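/- Let $k$ be a field and let $E=(E^0,E^1,r,s)$ be a finite quiver. Let $P(E)$ be its path $k$-algebra (paths $e_1\cdots e_n$ with $r(e_t)=s(e_{t+1})$ and trivial paths $p_v$, $v\in E^0$, as basis, concatenation as product), let $\overline{E}$ be the inverse quiver, with an arrow $\overline{e}$ from $r(e)$ to $s(e)$ for each $e\in E^1$, and let $L(E)$ be the Leavitt path algebra, i.e. the unital $k$-algebra with $1=\sum_{v}p_v$ generated by $p_v$ ($v\in E^0$) and $e,\overline{e}$ ($e\in E^1$) subject to $p_vp_{v'}=\delta_{v,v'}p_v$; $p_{s(e)}e=ep_{r(e)}=e$; $p_{r(e)}\overline{e}=\overline{e}p_{s(e)}=\overline{e}$; $\overline{e}e'=\delta_{e,e'}p_{r(e)}$; and $p_v=\sum_{s(e)=v}e\overline{e}$ for every $v$ that emits arrows. There are natural homomorphisms $P(E)\to L(E)\leftarrow P(\overline{E})$, along which $L(E)$-modules are regarded as $P(E)$- and $P(\overline{E})$-modules. All modules are left modules. A $P(E)$-module $M$ is a Blanchfield module if $\mathrm{Tor}^{P(E)}_q(k^{E^0},M)=0$ for all $q\ge 0$, where $k^{E^0}$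 is a right $P(E)$-module through the augmentation $P(E)\to k^{E^0}$ (which kills all arrows). Every Blanchfield $P(E)$-module has a unique structure of $L(E)$-module extending its $P(E)$-module structure, and is regarded as an $L(E)$-module in this way. A lattice in a finitely generated Blanchfield $P(E)$-module $M$ is a $P(\overline{E})$-submodule $A\subseteq M$ that is finite-dimensional over $k$ and satisfies $M=P(E)A$. (1) Let $M$ be an $L(E)$-module. Then $M$ is a finitely generated Blanchfield $P(E)$-module if and only if $M$ is a finitely presented $L(E)$-module of finite length without nonzero projective $L(E)$-submodules. (2) Let $M$ be a finitely generated Blanchfield $P(E)$-module. Then $M$ contains a lattice. Moreover, a $P(\overline{E})$-submodule $A$ of $M$ is a lattice if and only if $A$ is finite-dimensional over $k$ and the natural map $L(E)\otimes_{P(\overline{E})}A\to M$ is an isomorphism. Furthermore, no lattice in $M$ contains a nonzero projective $P(\overline{E})$-submodule. (3) Every finitely generated Blanchfield $P(E)$-module contains a smallest lattice, that is, a lattice contained in every lattice. -/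

import Mathlib

universe u w

noncomputable section

open CategoryTheory TensorProduct

/-! ## Tensor products and Tor over a ring that need not be commutative -/

namespace NCTensor

universe v

variable (R : Type u) [Ring R]

/-- The subgroup of `X ⊗[ℤ] M` generated by the elements `x r ⊗ m - x ⊗ r m`, for a right `R`-module
`X` (that is, a module over the opposite ring) and a left `R`-module `M`. -/
def relations (X : Type v) [AddCommGroup X] [Module Rᵐᵒᵖ X] (M : Type w) [AddCommGroup M]
    [Module R M] : AddSubgroup (X ⊗[ℤ] M) :=
  AddSubgroup.closure
    {t | ∃ (x : X) (r : R) (m : M), t = (MulOpposite.op r • x) ⊗ₜ[ℤ] m - x ⊗ₜ[ℤ] (r • m)}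

/-- The abelian group `X ⊗_R M`, for a right `R`-module `X` and a left `R`-module `M`. -/
abbrev Tensor (X : Type v) [AddCommGroup X] [Module Rᵐᵒᵖ X] (M : Type w) [AddCommGroup M]
    [Module R M] : Type (max v w) :=
  (X ⊗[ℤ] M) ⧸ relations R X M

/-- The element `x ⊗ m` of `X ⊗_R M`. -/
def Tensor.tmul {X : Type v} [AddCommGroup X] [Module Rᵐᵒᵖ X] {M : Type w} [AddCommGroup M]
    [Module R M] (x : X) (m : M) : Tensor R X M :=
  QuotientAddGroup.mk' (relations R X M) (x ⊗ₜ[ℤ] m)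

section

variable {R}

theorem Tensor.add_tmul {X : Type v} [AddCommGroup X] [Module Rᵐᵒᵖ X] {M : Type w}
    [AddCommGroup M] [Module R M] (x y : X) (m : M) :
    Tensor.tmul R (x + y) m = Tensor.tmul R x m + Tensor.tmul R y m := by
  rw [Tensor.tmul, TensorProduct.add_tmul, map_add]
  rfl

theorem Tensor.tmul_add {X : Type v} [AddCommGroup X] [Module Rᵐᵒᵖ X] {M : Type w}
    [AddCommGroup M] [Module R M] (x : X) (m n : M) :
    Tensor.tmul R x (m + n) = Tensor.tmul R x m + Tensor.tmul R x n := by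
  rw [Tensor.tmul, TensorProduct.tmul_add, map_add]
  rfl

theorem Tensor.op_smul_tmul {X : Type v} [AddCommGroup X] [Module Rᵐᵒᵖ X] {M : Type w}
    [AddCommGroup M] [Module R M] (x : X) (r : R) (m : M) :
    Tensor.tmul R (MulOpposite.op r • x) m = Tensor.tmul R x (r • m) := by
  rw [← sub_eq_zero, Tensor.tmul, Tensor.tmul, ← map_sub]
  exact (QuotientAddGroup.eq_zero_iff _).mpr (AddSubgroup.subset_closure ⟨x, r, m, rfl⟩)

theorem Tensor.hom_ext {X : Type v} [AddCommGroup X] [Module Rᵐᵒᵖ X] {M : Type w}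
    [AddCommGroup M] [Module R M] {G : Type*} [AddCommGroup G] {f g : Tensor R X M →+ G}
    (h : ∀ (x : X) (m : M), f (Tensor.tmul R x m) = g (Tensor.tmul R x m)) : f = g := by
  refine QuotientAddGroup.addMonoidHom_ext _ (AddMonoidHom.ext fun t => ?_)
  induction t with
  | zero => rw [map_zero, map_zero]
  | tmul x m => exact h x m
  | add s t hs ht => rw [map_add, map_add, hs, ht]

/-- The homomorphism out of `X ⊗_R M` given by a biadditive map `f` with `f (x r) m = f x (r m)`. -/
def Tensor.lift {X : Type v} [AddCommGroup X] [Module Rᵐᵒᵖ X] {M : Type w} [AddCommGroup M]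
    [Module R M] {G : Type*} [AddCommGroup G] (f : X →+ M →+ G)
    (hf : ∀ (x : X) (r : R) (m : M), f (MulOpposite.op r • x) m = f x (r • m)) :
    Tensor R X M →+ G :=
  QuotientAddGroup.lift (relations R X M)
    (TensorProduct.liftAddHom f fun n x m => by
      rw [map_zsmul, map_zsmul, AddMonoidHom.zsmul_apply]) <| by
    rw [relations, AddSubgroup.closure_le]
    rintro _ ⟨x, r, m, rfl⟩
    refine AddMonoidHom.mem_ker.mpr ?_
    rw [map_sub, TensorProduct.liftAddHom_tmul, TensorProduct.liftAddHom_tmul, hf, sub_self]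

theorem Tensor.lift_tmul {X : Type v} [AddCommGroup X] [Module Rᵐᵒᵖ X] {M : Type w}
    [AddCommGroup M] [Module R M] {G : Type*} [AddCommGroup G] (f : X →+ M →+ G)
    (hf : ∀ (x : X) (r : R) (m : M), f (MulOpposite.op r • x) m = f x (r • m)) (x : X) (m : M) :
    Tensor.lift f hf (Tensor.tmul R x m) = f x m := rfl

/-- The functoriality of `X ⊗_R M` in the right module `X`. -/
def Tensor.map {X Y : Type v} [AddCommGroup X] [Module Rᵐᵒᵖ X] [AddCommGroup Y] [Module Rᵐᵒᵖ Y]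
    (f : X →ₗ[Rᵐᵒᵖ] Y) (M : Type w) [AddCommGroup M] [Module R M] :
    Tensor R X M →+ Tensor R Y M :=
  Tensor.lift
    (AddMonoidHom.mk' (fun x => AddMonoidHom.mk' (fun m => Tensor.tmul R (f x) m)
      (Tensor.tmul_add (f x))) fun x y => by
        ext m
        change Tensor.tmul R (f (x + y)) m = Tensor.tmul R (f x) m + Tensor.tmul R (f y) m
        rw [map_add, Tensor.add_tmul])
    fun x r m => by
      change Tensor.tmul R (f (MulOpposite.op r • x)) m = Tensor.tmul R (f x) (r • m)
      rw [map_smul, Tensor.op_smul_tmul]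

theorem Tensor.map_tmul {X Y : Type v} [AddCommGroup X] [Module Rᵐᵒᵖ X] [AddCommGroup Y]
    [Module Rᵐᵒᵖ Y] (f : X →ₗ[Rᵐᵒᵖ] Y) {M : Type w} [AddCommGroup M] [Module R M] (x : X) (m : M) :
    Tensor.map f M (Tensor.tmul R x m) = Tensor.tmul R (f x) m := rfl

end

/-- The functor `- ⊗_R M` from right `R`-modules to abelian groups. -/
def tensorFunctor (M : Type w) [AddCommGroup M] [Module R M] :
    ModuleCat.{u} Rᵐᵒᵖ ⥤ AddCommGrpCat.{max u w} where
  obj X := AddCommGrpCat.of (Tensor R X M)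
  map f := AddCommGrpCat.ofHom (Tensor.map f.hom M)
  map_id X := by
    ext : 1
    exact Tensor.hom_ext fun _ _ => rfl
  map_comp f g := by
    ext : 1
    exact Tensor.hom_ext fun _ _ => rfl

instance (M : Type w) [AddCommGroup M] [Module R M] : (tensorFunctor R M).Additive where
  map_add {X Y f g} := by
    ext : 1
    exact Tensor.hom_ext fun x m => Tensor.add_tmul (f.hom x) (g.hom x) m

/-- `Tor_q^R(X, M)`, as the `q`-th left derived functor of `- ⊗_R M` applied to the right module
`X`. -/
def Tor (q : ℕ) (X : Type u) [AddCommGroup X] [Module Rᵐᵒᵖ X] (M : Type w) [AddCommGroup M]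
    [Module R M] : AddCommGrpCat.{max u w} :=
  ((tensorFunctor R M).leftDerived q).obj (ModuleCat.of Rᵐᵒᵖ X)

end NCTensor

/-! ## Path algebras -/

/-- The set of all paths of a quiver, with arbitrary source and target. -/
abbrev QuiverPath (V : Type) [Quiver.{0} V] : Type := Σ a b : V, Quiver.Path a b

/-- The path algebra `P(E)` over `k` of a quiver `E` with set of vertices `V`: the `k`-vector space
with the set of all paths as basis. Its multiplication is concatenation of paths: a path from `a` to
`b` times a path from `b` to `c` is the composite path from `a` to `c`, and products of
non-composable paths are zero. -/
def PathAlgebra (k : Type u) [Field k] (V : Type) [Quiver.{0} V] : Type u := QuiverPath V →₀ k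

namespace PathAlgebra

instance fintypeOpposite (V : Type) [Fintype V] : Fintype Vᵒᵖ :=
  Fintype.ofEquiv V Opposite.equivToOpposite

variable {k : Type u} [Field k] {V : Type} [Quiver.{0} V]

instance : AddCommGroup (PathAlgebra k V) := inferInstanceAs (AddCommGroup (QuiverPath V →₀ k))

instance : Module k (PathAlgebra k V) := inferInstanceAs (Module k (QuiverPath V →₀ k))

/-- The basis element of the path algebra given by a path. -/
def ofPath (x : QuiverPath V) : PathAlgebra k V := Finsupp.single x (1 : k)

open Classical in
/-- The product of two paths in the path algebra. -/
def pathMul (x y : QuiverPath V) : PathAlgebra k V :=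
  if h : x.2.1 = y.1 then ofPath ⟨x.1, y.2.1, (x.2.2.cast rfl h).comp y.2.2⟩ else 0

/-- The `k`-linear map out of the path algebra with prescribed values on paths. -/
def linearLift {W : Type*} [AddCommGroup W] [Module k W] (f : QuiverPath V → W) :
    PathAlgebra k V →ₗ[k] W :=
  Finsupp.linearCombination k f

/-- Multiplication in the path algebra, as a bilinear map. -/
def mulLin : PathAlgebra k V →ₗ[k] PathAlgebra k V →ₗ[k] PathAlgebra k V :=
  linearLift fun x => linearLift fun y => pathMul x y

@[simp]
theorem linearLift_ofPath {W : Type*} [AddCommGroup W] [Module k W] (f : QuiverPath V → W)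
    (x : QuiverPath V) : linearLift f (ofPath x : PathAlgebra k V) = f x :=
  (Finsupp.linearCombination_single k (1 : k) x).trans (one_smul k (f x))

theorem linear_ext {W : Type*} [AddCommGroup W] [Module k W] {f g : PathAlgebra k V →ₗ[k] W}
    (h : ∀ x, f (ofPath x) = g (ofPath x)) : f = g :=
  Finsupp.lhom_ext' fun x => LinearMap.ext_ring (h x)

theorem pathMul_comp {a b c : V} (p : Quiver.Path a b) (q : Quiver.Path b c) :
    (pathMul ⟨a, b, p⟩ ⟨b, c, q⟩ : PathAlgebra k V) = ofPath ⟨a, c, p.comp q⟩ := by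
  simp [pathMul]

theorem pathMul_of_ne {x y : QuiverPath V} (h : x.2.1 ≠ y.1) :
    (pathMul x y : PathAlgebra k V) = 0 := by
  simp [pathMul, h]

instance : Mul (PathAlgebra k V) := ⟨fun f g => mulLin f g⟩

theorem mul_def (f g : PathAlgebra k V) : f * g = mulLin f g := rfl

theorem ofPath_mul_ofPath (x y : QuiverPath V) :
    (ofPath x * ofPath y : PathAlgebra k V) = pathMul x y := by
  simp [mul_def, mulLin]

theorem mul_assoc_aux (f g h : PathAlgebra k V) : f * g * h = f * (g * h) := by
  have key : (LinearMap.llcomp k _ _ _ (mulLin (k := k) (V := V))).comp mulLin =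
      (LinearMap.llcomp k (PathAlgebra k V) (PathAlgebra k V →ₗ[k] PathAlgebra k V)
        (PathAlgebra k V →ₗ[k] PathAlgebra k V)).flip mulLin ∘ₗ
        (LinearMap.llcomp k (PathAlgebra k V) (PathAlgebra k V) (PathAlgebra k V)) ∘ₗ mulLin := by
    refine linear_ext fun x => linear_ext fun y => linear_ext fun z => ?_
    change (ofPath x * ofPath y) * ofPath z = ofPath x * (ofPath y * ofPath z)
    obtain ⟨a, b, p⟩ := x
    obtain ⟨b', c, q⟩ := y
    obtain ⟨c', d, r⟩ := z
    by_cases hb : b = b'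
    · subst hb
      by_cases hc : c = c'
      · subst hc
        simp only [ofPath_mul_ofPath, pathMul_comp, Quiver.Path.comp_assoc]
      · rw [ofPath_mul_ofPath, ofPath_mul_ofPath, pathMul_comp, ofPath_mul_ofPath,
          pathMul_of_ne hc, pathMul_of_ne hc, mul_def, map_zero]
    · rw [ofPath_mul_ofPath, pathMul_of_ne hb, mul_def, map_zero, LinearMap.zero_apply]
      by_cases hc : c = c'
      · subst hc
        rw [ofPath_mul_ofPath, pathMul_comp, ofPath_mul_ofPath, pathMul_of_ne hb]
      · rw [ofPath_mul_ofPath, pathMul_of_ne hc, mul_def, map_zero]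
  exact LinearMap.congr_fun (LinearMap.congr_fun (LinearMap.congr_fun key f) g) h

variable [Fintype V]

instance : One (PathAlgebra k V) := ⟨∑ v : V, ofPath ⟨v, v, Quiver.Path.nil⟩⟩

theorem one_def : (1 : PathAlgebra k V) = ∑ v : V, ofPath ⟨v, v, Quiver.Path.nil⟩ := rfl

theorem one_mul_aux (f : PathAlgebra k V) : 1 * f = f := by
  have key : mulLin (1 : PathAlgebra k V) = LinearMap.id := by
    refine linear_ext fun x => ?_
    obtain ⟨a, b, p⟩ := x
    rw [one_def, map_sum, LinearMap.sum_apply, Finset.sum_eq_single a]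
    · rw [← mul_def, ofPath_mul_ofPath, pathMul_comp, Quiver.Path.nil_comp]; rfl
    · intro c _ hc
      rw [← mul_def, ofPath_mul_ofPath, pathMul_of_ne hc]
    · simp
  exact LinearMap.congr_fun key f

theorem mul_one_aux (f : PathAlgebra k V) : f * 1 = f := by
  have key : mulLin.flip (1 : PathAlgebra k V) = LinearMap.id := by
    refine linear_ext fun x => ?_
    obtain ⟨a, b, p⟩ := x
    rw [one_def, map_sum, LinearMap.sum_apply, Finset.sum_eq_single b]
    · rw [LinearMap.flip_apply, ← mul_def, ofPath_mul_ofPath, pathMul_comp,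
        Quiver.Path.comp_nil]; rfl
    · intro c _ hc
      rw [LinearMap.flip_apply, ← mul_def, ofPath_mul_ofPath, pathMul_of_ne hc.symm]
    · simp
  exact LinearMap.congr_fun key f

instance : Ring (PathAlgebra k V) :=
  { (inferInstance : AddCommGroup (PathAlgebra k V)) with
    mul := (· * ·)
    one := 1
    mul_assoc := mul_assoc_aux
    one_mul := one_mul_aux
    mul_one := mul_one_aux
    left_distrib := fun f g h => map_add (mulLin f) g h
    right_distrib := fun f g h => LinearMap.map_add₂ mulLin f g h
    zero_mul := fun f => LinearMap.map_zero₂ mulLin f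
    mul_zero := fun f => map_zero (mulLin f) }

instance : Algebra k (PathAlgebra k V) :=
  Algebra.ofModule (fun c f g => LinearMap.map_smul₂ mulLin c f g)
    (fun c f g => map_smul (mulLin f) c g)

/-- The idempotent `p_v` of a vertex `v`, that is, the trivial path at `v`. -/
def vertex (k : Type u) [Field k] (v : V) : PathAlgebra k V := ofPath ⟨v, v, Quiver.Path.nil⟩

/-- The element of the path algebra given by an arrow. -/
def arrow (k : Type u) [Field k] {v w : V} (e : v ⟶ w) : PathAlgebra k V :=
  ofPath ⟨v, w, e.toPath⟩

/-- The image of a path in a ring, given the images of vertices and arrows: the product of the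
images of the successive arrows, preceded by the image of the source vertex. -/
def evalPath {A : Type*} [Ring A] {V : Type} [Quiver.{0} V] (p : V → A)
    (x : ∀ {v w : V}, (v ⟶ w) → A) {a : V} : ∀ {b : V}, Quiver.Path a b → A
  | _, .nil => p a
  | _, .cons q e => evalPath p x q * x e

/-- The relations that images `p v` of the vertices and `x e` of the arrows in an algebra have to
satisfy in order to define a homomorphism out of the path algebra. -/
structure IsPathFamily {A : Type*} [Ring A] (p : V → A) (x : ∀ {v w : V}, (v ⟶ w) → A) :
    Prop where
  idem : ∀ v, p v * p v = p v
  orthogonal : ∀ v w, v ≠ w → p v * p w = 0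
  sum_eq_one : ∑ v, p v = 1
  source_mul : ∀ {v w : V} (e : v ⟶ w), p v * x e = x e
  mul_target : ∀ {v w : V} (e : v ⟶ w), x e * p w = x e

section lift

variable {A : Type*} [Ring A] [Algebra k A] {p : V → A} {x : ∀ {v w : V}, (v ⟶ w) → A}

theorem source_mul_evalPath (h : IsPathFamily p x) {a b : V} (q : Quiver.Path a b) :
    p a * evalPath p x q = evalPath p x q := by
  induction q with
  | nil => exact h.idem a
  | cons q e ih => rw [evalPath, ← mul_assoc, ih]

theorem evalPath_mul_target (h : IsPathFamily p x) {a b : V} (q : Quiver.Path a b) :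
    evalPath p x q * p b = evalPath p x q := by
  cases q with
  | nil => exact h.idem a
  | cons q e => rw [evalPath, mul_assoc, h.mul_target]

theorem evalPath_comp (h : IsPathFamily p x) {a b c : V} (q : Quiver.Path a b)
    (q' : Quiver.Path b c) : evalPath p x (q.comp q') = evalPath p x q * evalPath p x q' := by
  induction q' with
  | nil => exact (evalPath_mul_target h q).symm
  | cons q' e ih => rw [Quiver.Path.comp_cons, evalPath, ih, evalPath, mul_assoc]

/-- The algebra homomorphism out of the path algebra with prescribed images of vertices and
arrows. -/
def lift (h : IsPathFamily p x) : PathAlgebra k V →ₐ[k] A :=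
  AlgHom.ofLinearMap (linearLift fun y => evalPath p x y.2.2)
    (by
      rw [one_def, map_sum, ← h.sum_eq_one]
      exact Finset.sum_congr rfl fun v _ => by rw [linearLift_ofPath]; rfl)
    (by
      set φ : PathAlgebra k V →ₗ[k] A := linearLift fun y => evalPath p x y.2.2 with hφ
      have key : (LinearMap.llcomp k _ _ _ φ).comp mulLin =
          (LinearMap.mul k A).compl₁₂ φ φ := by
        refine linear_ext fun y => linear_ext fun z => ?_
        change φ (ofPath y * ofPath z) = φ (ofPath y) * φ (ofPath z)
        obtain ⟨a, b, q⟩ := y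
        obtain ⟨b', c, q'⟩ := z
        rw [ofPath_mul_ofPath, hφ, linearLift_ofPath, linearLift_ofPath]
        by_cases hb : b = b'
        · subst hb
          rw [pathMul_comp, linearLift_ofPath]
          exact evalPath_comp h q q'
        · rw [pathMul_of_ne hb, map_zero]
          change 0 = evalPath p x q * evalPath p x q'
          rw [← evalPath_mul_target h q, ← source_mul_evalPath h q', mul_assoc,
            ← mul_assoc (p b), h.orthogonal b b' hb, zero_mul, mul_zero]
      intro f g
      exact LinearMap.congr_fun (LinearMap.congr_fun key f) g)

end lift

open Classical in
/-- The augmentation `ε : P(E) → k^{E⁰}`, the algebra homomorphism that sends `p_v` to the `v`-th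
standard idempotent and all arrows to zero. -/
def augmentation (k : Type u) [Field k] (V : Type) [Quiver.{0} V] [Fintype V] :
    PathAlgebra k V →ₐ[k] (V → k) :=
  lift (p := fun v => Pi.single v 1) (x := fun _ => 0)
    { idem := fun v => by rw [← Pi.single_mul, one_mul]
      orthogonal := fun v w h => by
        ext i
        by_cases hi : i = v
        · subst hi; simp [h]
        · simp [hi]
      sum_eq_one := Finset.univ_sum_single (1 : V → k)
      source_mul := fun _ => mul_zero _
      mul_target := fun _ => zero_mul _ }

end PathAlgebra

/-- The vector space `k^{E⁰}`, regarded as a right module over the path algebra. -/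
def VertexModule (k : Type u) (V : Type) : Type u := V → k

namespace VertexModule

variable (k : Type u) [Field k] (V : Type) [Quiver.{0} V] [Fintype V]

instance : AddCommGroup (VertexModule k V) := inferInstanceAs (AddCommGroup (V → k))

/-- The right action of the path algebra on `k^{E⁰}` through the augmentation:
`x · a = x * ε a`. -/
instance : Module (PathAlgebra k V)ᵐᵒᵖ (VertexModule k V) :=
  letI : Module (V → k)ᵐᵒᵖ (VertexModule k V) := inferInstanceAs (Module (V → k)ᵐᵒᵖ (V → k))
  Module.compHom (VertexModule k V) (PathAlgebra.augmentation k V).toRingHom.op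

end VertexModule

/-- A left `P(E)`-module `M` is a Blanchfield module if `Tor_q^{P(E)}(k^{E⁰}, M) = 0` for all
`q ≥ 0`. -/
def IsBlanchfield (k : Type u) [Field k] (V : Type) [Quiver.{0} V] [Fintype V]
    (M : Type*) [AddCommGroup M] [Module (PathAlgebra k V) M] : Prop :=
  ∀ q : ℕ, Subsingleton (NCTensor.Tor (PathAlgebra k V) q (VertexModule k V) M)

/-! ## Leavitt path algebras -/

namespace LeavittPathAlgebra

/-- The generators `p_v`, `e` and `e̅` of the Leavitt path algebra. -/
inductive Generator (V : Type) [Quiver.{0} V] : Type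
  | vertex (v : V) : Generator V
  | arrow {v w : V} (e : v ⟶ w) : Generator V
  | ghost {v w : V} (e : v ⟶ w) : Generator V

/-- The free algebra on the generators `p_v`, `e` and `e̅`. -/
abbrev Free (k : Type u) [Field k] (V : Type) [Quiver.{0} V] : Type u :=
  FreeAlgebra k (Generator V)

variable (k : Type u) [Field k] (V : Type) [Quiver.{0} V] [Fintype V]
  [∀ v w : V, Fintype (v ⟶ w)]

/-- The generator `p_v` in the free algebra. -/
abbrev freeVertex {V : Type} [Quiver.{0} V] (v : V) : Free k V := FreeAlgebra.ι k (.vertex v)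

/-- The generator `e` in the free algebra. -/
abbrev freeArrow {V : Type} [Quiver.{0} V] {v w : V} (e : v ⟶ w) : Free k V :=
  FreeAlgebra.ι k (.arrow e)

/-- The generator `e̅` in the free algebra. -/
abbrev freeGhost {V : Type} [Quiver.{0} V] {v w : V} (e : v ⟶ w) : Free k V :=
  FreeAlgebra.ι k (.ghost e)

/-- The defining relations of the Leavitt path algebra. The relation `one` records that the unit of
the algebra is the sum of the vertices. -/
inductive Rel : Free k V → Free k V → Prop
  | one : Rel (∑ v : V, freeVertex k v) 1
  | vertex_mul_self (v : V) : Rel (freeVertex k v * freeVertex k v) (freeVertex k v)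
  | vertex_mul_of_ne (v w : V) (h : v ≠ w) : Rel (freeVertex k v * freeVertex k w) 0
  | source_mul_arrow {v w : V} (e : v ⟶ w) : Rel (freeVertex k v * freeArrow k e) (freeArrow k e)
  | arrow_mul_range {v w : V} (e : v ⟶ w) : Rel (freeArrow k e * freeVertex k w) (freeArrow k e)
  | range_mul_ghost {v w : V} (e : v ⟶ w) : Rel (freeVertex k w * freeGhost k e) (freeGhost k e)
  | ghost_mul_source {v w : V} (e : v ⟶ w) : Rel (freeGhost k e * freeVertex k v) (freeGhost k e)
  | ck1_self {v w : V} (e : v ⟶ w) : Rel (freeGhost k e * freeArrow k e) (freeVertex k w)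
  | ck1_of_ne {v w v' w' : V} (e : v ⟶ w) (e' : v' ⟶ w')
      (h : (⟨v, w, e⟩ : Σ a b : V, (a ⟶ b)) ≠ ⟨v', w', e'⟩) :
      Rel (freeGhost k e * freeArrow k e') 0
  | ck2 (v : V) (h : ∃ w : V, Nonempty (v ⟶ w)) :
      Rel (freeVertex k v) (∑ w : V, ∑ e : v ⟶ w, freeArrow k e * freeGhost k e)

end LeavittPathAlgebra

/-- The Leavitt path algebra `L(E)` over `k` of a finite quiver `E`. -/
def LeavittPathAlgebra (k : Type u) [Field k] (V : Type) [Quiver.{0} V] [Fintype V]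
    [∀ v w : V, Fintype (v ⟶ w)] : Type u :=
  RingQuot (LeavittPathAlgebra.Rel k V)

namespace LeavittPathAlgebra

section

variable (k : Type u) [Field k] (V : Type) [Quiver.{0} V] [Fintype V]
  [∀ v w : V, Fintype (v ⟶ w)]

instance : Ring (LeavittPathAlgebra k V) := inferInstanceAs (Ring (RingQuot (Rel k V)))

instance : Algebra k (LeavittPathAlgebra k V) := inferInstanceAs (Algebra k (RingQuot (Rel k V)))

/-- The quotient map from the free algebra to the Leavitt path algebra. -/
def mk : Free k V →ₐ[k] LeavittPathAlgebra k V := RingQuot.mkAlgHom k (Rel k V)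

variable {k V} in
theorem mk_eq {a b : Free k V} (h : Rel k V a b) : mk k V a = mk k V b :=
  RingQuot.mkAlgHom_rel k h

/-- The homomorphism `P(E) → L(E)` that sends `p_v` to `p_v` and `e` to `e`. -/
def ofPathAlgebra : PathAlgebra k V →ₐ[k] LeavittPathAlgebra k V :=
  PathAlgebra.lift (p := fun v => mk k V (freeVertex k v)) (x := fun e => mk k V (freeArrow k e))
    { idem := fun v => by rw [← map_mul]; exact mk_eq (.vertex_mul_self v)
      orthogonal := fun v w h => by
        rw [← map_mul, ← map_zero (mk k V)]; exact mk_eq (.vertex_mul_of_ne v w h)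
      sum_eq_one := by rw [← map_sum, ← map_one (mk k V)]; exact mk_eq .one
      source_mul := fun e => by rw [← map_mul]; exact mk_eq (.source_mul_arrow e)
      mul_target := fun e => by rw [← map_mul]; exact mk_eq (.arrow_mul_range e) }

/-- The homomorphism `P(E̅) → L(E)` that sends `p_v` to `p_v` and `e̅` to `e̅`. The inverse quiver `E̅`
is the opposite quiver `Vᵒᵖ`, in which an arrow `e` from `v` to `w` becomes an arrow from `w` to
`v`. -/
def ofInversePathAlgebra : PathAlgebra k Vᵒᵖ →ₐ[k] LeavittPathAlgebra k V :=
  PathAlgebra.lift (p := fun v => mk k V (freeVertex k v.unop))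
    (x := fun e => mk k V (freeGhost k e.unop))
    { idem := fun v => by rw [← map_mul]; exact mk_eq (.vertex_mul_self v.unop)
      orthogonal := fun v w h => by
        rw [← map_mul, ← map_zero (mk k V)]
        exact mk_eq (.vertex_mul_of_ne v.unop w.unop fun h' => h (Opposite.unop_injective h'))
      sum_eq_one := by
        rw [← map_sum, ← map_one (mk k V), ← mk_eq (Rel.one (k := k) (V := V))]
        exact congrArg (mk k V) (Equiv.sum_comp Opposite.equivToOpposite.symm
          (fun v : V => freeVertex k v))
      source_mul := fun e => by rw [← map_mul]; exact mk_eq (.range_mul_ghost e.unop)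
      mul_target := fun e => by rw [← map_mul]; exact mk_eq (.ghost_mul_source e.unop) }

/-- `L(E)` as a left `P(E)`-module. -/
instance : Module (PathAlgebra k V) (LeavittPathAlgebra k V) :=
  Module.compHom _ (ofPathAlgebra k V).toRingHom

/-- `L(E)` as a left `P(E̅)`-module. -/
instance : Module (PathAlgebra k Vᵒᵖ) (LeavittPathAlgebra k V) :=
  Module.compHom _ (ofInversePathAlgebra k V).toRingHom

/-- `L(E)` as a right `P(E̅)`-module. -/
instance : Module (PathAlgebra k Vᵒᵖ)ᵐᵒᵖ (LeavittPathAlgebra k V) :=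
  Module.compHom _ (ofInversePathAlgebra k V).toRingHom.op

theorem smul_def (a : PathAlgebra k Vᵒᵖ) (l : LeavittPathAlgebra k V) :
    a • l = ofInversePathAlgebra k V a * l := rfl

theorem op_smul_def (a : PathAlgebra k Vᵒᵖ) (l : LeavittPathAlgebra k V) :
    MulOpposite.op a • l = l * ofInversePathAlgebra k V a := rfl

end

section modules

variable {k : Type u} [Field k] {V : Type} [Quiver.{0} V] [Fintype V]
  [∀ v w : V, Fintype (v ⟶ w)]
  {M : Type*} [AddCommGroup M] [Module (LeavittPathAlgebra k V) M]
  [Module (PathAlgebra k Vᵒᵖ) M] [IsScalarTower (PathAlgebra k Vᵒᵖ) (LeavittPathAlgebra k V) M]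

/-- The natural map `L(E) ⊗_{P(E̅)} A → M`, `l ⊗ a ↦ l a`, for a `P(E̅)`-submodule `A` of an
`L(E)`-module `M`. -/
def tensorToModule (A : Submodule (PathAlgebra k Vᵒᵖ) M) :
    NCTensor.Tensor (PathAlgebra k Vᵒᵖ) (LeavittPathAlgebra k V) A →+ M :=
  NCTensor.Tensor.lift
    (AddMonoidHom.mk' (fun l => AddMonoidHom.mk' (fun a : A => l • (a : M))
      fun a a' => by rw [Submodule.coe_add, smul_add])
      fun l l' => AddMonoidHom.ext fun a => add_smul l l' (a : M))
    fun l r a => by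
      change (MulOpposite.op r • l) • (a : M) = l • (r • (a : M))
      rw [op_smul_def, mul_smul, ← smul_one_smul (LeavittPathAlgebra k V) r (a : M), smul_def,
        mul_one]

/-- A lattice in a module `M`: a `P(E̅)`-submodule `A` of `M` which is finite-dimensional over `k` and
satisfies `M = P(E) A`. -/
structure IsLattice [Module k M] [IsScalarTower k (PathAlgebra k Vᵒᵖ) M]
    [Module (PathAlgebra k V) M] (A : Submodule (PathAlgebra k Vᵒᵖ) M) : Prop where
  finiteDimensional : FiniteDimensional k A
  span_eq_top : Submodule.span (PathAlgebra k V) (A : Set M) = ⊤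

end modules

end LeavittPathAlgebra

/-- The class of finitely presented `R`-modules of finite length without nonzero projective
submodules. -/
structure IsFNP (R : Type*) [Ring R] (M : Type*) [AddCommGroup M] [Module R M] : Prop where
  finitePresentation : Module.FinitePresentation R M
  isFiniteLength : IsFiniteLength R M
  eq_bot_of_projective : ∀ N : Submodule R M, Module.Projective R N → N = ⊥

end

set_option linter.unusedSectionVars false

/-! The proof rests on the reconstruction identity `sum_smul`: in an L(E)-module, y = ∑ e(e̅y) + ∑
p_v y, the second sum over the sinks. The elements e̅, called ghosts below, take y apart, and the
arrows put it together again; conversely e̅e' = δ p_{r(e)} lets a ghost undo an arrow.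

Blanchfield modules: the right module k^{E⁰} has the projective resolution 0 → ⨁ p_{r(e)}P(E) → P(E)
→ k^{E⁰} → 0. Hence M is Blanchfield iff (m_e) ↦ ∑ e m_e is a bijection ⨁ p_{r(e)}M → M
(`PathAlgebra.isBlanchfield_iff`). The components of its inverse are the only possible ghosts, so
the L(E)-structure exists and is unique. An L(E)-module is Blanchfield iff the sinks act as zero
(`isBlanchfield_iff_sink`).

Lattices: let B be a subspace stable under vertices and ghosts that generates M over L(E). Long
ghost words move every element of M into B (`IsGhostStable.exists_mem_eventual`), and reconstruction
then puts it into P(E)B. If the element lies in a submodule N, it is rebuilt from B ∩ N. Therefore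
L(E) ⊗ A → M is injective for every A; two lattices meet in a lattice, so one of least dimension is
contained in all; N ↦ B ∩ N is strictly monotone, so M has finite length if B is finite-dimensional;
and M is presented by the action of vertices and ghosts on a basis of B. Such a B is found by
applying all paths of bounded length to generators.

Projective submodules: ghosts have degree -1, and when sinks act as zero they have no common zero.
In a projective module, the coordinates of a finite-dimensional subspace have bounded degrees, so
repeated lowering would leave this range without reaching zero
(`Submodule.eq_bot_of_projective_of_degree`).

Converse: let M be finitely presented without nonzero projective submodules, and let W_D be the span
of the β̅x for generators x and paths β of length at most D. If D bounds the relations and c = p_v c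
lies in W_{D+1} but not in W_D, the relations are too short to constrain c: it can be exchanged for
a free generator of L(E)p_v. The exchange takes place in a module of germs of functions on paths
(`mul_vtx_eq_zero_of_smul_eq_zero`). Thus lc = 0 implies lp_v = 0, so L(E)c is projective and c = 0,
a contradiction. Hence W_D is ghost-stable and M = P(E)W_D. The same argument at a sink v gives p_v
M = 0. -/

noncomputable section

/-! ### Generators, relations and the universal property of L(E) -/

/-- The arrows of a quiver, bundled with their source and target. -/
abbrev QuiverArrow (V : Type) [Quiver.{0} V] : Type := Σ a b : V, (a ⟶ b)

namespace QuiverArrow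

variable {V : Type} [Quiver.{0} V]

/-- The source of an arrow. -/
abbrev src (e : QuiverArrow V) : V := e.1

/-- The target of an arrow. -/
abbrev tgt (e : QuiverArrow V) : V := e.2.1

end QuiverArrow

/-- A sink of a quiver is a vertex that does not emit arrows. -/
def IsQuiverSink {V : Type} [Quiver.{0} V] (v : V) : Prop := ∀ e : QuiverArrow V, e.src ≠ v

namespace LeavittPathAlgebra

open scoped Classical in
/-- The images of the generators of a Leavitt path algebra in an algebra. The last two relations of
Cuntz and Krieger are combined into the decomposition of the unit `sum_arr_gho`. -/
structure IsFamily {V : Type} [Quiver.{0} V] [Fintype V] [∀ v w : V, Fintype (v ⟶ w)]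
    {A : Type*} [Ring A] (p : V → A) (x y : QuiverArrow V → A) : Prop where
  idem : ∀ v, p v * p v = p v
  orthogonal : ∀ v w, v ≠ w → p v * p w = 0
  sum_eq_one : ∑ v, p v = 1
  src_mul : ∀ e, p e.src * x e = x e
  mul_tgt : ∀ e, x e * p e.tgt = x e
  tgt_mul : ∀ e, p e.tgt * y e = y e
  mul_src : ∀ e, y e * p e.src = y e
  gho_mul_arr : ∀ e e', y e * x e' = if e = e' then p e.tgt else 0
  sum_arr_gho : ∑ e, x e * y e + ∑ v, (if IsQuiverSink v then p v else 0) = 1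

namespace IsFamily

variable {V : Type} [Quiver.{0} V] [Fintype V] [∀ v w : V, Fintype (v ⟶ w)]
  {A : Type*} [Ring A] {p : V → A} {x y : QuiverArrow V → A}

theorem mul_src_of_ne (h : IsFamily p x y) {v : V} {e : QuiverArrow V} (hv : v ≠ e.src) :
    p v * x e = 0 := by
  rw [← h.src_mul, ← mul_assoc, h.orthogonal _ _ hv, zero_mul]

/-- Multiplying `sum_arr_gho` on the left by `p v` keeps only the arrows with source `v`; no sink
term survives, because `v` emits an arrow. -/
theorem ck2 (h : IsFamily p x y) (v : V) (hv : ∃ w : V, Nonempty (v ⟶ w)) :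
    p v = ∑ w : V, ∑ e : v ⟶ w, x ⟨v, w, e⟩ * y ⟨v, w, e⟩ := by
  classical
  obtain ⟨w₀, ⟨e₀⟩⟩ := hv
  have h0 := congrArg (p v * ·) h.sum_arr_gho
  simp only [mul_add, mul_one, Finset.mul_sum] at h0
  rw [← h0, Finset.sum_eq_zero (s := Finset.univ (α := V)), add_zero, Fintype.sum_sigma,
    Finset.sum_eq_single v, Fintype.sum_sigma]
  · exact Finset.sum_congr rfl fun w _ => Finset.sum_congr rfl fun e _ => by
      rw [← mul_assoc, h.src_mul ⟨v, w, e⟩]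
  · intro a _ ha
    refine Finset.sum_eq_zero fun e _ => ?_
    rw [← mul_assoc, h.mul_src_of_ne (e := ⟨a, e⟩) ha.symm, zero_mul]
  · simp
  · intro a _
    split_ifs with hs
    · exact h.orthogonal _ _ fun hva => hs ⟨v, w₀, e₀⟩ hva
    · rw [mul_zero]

variable {k : Type u} [Field k] [Algebra k A]

/-- The values of a homomorphism out of the free algebra on the generators. -/
def onGenerators (p : V → A) (x y : QuiverArrow V → A) : Generator V → A
  | .vertex v => p v
  | .arrow e => x ⟨_, _, e⟩
  | .ghost e => y ⟨_, _, e⟩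

/-- The algebra homomorphism out of the Leavitt path algebra given by the images of the
generators. -/
def lift (h : IsFamily p x y) : LeavittPathAlgebra k V →ₐ[k] A :=
  RingQuot.liftAlgHom k ⟨FreeAlgebra.lift k (onGenerators p x y), by
    intro a b hab
    induction hab with
    | one => simpa [onGenerators] using h.sum_eq_one
    | vertex_mul_self v => simpa [onGenerators] using h.idem v
    | vertex_mul_of_ne v w hvw => simpa [onGenerators] using h.orthogonal v w hvw
    | source_mul_arrow e => simpa [onGenerators] using h.src_mul ⟨_, _, e⟩
    | arrow_mul_range e => simpa [onGenerators] using h.mul_tgt ⟨_, _, e⟩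
    | range_mul_ghost e => simpa [onGenerators] using h.tgt_mul ⟨_, _, e⟩
    | ghost_mul_source e => simpa [onGenerators] using h.mul_src ⟨_, _, e⟩
    | ck1_self e => simpa [onGenerators] using h.gho_mul_arr ⟨_, _, e⟩ ⟨_, _, e⟩
    | ck1_of_ne e e' hee =>
      rw [map_mul, map_zero, FreeAlgebra.lift_ι_apply, FreeAlgebra.lift_ι_apply]
      exact (h.gho_mul_arr _ _).trans (if_neg hee)
    | ck2 v hv => simpa [onGenerators] using h.ck2 v hv⟩

end IsFamily

variable (k : Type u) [Field k] {V : Type} [Quiver.{0} V] [Fintype V]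
  [∀ v w : V, Fintype (v ⟶ w)]

/-- The element `p_v` of the Leavitt path algebra. -/
def vtx (v : V) : LeavittPathAlgebra k V := mk k V (freeVertex k v)

/-- The element `e` of the Leavitt path algebra. -/
def arr (e : QuiverArrow V) : LeavittPathAlgebra k V := mk k V (freeArrow k e.2.2)

/-- The element `e̅` of the Leavitt path algebra. -/
def gho (e : QuiverArrow V) : LeavittPathAlgebra k V := mk k V (freeGhost k e.2.2)

theorem isFamily : IsFamily (vtx k : V → _) (arr k) (gho k) := by
  classical
  have horth : ∀ v w : V, v ≠ w → vtx k v * vtx k w = 0 := fun v w h =>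
    ((map_mul _ _ _).symm.trans (mk_eq (.vertex_mul_of_ne v w h))).trans (map_zero (mk k V))
  have hone : ∑ v : V, vtx k v = 1 :=
    ((map_sum (mk k V) _ _).symm.trans (mk_eq .one)).trans (map_one (mk k V))
  have hsrc : ∀ e : QuiverArrow V, vtx k e.src * arr k e = arr k e := fun e =>
    (map_mul _ _ _).symm.trans (mk_eq (.source_mul_arrow e.2.2))
  refine ⟨fun v => (map_mul _ _ _).symm.trans (mk_eq (.vertex_mul_self v)), horth, hone, hsrc,
    fun e => (map_mul _ _ _).symm.trans (mk_eq (.arrow_mul_range e.2.2)),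
    fun e => (map_mul _ _ _).symm.trans (mk_eq (.range_mul_ghost e.2.2)),
    fun e => (map_mul _ _ _).symm.trans (mk_eq (.ghost_mul_source e.2.2)), fun e e' => ?_, ?_⟩
  · split_ifs with h
    · subst h
      exact (map_mul _ _ _).symm.trans (mk_eq (.ck1_self e.2.2))
    · exact ((map_mul _ _ _).symm.trans (mk_eq (.ck1_of_ne e.2.2 e'.2.2 h))).trans
        (map_zero (mk k V))
  · rw [Fintype.sum_sigma, ← Finset.sum_add_distrib, ← hone]
    refine Finset.sum_congr rfl fun v _ => ?_
    split_ifs with hv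
    · rw [Finset.sum_eq_zero fun e _ => absurd rfl (hv ⟨v, e⟩), zero_add]
    · have hv' : ∃ w : V, Nonempty (v ⟶ w) := by
        simp only [IsQuiverSink, not_forall, not_not] at hv
        obtain ⟨⟨a, b, e⟩, rfl⟩ := hv
        exact ⟨b, ⟨e⟩⟩
      rw [add_zero, Fintype.sum_sigma]
      refine Eq.trans ?_ (mk_eq (.ck2 v hv')).symm
      simp only [map_sum, map_mul]
      rfl

variable {k}

section lift

variable {A : Type*} [Ring A] [Algebra k A] {p : V → A} {x y : QuiverArrow V → A}

theorem IsFamily.lift_vtx (h : IsFamily p x y) (v : V) : h.lift (vtx k v) = p v :=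
  (RingQuot.liftAlgHom_mkAlgHom_apply k _ _ _).trans (FreeAlgebra.lift_ι_apply _ _)

theorem IsFamily.lift_arr (h : IsFamily p x y) (e : QuiverArrow V) : h.lift (arr k e) = x e :=
  (RingQuot.liftAlgHom_mkAlgHom_apply k _ _ _).trans (FreeAlgebra.lift_ι_apply _ _)

theorem IsFamily.lift_gho (h : IsFamily p x y) (e : QuiverArrow V) : h.lift (gho k e) = y e :=
  (RingQuot.liftAlgHom_mkAlgHom_apply k _ _ _).trans (FreeAlgebra.lift_ι_apply _ _)

theorem algHom_ext {f g : LeavittPathAlgebra k V →ₐ[k] A} (hv : ∀ v, f (vtx k v) = g (vtx k v))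
    (ha : ∀ e, f (arr k e) = g (arr k e)) (hg : ∀ e, f (gho k e) = g (gho k e)) : f = g := by
  refine RingQuot.ringQuot_ext' (S := k) _ _ (FreeAlgebra.hom_ext (funext fun t => ?_))
  cases t with
  | vertex v => exact hv v
  | arrow e => exact ha ⟨_, _, e⟩
  | ghost e => exact hg ⟨_, _, e⟩

end lift

/-- This serves as an induction principle: a property stable under sums, products and scalars need
only be checked on the generators. -/
theorem subalgebra_eq_top (S : Subalgebra k (LeavittPathAlgebra k V)) (hv : ∀ v, vtx k v ∈ S)
    (ha : ∀ e, arr k e ∈ S) (hg : ∀ e, gho k e ∈ S) : S = ⊤ := by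
  let F : Free k V →ₐ[k] S := FreeAlgebra.lift k fun t => match t with
    | .vertex v => ⟨vtx k v, hv v⟩
    | .arrow e => ⟨arr k ⟨_, _, e⟩, ha _⟩
    | .ghost e => ⟨gho k ⟨_, _, e⟩, hg _⟩
  have hF : S.val.comp F = mk k V := by
    refine FreeAlgebra.hom_ext (funext fun t => ?_)
    simp only [Function.comp_apply, AlgHom.comp_apply, F, FreeAlgebra.lift_ι_apply]
    cases t <;> rfl
  refine eq_top_iff.mpr fun l _ => ?_
  obtain ⟨a, rfl⟩ := RingQuot.mkAlgHom_surjective k (Rel k V) l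
  have : mk k V a ∈ S := by
    rw [← hF]
    exact (F a).2
  exact this

section relations

variable {Y : Type*} [AddCommGroup Y] [Module (LeavittPathAlgebra k V) Y]

-- The reconstruction identity. Together with `gho_smul_arr_smul` it carries almost every argument
-- below.
open scoped Classical in
theorem sum_smul (y : Y) : ∑ e : QuiverArrow V, arr k e • gho k e • y +
    ∑ v : V, (if IsQuiverSink v then vtx k v • y else 0) = y := by
  have h := congrArg (· • y) (isFamily k (V := V)).sum_arr_gho
  simpa only [add_smul, Finset.sum_smul, mul_smul, one_smul, ite_smul, zero_smul] using h

theorem sum_vtx_smul (y : Y) : ∑ v : V, vtx k v • y = y := by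
  rw [← Finset.sum_smul, (isFamily k).sum_eq_one, one_smul]

open scoped Classical in
theorem gho_smul_arr_smul (e e' : QuiverArrow V) (y : Y) :
    gho k e • arr k e' • y = if e = e' then vtx k e.tgt • y else 0 := by
  rw [smul_smul, (isFamily k).gho_mul_arr, ite_smul, zero_smul]

theorem vtx_smul_arr_smul_of_sink {v : V} (hv : IsQuiverSink v) (e : QuiverArrow V) (y : Y) :
    vtx k v • arr k e • y = 0 := by
  rw [smul_smul, (isFamily k).mul_src_of_ne (hv e).symm, zero_smul]

open scoped Classical in
theorem vtx_smul_gho_smul (v : V) (e : QuiverArrow V) (y : Y) :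
    vtx k v • gho k e • y = if v = e.tgt then gho k e • y else 0 := by
  rw [smul_smul]
  split_ifs with h
  · rw [h, (isFamily k).tgt_mul]
  · rw [← (isFamily k).tgt_mul, ← mul_assoc, (isFamily k).orthogonal _ _ h, zero_mul, zero_smul]

open scoped Classical in
theorem gho_smul_vtx_smul (v : V) (e : QuiverArrow V) (y : Y) :
    gho k e • vtx k v • y = if v = e.src then gho k e • y else 0 := by
  rw [smul_smul]
  split_ifs with h
  · rw [h, (isFamily k).mul_src]
  · rw [← (isFamily k).mul_src, mul_assoc, (isFamily k).orthogonal _ _ (Ne.symm h), mul_zero,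
      zero_smul]

open scoped Classical in
theorem vtx_smul_vtx_smul (v v' : V) (y : Y) :
    vtx k v • vtx k v' • y = if v = v' then vtx k v • y else 0 := by
  rw [smul_smul]
  split_ifs with h
  · rw [h, (isFamily k).idem]
  · rw [(isFamily k).orthogonal _ _ h, zero_smul]

end relations

section action

variable {Y : Type*} [AddCommGroup Y] [Module k Y] [Module (LeavittPathAlgebra k V) Y]
  [IsScalarTower k (LeavittPathAlgebra k V) Y]

/-- A `k`-subspace that is stable under the generators is stable under the whole Leavitt path
algebra. -/
theorem smul_mem_of_generators (N : Submodule k Y)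
    (hv : ∀ v : V, ∀ y ∈ N, vtx k v • y ∈ N)
    (ha : ∀ e : QuiverArrow V, ∀ y ∈ N, arr k e • y ∈ N)
    (hg : ∀ e : QuiverArrow V, ∀ y ∈ N, gho k e • y ∈ N)
    (l : LeavittPathAlgebra k V) {y : Y} (hy : y ∈ N) : l • y ∈ N := by
  let S : Subalgebra k (LeavittPathAlgebra k V) :=
    { carrier := {l | ∀ y ∈ N, l • y ∈ N}
      mul_mem' := fun {a b} ha hb y hy => by rw [mul_smul]; exact ha _ (hb _ hy)
      add_mem' := fun {a b} ha hb y hy => by rw [add_smul]; exact N.add_mem (ha _ hy) (hb _ hy)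
      algebraMap_mem' := fun c y hy => by
        rw [algebraMap_smul]; exact N.smul_mem c hy }
  have : l ∈ S := by
    rw [subalgebra_eq_top S (fun v => hv v) (fun e => ha e) fun e => hg e]
    trivial
  exact this y hy

/-- The submodule over the Leavitt path algebra given by a subspace that is stable under the
generators. -/
def submoduleOfGenerators (N : Submodule k Y)
    (hv : ∀ v : V, ∀ y ∈ N, vtx k v • y ∈ N)
    (ha : ∀ e : QuiverArrow V, ∀ y ∈ N, arr k e • y ∈ N)
    (hg : ∀ e : QuiverArrow V, ∀ y ∈ N, gho k e • y ∈ N) : Submodule (LeavittPathAlgebra k V) Y :=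
  { N.toAddSubmonoid with smul_mem' := fun l _ hy => smul_mem_of_generators N hv ha hg l hy }

end action

end LeavittPathAlgebra

end

/-! ### Ghost-stable subspaces and reconstruction from them -/

noncomputable section

namespace PathAlgebra

variable {k : Type u} [Field k] {V : Type} [Quiver.{0} V] [Fintype V]

theorem ofPath_cons {a b c : V} (q : Quiver.Path a b) (e : b ⟶ c) :
    (ofPath ⟨a, c, q.cons e⟩ : PathAlgebra k V) = ofPath ⟨a, b, q⟩ * arrow k e := by
  rw [arrow, ofPath_mul_ofPath, pathMul_comp]
  rfl

theorem subalgebra_eq_top (S : Subalgebra k (PathAlgebra k V)) (hv : ∀ v : V, vertex k v ∈ S)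
    (ha : ∀ {v w : V} (e : v ⟶ w), arrow k e ∈ S) : S = ⊤ := by
  have hp : ∀ {a b : V} (q : Quiver.Path a b), (ofPath ⟨a, b, q⟩ : PathAlgebra k V) ∈ S := by
    intro a b q
    induction q with
    | nil => exact hv a
    | cons q e ih => rw [ofPath_cons]; exact S.mul_mem ih (ha e)
  refine eq_top_iff.mpr fun x _ => ?_
  refine Finsupp.induction_linear (motive := fun x => (x : PathAlgebra k V) ∈ S) x S.zero_mem
    (fun f g hf hg => S.add_mem hf hg) fun y c => ?_
  have : (Finsupp.single y c : QuiverPath V →₀ k) = c • Finsupp.single y (1 : k) := by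
    rw [Finsupp.smul_single, smul_eq_mul, mul_one]
  rw [this]
  exact S.smul_mem (hp y.2.2) c

section lift

variable {A : Type*} [Ring A] [Algebra k A] {p : V → A} {x : ∀ {v w : V}, (v ⟶ w) → A}

theorem lift_vertex (h : IsPathFamily p x) (v : V) : lift h (vertex k v) = p v :=
  linearLift_ofPath _ _

theorem lift_arrow (h : IsPathFamily p x) {v w : V} (e : v ⟶ w) : lift h (arrow k e) = x e :=
  (linearLift_ofPath _ _).trans (h.source_mul e)

end lift

theorem isPathFamily :
    IsPathFamily (vertex k : V → PathAlgebra k V) (fun {_ _} e => arrow k e) where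
  idem v := by rw [vertex, ofPath_mul_ofPath, pathMul_comp, Quiver.Path.nil_comp]
  orthogonal v w h := by rw [vertex, vertex, ofPath_mul_ofPath, pathMul_of_ne h]
  sum_eq_one := rfl
  source_mul e := by
    rw [vertex, arrow, ofPath_mul_ofPath, pathMul_comp, Quiver.Path.nil_comp]
  mul_target e := by
    rw [vertex, arrow, ofPath_mul_ofPath, pathMul_comp, Quiver.Path.comp_nil]

section action

variable {Y : Type*} [AddCommGroup Y] [Module k Y] [Module (PathAlgebra k V) Y]
  [IsScalarTower k (PathAlgebra k V) Y]

/-- The submodule over the path algebra given by a subspace that is stable under vertices and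
arrows. -/
def submoduleOfGenerators (N : Submodule k Y) (hv : ∀ v : V, ∀ y ∈ N, vertex k v • y ∈ N)
    (ha : ∀ {v w : V} (e : v ⟶ w), ∀ y ∈ N, arrow k e • y ∈ N) :
    Submodule (PathAlgebra k V) Y :=
  { N.toAddSubmonoid with
    smul_mem' := fun l y hy => by
      let S : Subalgebra k (PathAlgebra k V) :=
        { carrier := {l | ∀ y ∈ N, l • y ∈ N}
          mul_mem' := fun {a b} ha hb y hy => by rw [mul_smul]; exact ha _ (hb _ hy)
          add_mem' := fun {a b} ha hb y hy => by
            rw [add_smul]; exact N.add_mem (ha _ hy) (hb _ hy)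
          algebraMap_mem' := fun c y hy => by rw [algebraMap_smul]; exact N.smul_mem c hy }
      have : l ∈ S := by
        rw [subalgebra_eq_top S (fun v => hv v) fun e => ha e]
        trivial
      exact this y hy }

end action

end PathAlgebra

namespace LeavittPathAlgebra

variable {k : Type u} [Field k] {V : Type} [Quiver.{0} V] [Fintype V]
  [∀ v w : V, Fintype (v ⟶ w)]

theorem ofPathAlgebra_vertex (v : V) : ofPathAlgebra k V (PathAlgebra.vertex k v) = vtx k v :=
  PathAlgebra.lift_vertex _ v

theorem ofPathAlgebra_arrow (e : QuiverArrow V) :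
    ofPathAlgebra k V (PathAlgebra.arrow k e.2.2) = arr k e :=
  PathAlgebra.lift_arrow _ e.2.2

theorem ofInversePathAlgebra_vertex (v : Vᵒᵖ) :
    ofInversePathAlgebra k V (PathAlgebra.vertex k v) = vtx k v.unop :=
  PathAlgebra.lift_vertex _ v

theorem ofInversePathAlgebra_arrow {a b : Vᵒᵖ} (e : a ⟶ b) :
    ofInversePathAlgebra k V (PathAlgebra.arrow k e) = gho k ⟨b.unop, a.unop, e.unop⟩ :=
  PathAlgebra.lift_arrow _ e

section towers

variable {Y : Type*} [AddCommGroup Y] [Module (LeavittPathAlgebra k V) Y]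

theorem ofPathAlgebra_smul [Module (PathAlgebra k V) Y]
    [IsScalarTower (PathAlgebra k V) (LeavittPathAlgebra k V) Y] (x : PathAlgebra k V) (y : Y) :
    ofPathAlgebra k V x • y = x • y := by
  rw [← smul_one_smul (LeavittPathAlgebra k V) x y]
  exact congrArg (· • y) (mul_one _).symm

theorem ofInversePathAlgebra_smul [Module (PathAlgebra k Vᵒᵖ) Y]
    [IsScalarTower (PathAlgebra k Vᵒᵖ) (LeavittPathAlgebra k V) Y] (x : PathAlgebra k Vᵒᵖ)
    (y : Y) : ofInversePathAlgebra k V x • y = x • y := by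
  rw [← smul_one_smul (LeavittPathAlgebra k V) x y]
  exact congrArg (· • y) (mul_one _).symm

theorem isScalarTower_of_inverse [Module (PathAlgebra k Vᵒᵖ) Y]
    [IsScalarTower (PathAlgebra k Vᵒᵖ) (LeavittPathAlgebra k V) Y] [Module k Y]
    [IsScalarTower k (PathAlgebra k Vᵒᵖ) Y] : IsScalarTower k (LeavittPathAlgebra k V) Y := by
  refine IsScalarTower.of_algebraMap_smul fun c y => ?_
  rw [← (ofInversePathAlgebra k V).commutes c, ofInversePathAlgebra_smul, algebraMap_smul]

end towers

variable {Y : Type*} [AddCommGroup Y] [Module k Y] [Module (LeavittPathAlgebra k V) Y]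
  [IsScalarTower k (LeavittPathAlgebra k V) Y]

variable (V) in
/-- A subspace of a module over the Leavitt path algebra that is stable under the vertices and
under the arrows of the inverse quiver. -/
structure IsGhostStable (B : Submodule k Y) : Prop where
  vtx_smul_mem : ∀ v : V, ∀ y ∈ B, vtx k v • y ∈ B
  gho_smul_mem : ∀ e : QuiverArrow V, ∀ y ∈ B, gho k e • y ∈ B

theorem isGhostStable_restrictScalars [Module (PathAlgebra k Vᵒᵖ) Y]
    [IsScalarTower (PathAlgebra k Vᵒᵖ) (LeavittPathAlgebra k V) Y]
    [IsScalarTower k (PathAlgebra k Vᵒᵖ) Y] (A : Submodule (PathAlgebra k Vᵒᵖ) Y) :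
    IsGhostStable V (A.restrictScalars k) := by
  refine ⟨fun v y hy => ?_, fun e y hy => ?_⟩
  · have := ofInversePathAlgebra_vertex (k := k) (Opposite.op v)
    rw [Opposite.unop_op] at this
    rw [← this, ofInversePathAlgebra_smul]
    exact A.smul_mem _ hy
  · have := ofInversePathAlgebra_arrow (k := k) e.2.2.op
    change _ = gho k e at this
    rw [← this, ofInversePathAlgebra_smul]
    exact A.smul_mem _ hy

/-- The submodule over the path algebra of the inverse quiver given by a stable subspace. -/
def IsGhostStable.toSubmodule [Module (PathAlgebra k Vᵒᵖ) Y]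
    [IsScalarTower (PathAlgebra k Vᵒᵖ) (LeavittPathAlgebra k V) Y]
    [IsScalarTower k (PathAlgebra k Vᵒᵖ) Y] {B : Submodule k Y} (hB : IsGhostStable V B) :
    Submodule (PathAlgebra k Vᵒᵖ) Y :=
  PathAlgebra.submoduleOfGenerators B
    (fun v y hy => by
      rw [← ofInversePathAlgebra_smul, ofInversePathAlgebra_vertex]
      exact hB.1 _ y hy)
    (fun e y hy => by
      rw [← ofInversePathAlgebra_smul, ofInversePathAlgebra_arrow]
      exact hB.2 _ y hy)

variable (V) in
/-- The elements of a module that all long paths in the inverse quiver, and all paths in the inverse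
quiver starting at a sink, move into the subspace `B`. -/
def eventual (B : Submodule k Y) : ℕ → Submodule k Y
  | 0 => B
  | n + 1 => (⨅ e : QuiverArrow V, (eventual B n).comap (Algebra.lsmul k k Y (gho k e))) ⊓
      ⨅ v : {v : V // IsQuiverSink v}, (eventual B n).comap (Algebra.lsmul k k Y (vtx k v.1))

theorem mem_eventual_succ {B : Submodule k Y} {n : ℕ} {y : Y} :
    y ∈ eventual V B (n + 1) ↔ (∀ e : QuiverArrow V, gho k e • y ∈ eventual V B n) ∧
      ∀ v : V, IsQuiverSink v → vtx k v • y ∈ eventual V B n := by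
  simp [eventual, Submodule.mem_iInf]

theorem IsGhostStable.eventual_le_succ_of_eventual {B : Submodule k Y} {n : ℕ}
    (h : IsGhostStable V (eventual V B n)) : eventual V B n ≤ eventual V B (n + 1) :=
  fun y hy => mem_eventual_succ.mpr ⟨fun e => h.2 e y hy, fun v _ => h.1 v y hy⟩

theorem IsGhostStable.eventual {B : Submodule k Y} (hB : IsGhostStable V B) (n : ℕ) :
    IsGhostStable V (eventual V B n) := by
  induction n with
  | zero => exact hB
  | succ n ih =>
    refine ⟨fun v y hy => mem_eventual_succ.mpr ⟨fun e => ?_, fun v' hv' => ?_⟩, fun e y hy =>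
      ih.eventual_le_succ_of_eventual ((mem_eventual_succ.mp hy).1 e)⟩
    · rw [gho_smul_vtx_smul]
      split_ifs
      exacts [(mem_eventual_succ.mp hy).1 e, Submodule.zero_mem _]
    · rw [vtx_smul_vtx_smul]
      split_ifs
      exacts [(mem_eventual_succ.mp hy).2 v' hv', Submodule.zero_mem _]

theorem IsGhostStable.monotone_eventual {B : Submodule k Y} (hB : IsGhostStable V B) :
    Monotone (LeavittPathAlgebra.eventual V B) :=
  monotone_nat_of_le_succ fun n => (hB.eventual n).eventual_le_succ_of_eventual

/-- A ghost cancels an arrow or kills it, and a sink kills it, so applying an arrow costs just one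
level. -/
theorem IsGhostStable.arr_smul_mem_eventual {B : Submodule k Y} (hB : IsGhostStable V B) {n : ℕ}
    {y : Y} (hy : y ∈ LeavittPathAlgebra.eventual V B n) (e : QuiverArrow V) :
    arr k e • y ∈ LeavittPathAlgebra.eventual V B (n + 1) := by
  refine mem_eventual_succ.mpr ⟨fun e' => ?_, fun v hv => ?_⟩
  · rw [gho_smul_arr_smul]
    split_ifs
    exacts [(hB.eventual n).1 _ _ hy, Submodule.zero_mem _]
  · rw [vtx_smul_arr_smul_of_sink hv]
    exact Submodule.zero_mem _

/-- The union of the levels is an L(E)-submodule: vertices and ghosts preserve each level and arrows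
raise it by one. -/
theorem IsGhostStable.exists_mem_eventual {B : Submodule k Y} (hB : IsGhostStable V B) {y : Y}
    (hy : y ∈ Submodule.span (LeavittPathAlgebra k V) (B : Set Y)) :
    ∃ n, y ∈ LeavittPathAlgebra.eventual V B n := by
  have hmem : ∀ y, y ∈ (⨆ n, LeavittPathAlgebra.eventual V B n) ↔
      ∃ n, y ∈ LeavittPathAlgebra.eventual V B n := fun y =>
    Submodule.mem_iSup_of_directed _ hB.monotone_eventual.directed_le
  let N : Submodule (LeavittPathAlgebra k V) Y :=
    submoduleOfGenerators (⨆ n, LeavittPathAlgebra.eventual V B n)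
      (fun v y hy => by
        obtain ⟨n, hn⟩ := (hmem y).mp hy
        exact (hmem _).mpr ⟨n, (hB.eventual n).1 v y hn⟩)
      (fun e y hy => by
        obtain ⟨n, hn⟩ := (hmem y).mp hy
        exact (hmem _).mpr ⟨n + 1, hB.arr_smul_mem_eventual hn e⟩)
      (fun e y hy => by
        obtain ⟨n, hn⟩ := (hmem y).mp hy
        exact (hmem _).mpr ⟨n, (hB.eventual n).2 e y hn⟩)
  have hN : Submodule.span (LeavittPathAlgebra k V) (B : Set Y) ≤ N :=
    Submodule.span_le.mpr fun y hy => (hmem y).mpr ⟨0, hy⟩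
  exact (hmem y).mp (hN hy)

/-- By `sum_smul`, an element killed by all ghosts and all sinks is zero. -/
theorem eventual_bot (n : ℕ) : eventual V (⊥ : Submodule k Y) n = ⊥ := by
  induction n with
  | zero => rfl
  | succ n ih =>
    refine (Submodule.eq_bot_iff _).mpr fun y hy => ?_
    obtain ⟨h1, h2⟩ := mem_eventual_succ.mp hy
    rw [ih] at h1 h2
    rw [← sum_smul (k := k) (V := V) y]
    rw [Finset.sum_eq_zero fun e _ => by rw [(Submodule.mem_bot k).mp (h1 e), smul_zero],
      Finset.sum_eq_zero fun v _ => ?_, add_zero]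
    split_ifs with hv
    exacts [(Submodule.mem_bot k).mp (h2 v hv), rfl]

theorem eventual_mono {B C : Submodule k Y} (h : B ≤ C) (n : ℕ) :
    eventual V B n ≤ eventual V C n := by
  induction n with
  | zero => exact h
  | succ n ih =>
    intro y hy
    obtain ⟨h1, h2⟩ := mem_eventual_succ.mp hy
    exact mem_eventual_succ.mpr ⟨fun e => ih (h1 e), fun v hv => ih (h2 v hv)⟩

theorem mem_eventual_inf {B C : Submodule k Y} {n : ℕ} {y : Y} (hB : y ∈ eventual V B n)
    (hC : y ∈ eventual V C n) : y ∈ eventual V (B ⊓ C) n := by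
  induction n generalizing y with
  | zero => exact ⟨hB, hC⟩
  | succ n ih =>
    obtain ⟨h1, h2⟩ := mem_eventual_succ.mp hB
    obtain ⟨h3, h4⟩ := mem_eventual_succ.mp hC
    exact mem_eventual_succ.mpr ⟨fun e => ih (h1 e) (h3 e), fun v hv => ih (h2 v hv) (h4 v hv)⟩

theorem eventual_submodule (N : Submodule (LeavittPathAlgebra k V) Y) {y : Y} (hy : y ∈ N) (n : ℕ) :
    y ∈ eventual V (N.restrictScalars k) n := by
  induction n generalizing y with
  | zero => exact hy
  | succ n ih =>
    exact mem_eventual_succ.mpr ⟨fun e => ih (N.smul_mem _ hy), fun v _ => ih (N.smul_mem _ hy)⟩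

/-- Ghosts take `y` apart into elements of `B`; by `sum_smul` only arrows are needed to rebuild it.
-/
theorem eventual_le_span [Module (PathAlgebra k V) Y]
    [IsScalarTower (PathAlgebra k V) (LeavittPathAlgebra k V) Y] (B : Submodule k Y) (n : ℕ) {y : Y}
    (hy : y ∈ eventual V B n) : y ∈ Submodule.span (PathAlgebra k V) (B : Set Y) := by
  induction n generalizing y with
  | zero => exact Submodule.subset_span hy
  | succ n ih =>
    obtain ⟨h1, h2⟩ := mem_eventual_succ.mp hy
    rw [← sum_smul (k := k) (V := V) y]
    refine Submodule.add_mem _ (Submodule.sum_mem _ fun e _ => ?_)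
      (Submodule.sum_mem _ fun v _ => ?_)
    · rw [← ofPathAlgebra_arrow, ofPathAlgebra_smul]
      exact Submodule.smul_mem _ _ (ih (h1 e))
    · split_ifs with hv
      exacts [ih (h2 v hv), Submodule.zero_mem _]

/-- A homomorphism out of a module that is generated by the image of a compatible linear map is
injective if its composition with this linear map is injective. -/
theorem injective_of_comp_injective {A : Type*} [AddCommGroup A] [Module k A] {M : Type*}
    [AddCommGroup M] [Module (LeavittPathAlgebra k V) M] {s : A →ₗ[k] Y}
    (hs : IsGhostStable V (LinearMap.range s))
    (hspan : Submodule.span (LeavittPathAlgebra k V) (LinearMap.range s : Set Y) = ⊤)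
    (f : Y →ₗ[LeavittPathAlgebra k V] M) (hf : Function.Injective fun a => f (s a)) :
    Function.Injective f := by
  refine (injective_iff_map_eq_zero f).mpr fun y hy => ?_
  obtain ⟨n, hn⟩ := hs.exists_mem_eventual (hspan ▸ Submodule.mem_top (x := y))
  -- Ghost words keep `y` inside the kernel, so they move it into `range s ⊓ ker f`, which is zero.
  have h := mem_eventual_inf hn (eventual_submodule (LinearMap.ker f) hy n)
  have hbot : LinearMap.range s ⊓ (LinearMap.ker f).restrictScalars k = ⊥ := by
    refine (Submodule.eq_bot_iff _).mpr ?_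
    rintro _ ⟨⟨a, rfl⟩, ha⟩
    have : a = 0 := hf (by simpa using ha)
    rw [this, map_zero]
  rw [hbot, eventual_bot] at h
  exact h

end LeavittPathAlgebra

end

/-! ### The induced module L(E) ⊗ A, and lattices -/

noncomputable section

open CategoryTheory TensorProduct

namespace LeavittPathAlgebra

variable {k : Type u} [Field k] {V : Type} [Quiver.{0} V] [Fintype V]
  [∀ v w : V, Fintype (v ⟶ w)]

section tensor

variable (A : Type*) [AddCommGroup A] [Module (PathAlgebra k Vᵒᵖ) A]

variable (k V) in
/-- The module `L(E) ⊗_{P(E̅)} A`. -/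
abbrev InducedModule : Type _ :=
  NCTensor.Tensor (PathAlgebra k Vᵒᵖ) (LeavittPathAlgebra k V) A

/-- Left multiplication on the Leavitt path algebra as a homomorphism of right modules. -/
def mulLeftLinear (l : LeavittPathAlgebra k V) :
    LeavittPathAlgebra k V →ₗ[(PathAlgebra k Vᵒᵖ)ᵐᵒᵖ] LeavittPathAlgebra k V where
  toFun := fun x => l * x
  map_add' := mul_add l
  map_smul' := fun a x => (mul_assoc l x (ofInversePathAlgebra k V a.unop)).symm

instance : Module (LeavittPathAlgebra k V) (InducedModule k V A) where
  smul l t := NCTensor.Tensor.map (mulLeftLinear l) A t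
  one_smul t := DFunLike.congr_fun (f := NCTensor.Tensor.map (mulLeftLinear 1) A)
    (g := AddMonoidHom.id _) (NCTensor.Tensor.hom_ext fun x a =>
      congrArg (fun y => NCTensor.Tensor.tmul _ y a) (one_mul x)) t
  mul_smul l m t := DFunLike.congr_fun (f := NCTensor.Tensor.map (mulLeftLinear (l * m)) A)
    (g := (NCTensor.Tensor.map (mulLeftLinear l) A).comp
      (NCTensor.Tensor.map (mulLeftLinear m) A)) (NCTensor.Tensor.hom_ext fun x a =>
      congrArg (fun y => NCTensor.Tensor.tmul _ y a) (mul_assoc l m x)) t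
  smul_zero l := map_zero _
  smul_add l := map_add _
  add_smul l m t := DFunLike.congr_fun (f := NCTensor.Tensor.map (mulLeftLinear (l + m)) A)
    (g := NCTensor.Tensor.map (mulLeftLinear l) A + NCTensor.Tensor.map (mulLeftLinear m) A)
    (NCTensor.Tensor.hom_ext fun x a => by
      refine Eq.trans ?_ (NCTensor.Tensor.add_tmul (l * x) (m * x) a)
      exact congrArg (fun y => NCTensor.Tensor.tmul _ y a) (add_mul l m x)) t
  zero_smul t := DFunLike.congr_fun (f := NCTensor.Tensor.map (mulLeftLinear 0) A)
    (g := 0) (NCTensor.Tensor.hom_ext fun x a => by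
      have h := NCTensor.Tensor.add_tmul (R := PathAlgebra k Vᵒᵖ)
        (0 : LeavittPathAlgebra k V) 0 a
      rw [add_zero, left_eq_add] at h
      exact (congrArg (fun y => NCTensor.Tensor.tmul _ y a) (zero_mul x)).trans h) t

variable {A}

theorem smul_tmul (l x : LeavittPathAlgebra k V) (a : A) :
    (l • NCTensor.Tensor.tmul (PathAlgebra k Vᵒᵖ) x a : InducedModule k V A) =
      NCTensor.Tensor.tmul _ (l * x) a := rfl

theorem ofInverse_smul_tmul_one (q : PathAlgebra k Vᵒᵖ) (a : A) :
    (ofInversePathAlgebra k V q • NCTensor.Tensor.tmul (PathAlgebra k Vᵒᵖ)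
      (1 : LeavittPathAlgebra k V) a : InducedModule k V A) = NCTensor.Tensor.tmul _ 1 (q • a) := by
  rw [smul_tmul, mul_one, ← NCTensor.Tensor.op_smul_tmul, op_smul_def, one_mul]

theorem span_tmul_one :
    Submodule.span (LeavittPathAlgebra k V) (Set.range fun a : A =>
      (NCTensor.Tensor.tmul (PathAlgebra k Vᵒᵖ) (1 : LeavittPathAlgebra k V) a :
        InducedModule k V A)) = ⊤ := by
  refine eq_top_iff.mpr fun t _ => ?_
  obtain ⟨t, rfl⟩ := QuotientAddGroup.mk'_surjective _ t
  induction t with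
  | zero => rw [map_zero]; exact Submodule.zero_mem _
  | add s t hs ht => rw [map_add]; exact Submodule.add_mem _ (hs trivial) (ht trivial)
  | tmul x a =>
    have : QuotientAddGroup.mk' (NCTensor.relations (PathAlgebra k Vᵒᵖ) (LeavittPathAlgebra k V) A)
        (x ⊗ₜ a) = x • NCTensor.Tensor.tmul (PathAlgebra k Vᵒᵖ) (1 : LeavittPathAlgebra k V) a := by
      rw [smul_tmul, mul_one]
      rfl
    rw [this]
    exact Submodule.smul_mem _ _ (Submodule.subset_span ⟨a, rfl⟩)

end tensor

variable {M : Type*} [AddCommGroup M] [Module (LeavittPathAlgebra k V) M]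
  [Module (PathAlgebra k Vᵒᵖ) M] [IsScalarTower (PathAlgebra k Vᵒᵖ) (LeavittPathAlgebra k V) M]

/-- The map `l ⊗ a ↦ l a` as a homomorphism of modules over the Leavitt path algebra. -/
def tensorToModuleLinear (A : Submodule (PathAlgebra k Vᵒᵖ) M) :
    InducedModule k V A →ₗ[LeavittPathAlgebra k V] M :=
  { tensorToModule A with
    map_smul' := fun l t => DFunLike.congr_fun
      (f := (tensorToModule A).comp (NCTensor.Tensor.map (mulLeftLinear l) A))
      (g := (DistribSMul.toAddMonoidHom M l).comp (tensorToModule A))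
      (NCTensor.Tensor.hom_ext fun x a => mul_smul l x (a : M)) t }

/-- Ghosts can be moved across the tensor sign, so `1 ⊗ A` is ghost-stable. It generates the induced
module and embeds into `M`, and reconstruction extends this injectivity to the whole tensor product.
-/
theorem tensorToModule_injective (A : Submodule (PathAlgebra k Vᵒᵖ) M) :
    Function.Injective (tensorToModule A) := by
  let : Module k (InducedModule k V A) := Module.compHom _ (algebraMap k (LeavittPathAlgebra k V))
  have : IsScalarTower k (LeavittPathAlgebra k V) (InducedModule k V A) :=
    IsScalarTower.of_algebraMap_smul fun _ _ => rfl
  let : Module k A := Module.compHom _ (algebraMap k (PathAlgebra k Vᵒᵖ))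
  let s : A →ₗ[k] InducedModule k V A :=
    { toFun := fun a => NCTensor.Tensor.tmul _ 1 a
      map_add' := NCTensor.Tensor.tmul_add 1
      map_smul' := fun c a => by
        refine (ofInverse_smul_tmul_one (algebraMap k (PathAlgebra k Vᵒᵖ) c) a).symm.trans ?_
        rw [AlgHom.commutes]
        rfl }
  refine injective_of_comp_injective (s := s) ⟨?_, ?_⟩ ?_ (tensorToModuleLinear A) ?_
  · rintro v _ ⟨a, rfl⟩
    refine ⟨PathAlgebra.vertex k (Opposite.op v) • a, ?_⟩
    change NCTensor.Tensor.tmul _ 1 _ = _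
    rw [← ofInverse_smul_tmul_one, ofInversePathAlgebra_vertex]
    rfl
  · rintro e _ ⟨a, rfl⟩
    refine ⟨PathAlgebra.arrow k e.2.2.op • a, ?_⟩
    change NCTensor.Tensor.tmul _ 1 _ = _
    rw [← ofInverse_smul_tmul_one, ofInversePathAlgebra_arrow]
    rfl
  · exact span_tmul_one
  · intro a b h
    refine Subtype.ext ?_
    have : (1 : LeavittPathAlgebra k V) • (a : M) = (1 : LeavittPathAlgebra k V) • (b : M) := h
    rwa [one_smul, one_smul] at this

theorem range_tensorToModuleLinear (A : Submodule (PathAlgebra k Vᵒᵖ) M) :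
    LinearMap.range (tensorToModuleLinear A) =
      Submodule.span (LeavittPathAlgebra k V) (A : Set M) := by
  rw [LinearMap.range_eq_map, ← span_tmul_one, Submodule.map_span, ← Set.range_comp]
  congr 1
  ext m
  constructor
  · rintro ⟨a, rfl⟩
    change (1 : LeavittPathAlgebra k V) • (a : M) ∈ A
    rw [one_smul]
    exact a.2
  · intro hm
    exact ⟨⟨m, hm⟩, one_smul _ m⟩

theorem tensorToModule_bijective_iff (A : Submodule (PathAlgebra k Vᵒᵖ) M) :
    Function.Bijective (tensorToModule A) ↔
      Submodule.span (LeavittPathAlgebra k V) (A : Set M) = ⊤ := by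
  rw [← range_tensorToModuleLinear, LinearMap.range_eq_top, Function.Bijective,
    and_iff_right (tensorToModule_injective A)]
  rfl

section lattices

variable [Module (PathAlgebra k V) M] [IsScalarTower (PathAlgebra k V) (LeavittPathAlgebra k V) M]

omit [Module (PathAlgebra k Vᵒᵖ) M]
  [IsScalarTower (PathAlgebra k Vᵒᵖ) (LeavittPathAlgebra k V) M] in
theorem span_pathAlgebra_le_span (S : Set M) {m : M}
    (hm : m ∈ Submodule.span (PathAlgebra k V) S) :
    m ∈ Submodule.span (LeavittPathAlgebra k V) S :=
  Submodule.span_le_restrictScalars (PathAlgebra k V) (LeavittPathAlgebra k V) S hm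

-- For a ghost-stable subspace, the P(E)-span already contains everything that L(E) generates, by
-- `eventual_le_span`.
omit [Module (PathAlgebra k Vᵒᵖ) M]
  [IsScalarTower (PathAlgebra k Vᵒᵖ) (LeavittPathAlgebra k V) M] in
theorem IsGhostStable.span_eq_top_iff [Module k M] [IsScalarTower k (LeavittPathAlgebra k V) M]
    {B : Submodule k M} (hB : IsGhostStable V B) :
    Submodule.span (PathAlgebra k V) (B : Set M) = ⊤ ↔
      Submodule.span (LeavittPathAlgebra k V) (B : Set M) = ⊤ := by
  refine ⟨fun h => eq_top_iff.mpr fun m _ => span_pathAlgebra_le_span _ (h ▸ trivial),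
    fun h => eq_top_iff.mpr fun m _ => ?_⟩
  obtain ⟨n, hn⟩ := hB.exists_mem_eventual (h ▸ Submodule.mem_top (x := m))
  exact eventual_le_span _ n hn

variable [Module k M] [IsScalarTower k (PathAlgebra k Vᵒᵖ) M]

theorem isLattice_iff (A : Submodule (PathAlgebra k Vᵒᵖ) M) :
    IsLattice A ↔ FiniteDimensional k A ∧ Function.Bijective (tensorToModule A) := by
  have := isScalarTower_of_inverse (k := k) (V := V) (Y := M)
  have h := (isGhostStable_restrictScalars (k := k) (V := V) A).span_eq_top_iff
  rw [tensorToModule_bijective_iff]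
  exact ⟨fun hA => ⟨hA.1, h.mp hA.2⟩, fun hA => ⟨hA.1, h.mpr hA.2⟩⟩

/-- Sufficiently long ghost words move an element both into `A` and into `B`, hence into the
intersection; the larger of the two lengths serves for both. -/
theorem IsLattice.inf {A B : Submodule (PathAlgebra k Vᵒᵖ) M} (hA : IsLattice A)
    (hB : IsLattice B) : IsLattice (A ⊓ B) := by
  have := isScalarTower_of_inverse (k := k) (V := V) (Y := M)
  refine ⟨?_, eq_top_iff.mpr fun m _ => ?_⟩
  · have : FiniteDimensional k (A.restrictScalars k) := hA.1
    exact Submodule.finiteDimensional_of_le (S₁ := (A ⊓ B).restrictScalars k)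
      (S₂ := A.restrictScalars k) fun _ h => h.1
  · have hA' := isGhostStable_restrictScalars (k := k) (V := V) A
    have hB' := isGhostStable_restrictScalars (k := k) (V := V) B
    obtain ⟨n, hn⟩ := hA'.exists_mem_eventual (y := m)
      (by rw [hA'.span_eq_top_iff.mp hA.2]; trivial)
    obtain ⟨n', hn'⟩ := hB'.exists_mem_eventual (y := m)
      (by rw [hB'.span_eq_top_iff.mp hB.2]; trivial)
    exact eventual_le_span (A.restrictScalars k ⊓ B.restrictScalars k) (max n n') (mem_eventual_inf
      (hA'.monotone_eventual (le_max_left _ _) hn) (hB'.monotone_eventual (le_max_right _ _) hn'))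

/-- A lattice `A` of least dimension works: for a lattice `B`, the lattice `A ⊓ B` cannot have
smaller dimension than `A`, so it equals `A`. -/
theorem exists_isLeast_isLattice (h : ∃ A : Submodule (PathAlgebra k Vᵒᵖ) M, IsLattice A) :
    ∃ A : Submodule (PathAlgebra k Vᵒᵖ) M, IsLeast {A | IsLattice A} A := by
  have hwf : WellFounded (InvImage (· < ·)
    fun A : Submodule (PathAlgebra k Vᵒᵖ) M => Module.finrank k A) := InvImage.wf _ wellFounded_lt
  obtain ⟨A, hA, hmin⟩ := hwf.has_min {A | IsLattice A} h
  refine ⟨A, hA, fun B hB => ?_⟩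
  have : FiniteDimensional k (A.restrictScalars k) := hA.1
  have hle : (A ⊓ B).restrictScalars k ≤ A.restrictScalars k := fun _ h => h.1
  have heq := Submodule.eq_of_le_of_finrank_le (K := k) (V := M) (S₁ := (A ⊓ B).restrictScalars k)
    (S₂ := A.restrictScalars k) hle (not_lt.mp (hmin (A ⊓ B) (hA.inf hB)))
  intro a ha
  have : a ∈ (A ⊓ B).restrictScalars k := heq ▸ ha
  exact this.2

end lattices

end LeavittPathAlgebra

end

/-! ### Derived functors computed by a resolution of length one -/

section

universe v v'

open CategoryTheory Limits

section
variable {D : Type*} [Category D] [Abelian D]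

/-- With only two terms, exactness in degree zero says that the differential is epi, and in degree
one that it is mono. -/
theorem ChainComplex.forall_exactAt_iff_isIso_d (K : ChainComplex D ℕ)
    (hK : ∀ n, IsZero (K.X (n + 2))) : (∀ q, K.ExactAt q) ↔ IsIso (K.d 1 0) := by
  have h0 : K.ExactAt 0 ↔ Epi (K.d 1 0) := by
    rw [K.exactAt_iff' 1 0 0 (by simp) (by simp), ShortComplex.exact_iff_epi _ (K.shape _ _ (by simp))]
    rfl
  have h1 : K.ExactAt 1 ↔ Mono (K.d 1 0) := by
    rw [K.exactAt_iff' 2 1 0 (by simp) (by simp),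
      ShortComplex.exact_iff_mono _ ((hK 0).eq_of_src _ _)]
    rfl
  refine ⟨fun h => ?_, fun h q => ?_⟩
  · have := h0.mp (h 0)
    have := h1.mp (h 1)
    exact isIso_of_mono_of_epi _
  · match q with
    | 0 => exact h0.mpr inferInstance
    | 1 => exact h1.mpr inferInstance
    | n + 2 => exact ShortComplex.exact_of_isZero_X₂ _ (hK n)

end

namespace CategoryTheory.ShortComplex.ShortExact
variable {C : Type*} [Category C] [Abelian C]
  {S : ShortComplex C} (hS : S.ShortExact) [Projective S.X₁] [Projective S.X₂]

theorem down_rel_one_zero : (ComplexShape.down ℕ).Rel 1 0 := rfl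

/-- The first morphism of a short complex as a chain complex in degrees one and zero. -/
noncomputable def resolutionComplex (S : ShortComplex C) : ChainComplex C ℕ :=
  HomologicalComplex.double S.f down_rel_one_zero

/-- The object of the complex in degree one. -/
noncomputable def resolutionComplexIso₁ (S : ShortComplex C) : (resolutionComplex S).X 1 ≅ S.X₁ :=
  HomologicalComplex.doubleXIso₀ S.f down_rel_one_zero

/-- The object of the complex in degree zero. -/
noncomputable def resolutionComplexIso₀ (S : ShortComplex C) : (resolutionComplex S).X 0 ≅ S.X₂ :=
  HomologicalComplex.doubleXIso₁ S.f down_rel_one_zero one_ne_zero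

theorem resolutionComplex_d (S : ShortComplex C) : (resolutionComplex S).d 1 0 =
    (resolutionComplexIso₁ S).hom ≫ S.f ≫ (resolutionComplexIso₀ S).inv :=
  HomologicalComplex.double_d S.f down_rel_one_zero one_ne_zero

theorem isZero_resolutionComplex (S : ShortComplex C) (n : ℕ) :
    IsZero ((resolutionComplex S).X (n + 2)) :=
  HomologicalComplex.isZero_double_X _ _ _ (by omega) (by omega)

/-- The projective resolution of length one given by a short exact sequence. -/
noncomputable def projectiveResolution : ProjectiveResolution S.X₃ where
  complex := resolutionComplex S
  projective n := by
    match n with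
    | 0 => exact Projective.of_iso (resolutionComplexIso₀ S).symm ‹_›
    | 1 => exact Projective.of_iso (resolutionComplexIso₁ S).symm ‹_›
    | n + 2 => exact (isZero_resolutionComplex S n).projective
  π := (ChainComplex.toSingle₀Equiv _ _).symm
    ⟨(resolutionComplexIso₀ S).hom ≫ S.g, by simp [resolutionComplex_d]⟩
  quasiIso := ⟨fun n => by
    have := hS.mono_f
    match n with
    | 0 =>
      rw [ChainComplex.quasiIsoAt₀_iff,
        ShortComplex.quasiIso_iff_of_zeros' _ ((resolutionComplex S).shape 0 0 (by simp)) rfl rfl]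
      refine (ShortComplex.exact_and_epi_g_iff_of_iso (S₂ := S) ?_).2 ⟨hS.exact, hS.epi_g⟩
      refine ShortComplex.isoMk (resolutionComplexIso₁ S) (resolutionComplexIso₀ S) (Iso.refl _)
        ?_ ?_
      · change (resolutionComplexIso₁ S).hom ≫ S.f =
          (resolutionComplex S).d 1 0 ≫ (resolutionComplexIso₀ S).hom
        simp [resolutionComplex_d]
      · change (resolutionComplexIso₀ S).hom ≫ S.g = ((ChainComplex.toSingle₀Equiv _ _).symm
          ⟨(resolutionComplexIso₀ S).hom ≫ S.g, _⟩ : resolutionComplex S ⟶ _).f 0 ≫ 𝟙 _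
        simp
    | n + 1 =>
      rw [quasiIsoAt_iff_exactAt' _ _ (ChainComplex.exactAt_succ_single_obj _ _)]
      match n with
      | 0 =>
        rw [HomologicalComplex.exactAt_iff' _ 2 1 0 (by simp) (by simp),
          ShortComplex.exact_iff_mono _ ((isZero_resolutionComplex S 0).eq_of_src _ _)]
        change Mono ((resolutionComplex S).d 1 0)
        rw [resolutionComplex_d]
        infer_instance
      | n + 1 => exact ShortComplex.exact_of_isZero_X₂ _ (isZero_resolutionComplex S n)⟩

variable {D : Type*} [Category D] [Abelian D]

include hS in
theorem isZero_leftDerived_iff [HasProjectiveResolutions C] (F : C ⥤ D) [F.Additive] :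
    (∀ q, IsZero ((F.leftDerived q).obj S.X₃)) ↔ IsIso (F.map S.f) := by
  let R := projectiveResolution hS
  have key : ∀ q, IsZero ((F.leftDerived q).obj S.X₃) ↔
      ((F.mapHomologicalComplex _).obj R.complex).ExactAt q := fun q => by
    rw [HomologicalComplex.exactAt_iff_isZero_homology]
    exact (R.isoLeftDerivedObj F q).isZero_iff
  rw [forall_congr' key, ChainComplex.forall_exactAt_iff_isIso_d]
  · change IsIso (F.map ((resolutionComplex S).d 1 0)) ↔ _
    rw [resolutionComplex_d, F.map_comp, F.map_comp, isIso_comp_left_iff, isIso_comp_right_iff]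
  · exact fun n => F.map_isZero (isZero_resolutionComplex S n)

end CategoryTheory.ShortComplex.ShortExact

end

/-! ### The standard resolution of k^{E⁰} -/

noncomputable section

open CategoryTheory TensorProduct

namespace PathAlgebra

variable (k : Type u) [Field k] (V : Type) [Quiver.{0} V] [Fintype V] [∀ v w : V, Fintype (v ⟶ w)]

section derivative

/-- The map `(s, f) ↦ ∑ s_v p_v + ∑ e f_e` to the path algebra. -/
def assemble : (V → k) × (QuiverArrow V → PathAlgebra k V) →ₗ[k] PathAlgebra k V where
  toFun z := ∑ v, z.1 v • vertex k v + ∑ e : QuiverArrow V, arrow k e.2.2 * z.2 e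
  map_add' z z' := by
    simp only [Prod.fst_add, Prod.snd_add, Pi.add_apply, add_smul, mul_add, Finset.sum_add_distrib]
    abel
  map_smul' c z := by
    simp only [Prod.smul_fst, Prod.smul_snd, Pi.smul_apply, smul_eq_mul, mul_smul, mul_smul_comm,
      Finset.smul_sum, smul_add, RingHom.id_apply]

open scoped Classical in
/-- The action of a vertex on `k^{E⁰} × P(E)^{E¹}`. -/
def vertexOp (v : V) : Module.End k ((V → k) × (QuiverArrow V → PathAlgebra k V)) where
  toFun z := (Pi.single v (z.1 v), fun e => if e.src = v then z.2 e else 0)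
  map_add' z z' := by
    ext i : 2
    · by_cases h : i = v
      · subst h; simp
      · simp [h]
    · simp only [Prod.snd_add, Pi.add_apply]
      split_ifs <;> simp
  map_smul' c z := by
    ext i : 2
    · by_cases h : i = v
      · subst h; simp
      · simp [h]
    · simp

open scoped Classical in
/-- The action of an arrow on `k^{E⁰} × P(E)^{E¹}`. -/
def arrowOp (e : QuiverArrow V) : Module.End k ((V → k) × (QuiverArrow V → PathAlgebra k V)) :=
  (LinearMap.inr k (V → k) (QuiverArrow V → PathAlgebra k V)).comp
    ((LinearMap.single k (fun _ : QuiverArrow V => PathAlgebra k V) e).comp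
      ((LinearMap.mulLeft k (vertex k e.tgt)).comp (assemble k V)))

variable {k V}

theorem vertex_mul_vertex_self (v : V) : vertex k v * vertex k v = vertex k v :=
  isPathFamily.idem v

theorem vertex_mul_arrow_self (e : QuiverArrow V) :
    vertex k e.src * arrow k e.2.2 = arrow k e.2.2 :=
  isPathFamily.source_mul e.2.2

theorem vertex_mul_arrow_of_ne {v : V} {e : QuiverArrow V} (h : e.src ≠ v) :
    vertex k v * arrow k e.2.2 = 0 := by
  rw [← vertex_mul_arrow_self, ← mul_assoc, isPathFamily.orthogonal _ _ h.symm, zero_mul]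

theorem arrow_mul_vertex_self (e : QuiverArrow V) :
    arrow k e.2.2 * vertex k e.tgt = arrow k e.2.2 :=
  isPathFamily.mul_target e.2.2

theorem assemble_vertexOp (v : V) (z : (V → k) × (QuiverArrow V → PathAlgebra k V)) :
    assemble k V (vertexOp k V v z) = vertex k v * assemble k V z := by
  classical
  change ∑ v', (Pi.single v (z.1 v) : V → k) v' • vertex k v' +
    ∑ e : QuiverArrow V, arrow k e.2.2 * (if e.src = v then z.2 e else 0) =
    vertex k v * (∑ v, z.1 v • vertex k v + ∑ e : QuiverArrow V, arrow k e.2.2 * z.2 e)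
  rw [mul_add, Finset.mul_sum, Finset.mul_sum]
  congr 1
  · refine Finset.sum_congr rfl fun v' _ => ?_
    rw [mul_smul_comm]
    by_cases h : v' = v
    · subst h
      rw [Pi.single_eq_same, vertex_mul_vertex_self]
    · rw [Pi.single_eq_of_ne h, zero_smul, isPathFamily.orthogonal _ _ (Ne.symm h), smul_zero]
  · refine Finset.sum_congr rfl fun e _ => ?_
    rw [← mul_assoc]
    split_ifs with h
    · rw [← h, vertex_mul_arrow_self]
    · rw [vertex_mul_arrow_of_ne h, zero_mul, mul_zero]

open scoped Classical in
theorem arrowOp_apply (e : QuiverArrow V) (z : (V → k) × (QuiverArrow V → PathAlgebra k V)) :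
    arrowOp k V e z = (0, Pi.single e (vertex k e.tgt * assemble k V z)) := rfl

theorem assemble_arrowOp (e : QuiverArrow V) (z : (V → k) × (QuiverArrow V → PathAlgebra k V)) :
    assemble k V (arrowOp k V e z) = arrow k e.2.2 * assemble k V z := by
  classical
  rw [arrowOp_apply]
  change ∑ v', (0 : V → k) v' • vertex k v' + ∑ e' : QuiverArrow V, arrow k e'.2.2 *
    (Pi.single e (vertex k e.tgt * assemble k V z) : QuiverArrow V → PathAlgebra k V) e' = _
  rw [Finset.sum_eq_zero fun v _ => by rw [Pi.zero_apply, zero_smul], zero_add,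
    Finset.sum_eq_single e (fun e' _ h => by rw [Pi.single_eq_of_ne h, mul_zero]) (by simp),
    Pi.single_eq_same, ← mul_assoc, arrow_mul_vertex_self]

variable (k V) in
theorem isPathFamily_op : IsPathFamily (vertexOp k V) (fun {_ _} e => arrowOp k V ⟨_, _, e⟩) where
  idem v := by
    refine LinearMap.ext fun z => ?_
    change vertexOp k V v (vertexOp k V v z) = vertexOp k V v z
    simp only [vertexOp, LinearMap.coe_mk, AddHom.coe_mk, Pi.single_eq_same, Prod.mk.injEq,
      true_and]
    funext e
    split_ifs <;> rfl
  orthogonal v w h := by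
    classical
    refine LinearMap.ext fun z => ?_
    change vertexOp k V v (vertexOp k V w z) = 0
    simp only [vertexOp, LinearMap.coe_mk, AddHom.coe_mk, Pi.single_eq_of_ne h, Pi.single_zero]
    refine Prod.ext rfl (funext fun e => ?_)
    dsimp
    split_ifs with h1 h2
    · exact absurd (h1.symm.trans h2) h
    all_goals rfl
  sum_eq_one := by
    classical
    refine LinearMap.ext fun z => ?_
    rw [LinearMap.sum_apply]
    refine Prod.ext ?_ ?_
    · rw [Prod.fst_sum]
      exact Finset.univ_sum_single z.1
    · rw [Prod.snd_sum]
      funext e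
      rw [Finset.sum_apply]
      exact (Finset.sum_ite_eq Finset.univ e.src fun _ => z.2 e).trans (if_pos (Finset.mem_univ _))
  source_mul {a b} e := by
    classical
    refine LinearMap.ext fun z => ?_
    change vertexOp k V a (arrowOp k V ⟨a, b, e⟩ z) = arrowOp k V ⟨a, b, e⟩ z
    rw [arrowOp_apply]
    refine Prod.ext (Pi.single_zero _) (funext fun e' => ?_)
    change (if e'.src = a then (Pi.single ⟨a, b, e⟩ _ : QuiverArrow V → PathAlgebra k V) e' else 0) =
      (Pi.single ⟨a, b, e⟩ _ : QuiverArrow V → PathAlgebra k V) e'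
    split_ifs with h
    · rfl
    · rw [Pi.single_eq_of_ne]
      rintro rfl
      exact h rfl
  mul_target {a b} e := by
    refine LinearMap.ext fun z => ?_
    change arrowOp k V ⟨a, b, e⟩ (vertexOp k V b z) = arrowOp k V ⟨a, b, e⟩ z
    rw [arrowOp_apply, arrowOp_apply, assemble_vertexOp, ← mul_assoc, vertex_mul_vertex_self]

/-- Left multiplication is lifted to the pairs of vertex coefficients and arrow coefficients, and
`assemble` is equivariant for it. Acting on `(1, 0)` then yields the decomposition of `x` without
recursion on paths. -/
theorem assemble_lift (x : PathAlgebra k V) (z : (V → k) × (QuiverArrow V → PathAlgebra k V)) :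
    assemble k V (lift (isPathFamily_op k V) x z) = x * assemble k V z := by
  let S : Subalgebra k (PathAlgebra k V) :=
    { carrier := {x | ∀ z, assemble k V (lift (isPathFamily_op k V) x z) = x * assemble k V z}
      mul_mem' := fun {a b} ha hb z => by
        rw [map_mul, Module.End.mul_apply, ha, hb, mul_assoc]
      add_mem' := fun {a b} ha hb z => by
        rw [map_add, LinearMap.add_apply, map_add, ha, hb, add_mul]
      algebraMap_mem' := fun c z => by
        rw [AlgHom.commutes, Module.algebraMap_end_apply, map_smul, Algebra.smul_def] }
  have : x ∈ S := by
    rw [subalgebra_eq_top S (fun v z => ?_) (fun e z => ?_)]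
    · trivial
    · rw [lift_vertex, assemble_vertexOp]
    · rw [lift_arrow, assemble_arrowOp]
  exact this z

theorem augmentation_vertex [DecidableEq V] (v : V) :
    augmentation k V (vertex k v) = Pi.single v 1 := by
  refine (lift_vertex _ v).trans ?_
  congr!

theorem augmentation_arrow {v w : V} (e : v ⟶ w) : augmentation k V (arrow k e) = 0 :=
  lift_arrow _ e

theorem lift_op_fst (x : PathAlgebra k V) (z : (V → k) × (QuiverArrow V → PathAlgebra k V)) :
    (lift (isPathFamily_op k V) x z).1 = augmentation k V x * z.1 := by
  classical
  let S : Subalgebra k (PathAlgebra k V) :=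
    { carrier := {x | ∀ z, (lift (isPathFamily_op k V) x z).1 = augmentation k V x * z.1}
      mul_mem' := fun {a b} ha hb z => by
        rw [map_mul, Module.End.mul_apply, ha, hb, map_mul, mul_assoc]
      add_mem' := fun {a b} ha hb z => by
        rw [map_add, LinearMap.add_apply, Prod.fst_add, ha, hb, map_add, add_mul]
      algebraMap_mem' := fun c z => by
        rw [AlgHom.commutes, Module.algebraMap_end_apply, AlgHom.commutes, Prod.smul_fst,
          Algebra.smul_def] }
  have : x ∈ S := by
    rw [subalgebra_eq_top S (fun v z => ?_) (fun e z => ?_)]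
    · trivial
    · rw [lift_vertex, augmentation_vertex]
      change (Pi.single v (z.1 v) : V → k) = _
      ext i
      by_cases h : i = v
      · subst h; simp
      · simp [h]
    · rw [lift_arrow, augmentation_arrow, zero_mul]
      rfl
  exact this z

variable (k V) in
/-- The coefficients `∂_e x` in the decomposition `x = ε x + ∑ e ∂_e x`. -/
def derivative : PathAlgebra k V →ₗ[k] QuiverArrow V → PathAlgebra k V where
  toFun x := (lift (isPathFamily_op k V) x (1, 0)).2
  map_add' x y := by rw [map_add]; rfl
  map_smul' c x := by rw [map_smul]; rfl

theorem assemble_one : assemble k V (1, 0) = 1 := by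
  change ∑ v : V, (1 : k) • vertex k v + ∑ e : QuiverArrow V, arrow k e.2.2 * 0 = 1
  simp only [one_smul, mul_zero, Finset.sum_const_zero, add_zero]
  rfl

theorem augmentation_add_derivative (x : PathAlgebra k V) :
    ∑ v, augmentation k V x v • vertex k v + ∑ e : QuiverArrow V, arrow k e.2.2 * derivative k V x e
      = x := by
  have h := assemble_lift x (1, 0)
  rw [assemble_one, mul_one] at h
  refine Eq.trans ?_ h
  change _ = ∑ v, (lift (isPathFamily_op k V) x (1, 0)).1 v • vertex k v +
    ∑ e : QuiverArrow V, arrow k e.2.2 * derivative k V x e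
  rw [lift_op_fst, mul_one]

open scoped Classical in
theorem derivative_arrow_mul (e : QuiverArrow V) (x : PathAlgebra k V) :
    derivative k V (arrow k e.2.2 * x) = Pi.single e (vertex k e.tgt * x) := by
  change (lift (isPathFamily_op k V) (arrow k e.2.2 * x) (1, 0)).2 = _
  rw [map_mul, Module.End.mul_apply, lift_arrow, arrowOp_apply, assemble_lift, assemble_one,
    mul_one]

end derivative

section resolution

/-- The right module `⨁ p_{r(e)} P(E)`, the sum being over all arrows `e`. -/
def arrowModule : Submodule (PathAlgebra k V)ᵐᵒᵖ (QuiverArrow V → PathAlgebra k V) where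
  carrier := {f | ∀ e, vertex k e.tgt * f e = f e}
  add_mem' {f g} hf hg e := by rw [Pi.add_apply, mul_add, hf, hg]
  zero_mem' e := mul_zero _
  smul_mem' a f hf e := by
    change _ * (f e * a.unop) = f e * a.unop
    rw [← mul_assoc, hf]

variable {k V}

/-- The homomorphism `(f_e) ↦ ∑ e f_e` of right modules. -/
def arrowModuleMap : arrowModule k V →ₗ[(PathAlgebra k V)ᵐᵒᵖ] PathAlgebra k V where
  toFun f := ∑ e : QuiverArrow V, arrow k e.2.2 * f.1 e
  map_add' f g := by
    simp only [Submodule.coe_add, Pi.add_apply, mul_add, Finset.sum_add_distrib]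
  map_smul' a f := by
    change ∑ e : QuiverArrow V, arrow k e.2.2 * (f.1 e * a.unop) =
      (∑ e : QuiverArrow V, arrow k e.2.2 * f.1 e) * a.unop
    simp only [Finset.sum_mul, mul_assoc]

variable (k V) in
/-- The augmentation as a homomorphism of right modules. -/
def augmentationLinear : PathAlgebra k V →ₗ[(PathAlgebra k V)ᵐᵒᵖ] VertexModule k V where
  toFun x := augmentation k V x
  map_add' := map_add _
  map_smul' a x := map_mul (augmentation k V) x a.unop

/-- The coefficients `∂_e` recover the coordinates, since `∂_e` sends `∑ e' f_{e'}` to `p_{r(e)} f_e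
= f_e`. -/
theorem arrowModuleMap_injective : Function.Injective (arrowModuleMap (k := k) (V := V)) := by
  classical
  refine (injective_iff_map_eq_zero _).mpr fun f hf => Subtype.ext (funext fun e => ?_)
  have h := congrArg (derivative k V) (show ∑ e : QuiverArrow V, arrow k e.2.2 * f.1 e = 0 from hf)
  simp only [map_sum, derivative_arrow_mul, f.2 _, map_zero] at h
  rw [Finset.univ_sum_single] at h
  exact congrFun h e

theorem augmentationLinear_surjective :
    Function.Surjective (augmentationLinear k V) := by
  classical
  intro s
  refine ⟨∑ v, (s : V → k) v • vertex k v, ?_⟩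
  change augmentation k V _ = _
  simp only [map_sum, map_smul, augmentation_vertex]
  exact (Finset.sum_congr rfl fun v _ => by
    rw [← Pi.single_smul, smul_eq_mul, mul_one]).trans (Finset.univ_sum_single (s : V → k))

theorem arrowModuleMap_exact :
    Function.Exact (arrowModuleMap (k := k) (V := V)) (augmentationLinear k V) := by
  intro x
  constructor
  · intro hx
    -- The factor `p_{r(e)}` puts the tuple into `arrowModule` and is absorbed by the arrow `e` in
    -- the sum.
    refine ⟨⟨fun e => vertex k e.tgt * derivative k V x e, fun e => ?_⟩, ?_⟩
    · rw [← mul_assoc, vertex_mul_vertex_self]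
    · change ∑ e : QuiverArrow V, arrow k e.2.2 * (vertex k e.tgt * derivative k V x e) = x
      simp only [← mul_assoc, arrow_mul_vertex_self]
      conv_rhs => rw [← augmentation_add_derivative x]
      rw [right_eq_add]
      refine Finset.sum_eq_zero fun v _ => ?_
      rw [show augmentation k V x = 0 from hx, Pi.zero_apply, zero_smul]
  · rintro ⟨f, rfl⟩
    change augmentation k V (∑ e : QuiverArrow V, arrow k e.2.2 * f.1 e) = 0
    simp only [map_sum, map_mul, augmentation_arrow, zero_mul, Finset.sum_const_zero]

theorem _root_.Module.projective_opposite (R : Type*) [Ring R] : Module.Projective Rᵐᵒᵖ R :=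
  Module.Projective.of_equiv
    ({ MulOpposite.opAddEquiv with map_smul' := fun _ _ => rfl } : R ≃ₗ[Rᵐᵒᵖ] Rᵐᵒᵖ).symm

/-- A direct summand of a finite free module: the projection multiplies the `e`-th coordinate by
`p_{r(e)}`. -/
theorem projective_arrowModule : Module.Projective (PathAlgebra k V)ᵐᵒᵖ (arrowModule k V) := by
  have := Module.projective_opposite (PathAlgebra k V)
  have : Module.Projective (PathAlgebra k V)ᵐᵒᵖ (QuiverArrow V → PathAlgebra k V) :=
    .of_equiv (DFinsupp.linearEquivFunOnFintype
      (R := (PathAlgebra k V)ᵐᵒᵖ) (M := fun _ : QuiverArrow V => PathAlgebra k V))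
  refine Module.Projective.of_split (arrowModule k V).subtype
    { toFun := fun f => ⟨fun e => vertex k e.tgt * f e, fun e => by
        rw [← mul_assoc, vertex_mul_vertex_self]⟩
      map_add' := fun f g => Subtype.ext (funext fun e => mul_add _ _ _)
      map_smul' := fun a f => Subtype.ext (funext fun e => (mul_assoc _ _ _).symm) } ?_
  exact LinearMap.ext fun f => Subtype.ext (funext fun e => f.2 e)

end resolution

end PathAlgebra

end

/-! ### The Blanchfield condition as bijectivity of `arrowSum` -/

noncomputable section

open CategoryTheory TensorProduct

namespace PathAlgebra

variable {k : Type u} [Field k] {V : Type} [Quiver.{0} V] [Fintype V] [∀ v w : V, Fintype (v ⟶ w)]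

section tensor

variable (M : Type*) [AddCommGroup M] [Module (PathAlgebra k V) M]

variable (k V) in
/-- The group `⨁ p_{r(e)} M`, the sum being over all arrows `e`. -/
def arrowTuples : AddSubgroup (QuiverArrow V → M) where
  carrier := {f | ∀ e, vertex k e.tgt • f e = f e}
  add_mem' {f g} hf hg e := by rw [Pi.add_apply, smul_add, hf, hg]
  zero_mem' e := smul_zero _
  neg_mem' {f} hf e := by rw [Pi.neg_apply, smul_neg, hf]

/-- The homomorphism `(m_e) ↦ ∑ e m_e`. -/
def arrowSum (f : arrowTuples k V M) : M := ∑ e : QuiverArrow V, arrow k e.2.2 • f.1 e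

open scoped Classical in
variable (k) in
/-- The generator `p_{r(e)}` of a summand of `⨁ p_{r(e)} P(E)`. -/
def arrowGenerator (e : QuiverArrow V) : arrowModule k V :=
  ⟨Pi.single e (vertex k e.tgt), fun e' => by
    by_cases h : e' = e
    · subst h
      rw [Pi.single_eq_same, vertex_mul_vertex_self]
    · rw [Pi.single_eq_of_ne h, mul_zero]⟩

theorem arrowGenerator_self (e : QuiverArrow V) :
    (arrowGenerator k e).1 e = vertex k e.tgt := by
  classical
  change (Pi.single e (vertex k e.tgt) : QuiverArrow V → PathAlgebra k V) e = _
  rw [Pi.single_eq_same]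

theorem arrowGenerator_of_ne {e e' : QuiverArrow V} (h : e ≠ e') :
    (arrowGenerator k e').1 e = 0 := by
  classical
  change (Pi.single e' (vertex k e'.tgt) : QuiverArrow V → PathAlgebra k V) e = _
  rw [Pi.single_eq_of_ne h]

/-- The map from `⨁ p_{r(e)} M` to a tensor product. -/
def toTensor (f : arrowTuples k V M) : NCTensor.Tensor (PathAlgebra k V) (arrowModule k V) M :=
  ∑ e, NCTensor.Tensor.tmul _ (arrowGenerator k e) (f.1 e)

/-- The map `f ⊗ m ↦ (f_e m)_e`. -/
def ofTensor :
    NCTensor.Tensor (PathAlgebra k V) (arrowModule k V) M →+ arrowTuples k V M :=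
  NCTensor.Tensor.lift
    (AddMonoidHom.mk' (fun f => AddMonoidHom.mk' (fun m => ⟨fun e => f.1 e • m, fun e => by
        rw [smul_smul, f.2]⟩) fun m m' => Subtype.ext (funext fun e => smul_add _ _ _))
      fun f g => AddMonoidHom.ext fun m => Subtype.ext (funext fun e => add_smul _ _ _))
    fun f a m => Subtype.ext (funext fun e => mul_smul _ _ _)

theorem ofTensor_tmul_coe (f : arrowModule k V) (m : M) (e : QuiverArrow V) :
    (ofTensor M (NCTensor.Tensor.tmul _ f m)).1 e = f.1 e • m := rfl

theorem ofTensor_toTensor (f : arrowTuples k V M) : ofTensor M (toTensor M f) = f := by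
  classical
  refine Subtype.ext (funext fun e => ?_)
  rw [toTensor, map_sum, AddSubgroup.val_finsetSum, Finset.sum_apply, Finset.sum_eq_single e]
  · rw [ofTensor_tmul_coe, arrowGenerator_self]
    exact f.2 e
  · intro e' _ h
    rw [ofTensor_tmul_coe, arrowGenerator_of_ne h.symm, zero_smul]
  · simp

theorem toTensor_ofTensor (t : NCTensor.Tensor (PathAlgebra k V) (arrowModule k V) M) :
    toTensor M (ofTensor M t) = t := by
  classical
  let F : arrowTuples k V M →+ NCTensor.Tensor (PathAlgebra k V) (arrowModule k V) M :=
    AddMonoidHom.mk' (toTensor M) fun f g => by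
      simp only [toTensor, AddSubgroup.coe_add, Pi.add_apply, NCTensor.Tensor.tmul_add,
        Finset.sum_add_distrib]
  refine DFunLike.congr_fun (f := F.comp (ofTensor M)) (g := AddMonoidHom.id _)
    (NCTensor.Tensor.hom_ext fun f m => ?_) t
  change ∑ e, NCTensor.Tensor.tmul _ (arrowGenerator k e) (f.1 e • m) = NCTensor.Tensor.tmul _ f m
  let G : arrowModule k V →+ NCTensor.Tensor (PathAlgebra k V) (arrowModule k V) M :=
    AddMonoidHom.mk' (fun g => NCTensor.Tensor.tmul _ g m) fun g g' =>
      NCTensor.Tensor.add_tmul g g' m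
  simp only [← NCTensor.Tensor.op_smul_tmul]
  refine (map_sum G _ _).symm.trans (congrArg G (Subtype.ext (funext fun e => ?_)))
  rw [AddSubmonoidClass.coe_finsetSum, Finset.sum_apply, Finset.sum_eq_single e]
  · change (arrowGenerator k e).1 e * f.1 e = f.1 e
    rw [arrowGenerator_self]
    exact f.2 e
  · intro e' _ h
    change (arrowGenerator k e').1 e * f.1 e' = 0
    rw [arrowGenerator_of_ne h.symm, zero_mul]
  · simp

/-- The map `x ⊗ m ↦ x m`. -/
def _root_.NCTensor.Tensor.smulHom (R : Type*) [Ring R] (M : Type*) [AddCommGroup M] [Module R M] :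
    NCTensor.Tensor R R M →+ M :=
  NCTensor.Tensor.lift
    (AddMonoidHom.mk' (fun x => AddMonoidHom.mk' (fun m => x • m) (smul_add x))
      fun x y => AddMonoidHom.ext (add_smul x y))
    fun x r m => mul_smul x r m

theorem _root_.NCTensor.Tensor.smulHom_bijective (R : Type*) [Ring R] (M : Type*) [AddCommGroup M]
    [Module R M] : Function.Bijective (NCTensor.Tensor.smulHom R M) := by
  refine Function.bijective_iff_has_inverse.mpr ⟨fun m => NCTensor.Tensor.tmul R 1 m, fun t => ?_,
    fun m => one_smul R m⟩
  refine DFunLike.congr_fun (f := (AddMonoidHom.mk' (fun m => NCTensor.Tensor.tmul R (1 : R) m)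
    (NCTensor.Tensor.tmul_add 1)).comp (NCTensor.Tensor.smulHom R M)) (g := AddMonoidHom.id _)
    (NCTensor.Tensor.hom_ext fun x m => ?_) t
  change NCTensor.Tensor.tmul R 1 (x • m) = NCTensor.Tensor.tmul R x m
  rw [← NCTensor.Tensor.op_smul_tmul, MulOpposite.smul_eq_mul_unop, MulOpposite.unop_op, one_mul]

/-- Under the isomorphisms of `(⨁ p_{r(e)}P(E)) ⊗ M` with `⨁ p_{r(e)}M` and of `P(E) ⊗ M` with `M`,
the map induced by the resolution is `arrowSum`. -/
theorem map_arrowModuleMap_bijective_iff :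
    Function.Bijective (NCTensor.Tensor.map (arrowModuleMap (k := k) (V := V)) M) ↔
      Function.Bijective (arrowSum (k := k) (V := V) M) := by
  have hto : Function.Bijective (toTensor (k := k) (V := V) M) :=
    Function.bijective_iff_has_inverse.mpr
      ⟨ofTensor M, ofTensor_toTensor M, toTensor_ofTensor M⟩
  have hcomp : arrowSum (k := k) (V := V) M = NCTensor.Tensor.smulHom (PathAlgebra k V) M ∘
      NCTensor.Tensor.map (arrowModuleMap (k := k) (V := V)) M ∘ toTensor M := by
    classical
    funext f
    rw [Function.comp_apply, Function.comp_apply, toTensor, map_sum, map_sum]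
    refine Finset.sum_congr rfl fun e _ => ?_
    rw [NCTensor.Tensor.map_tmul]
    change arrow k e.2.2 • f.1 e = (∑ e' : QuiverArrow V, arrow k e'.2.2 *
      (arrowGenerator k e).1 e') • f.1 e
    rw [Finset.sum_eq_single e (fun e' _ h => by rw [arrowGenerator_of_ne h, mul_zero]) (by simp),
      arrowGenerator_self, arrow_mul_vertex_self]
  rw [hcomp, Function.Bijective.of_comp_iff' (NCTensor.Tensor.smulHom_bijective _ _),
    Function.Bijective.of_comp_iff _ hto]

end tensor

variable (k V) in
/-- The standard resolution of `k^{E⁰}`, as a short complex of right modules. -/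
def resolution : ShortComplex (ModuleCat.{u} (PathAlgebra k V)ᵐᵒᵖ) :=
  ShortComplex.mk (ModuleCat.ofHom (arrowModuleMap (k := k) (V := V)))
    (ModuleCat.ofHom (augmentationLinear k V))
    (ModuleCat.hom_ext (LinearMap.ext fun f => (arrowModuleMap_exact _).mpr ⟨f, rfl⟩))

theorem resolution_shortExact : (resolution k V).ShortExact :=
  ModuleCat.shortComplex_shortExact _ arrowModuleMap_exact arrowModuleMap_injective
    augmentationLinear_surjective

theorem isBlanchfield_iff (M : Type*) [AddCommGroup M] [Module (PathAlgebra k V) M] :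
    IsBlanchfield k V M ↔ Function.Bijective (arrowSum (k := k) (V := V) M) := by
  have h1 : Projective (resolution k V).X₁ :=
    (IsProjective.iff_projective _).mp projective_arrowModule
  have h2 : Projective (resolution k V).X₂ :=
    (IsProjective.iff_projective _).mp (Module.projective_opposite _)
  rw [← map_arrowModuleMap_bijective_iff, IsBlanchfield]
  have h := resolution_shortExact.isZero_leftDerived_iff
    (NCTensor.tensorFunctor (PathAlgebra k V) M)
  rw [ConcreteCategory.isIso_iff_bijective] at h
  refine Iff.trans (forall_congr' fun q => ?_) h
  exact (AddCommGrpCat.isZero_iff_subsingleton).symm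

end PathAlgebra

end

/-! ### The L(E)-structure of a Blanchfield module -/

noncomputable section

namespace PathAlgebra

variable {k : Type u} [Field k] {V : Type} [Quiver.{0} V] [Fintype V]

theorem algHom_ext {A : Type*} [Ring A] [Algebra k A] {f g : PathAlgebra k V →ₐ[k] A}
    (hv : ∀ v, f (vertex k v) = g (vertex k v))
    (ha : ∀ {v w : V} (e : v ⟶ w), f (arrow k e) = g (arrow k e)) : f = g := by
  refine AlgHom.ext fun x => ?_
  have : x ∈ AlgHom.equalizer f g := by
    rw [subalgebra_eq_top (AlgHom.equalizer f g) (fun v => hv v) fun e => ha e]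
    trivial
  exact this

end PathAlgebra

namespace LeavittPathAlgebra

variable {k : Type u} [Field k] {V : Type} [Quiver.{0} V] [Fintype V]
  [∀ v w : V, Fintype (v ⟶ w)]

section towers

variable {M : Type*} [AddCommGroup M] [Module (LeavittPathAlgebra k V) M]
  [Module (PathAlgebra k V) M] [IsScalarTower (PathAlgebra k V) (LeavittPathAlgebra k V) M]

theorem arrow_smul (e : QuiverArrow V) (m : M) : PathAlgebra.arrow k e.2.2 • m = arr k e • m := by
  rw [← ofPathAlgebra_smul, ofPathAlgebra_arrow]

theorem vertex_smul (v : V) (m : M) : PathAlgebra.vertex k v • m = vtx k v • m := by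
  rw [← ofPathAlgebra_smul, ofPathAlgebra_vertex]

theorem isScalarTower_of_path [Module k M] [IsScalarTower k (PathAlgebra k V) M] :
    IsScalarTower k (LeavittPathAlgebra k V) M := by
  refine IsScalarTower.of_algebraMap_smul fun c y => ?_
  rw [← (ofPathAlgebra k V).commutes c, ofPathAlgebra_smul, algebraMap_smul]

/-- The tuple of ghosts is always a left inverse of `arrowSum`. By `sum_smul`, the sink terms are
the only obstruction to its being a right inverse, and sinks annihilate every sum `∑ e m_e`. -/
theorem arrowSum_bijective_iff :
    Function.Bijective (PathAlgebra.arrowSum (k := k) (V := V) M) ↔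
      ∀ v : V, IsQuiverSink v → ∀ m : M, vtx k v • m = 0 := by
  classical
  have hsum : ∀ f : PathAlgebra.arrowTuples k V M,
      PathAlgebra.arrowSum (k := k) (V := V) M f = ∑ e, arr k e • f.1 e := fun f =>
    Finset.sum_congr rfl fun e _ => arrow_smul e _
  constructor
  · intro h v hv m
    obtain ⟨f, rfl⟩ := h.2 m
    rw [hsum, Finset.smul_sum]
    exact Finset.sum_eq_zero fun e _ => vtx_smul_arr_smul_of_sink hv e _
  · intro h
    constructor
    · intro f g hfg
      rw [hsum, hsum] at hfg
      refine Subtype.ext (funext fun e => ?_)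
      have hf : ∀ f : PathAlgebra.arrowTuples k V M, gho k e • ∑ e', arr k e' • f.1 e' = f.1 e := by
        intro f
        rw [Finset.smul_sum]
        simp only [gho_smul_arr_smul]
        rw [Finset.sum_ite_eq Finset.univ e, if_pos (Finset.mem_univ e), ← vertex_smul, f.2 e]
      rw [← hf f, hfg, hf g]
    · intro m
      refine ⟨⟨fun e => gho k e • m, fun e => ?_⟩, ?_⟩
      · rw [vertex_smul, vtx_smul_gho_smul, if_pos rfl]
      · rw [hsum]
        conv_rhs => rw [← sum_smul (k := k) (V := V) m]
        rw [left_eq_add]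
        refine Finset.sum_eq_zero fun v _ => ?_
        split_ifs with hv
        exacts [h v hv m, rfl]

theorem isBlanchfield_iff_sink :
    IsBlanchfield k V M ↔ ∀ v : V, IsQuiverSink v → ∀ m : M, vtx k v • m = 0 := by
  rw [PathAlgebra.isBlanchfield_iff, arrowSum_bijective_iff]

end towers

section extension

variable {M : Type*} [AddCommGroup M] [Module (PathAlgebra k V) M] [Module k M]
  [IsScalarTower k (PathAlgebra k V) M]
  (hM : Function.Bijective (PathAlgebra.arrowSum (k := k) (V := V) M))

/-- The `e`-th component of the inverse of the bijection `⨁ p_{r(e)} M → M`. -/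
def component (e : QuiverArrow V) (m : M) : M := ((Equiv.ofBijective _ hM).symm m).1 e

theorem sum_arrow_smul_component (m : M) :
    ∑ e : QuiverArrow V, PathAlgebra.arrow k e.2.2 • component hM e m = m :=
  (Equiv.ofBijective _ hM).apply_symm_apply m

theorem vertex_smul_component (e : QuiverArrow V) (m : M) :
    PathAlgebra.vertex k e.tgt • component hM e m = component hM e m :=
  ((Equiv.ofBijective _ hM).symm m).2 e

/-- Coordinates are unique, so each identity for `component` is checked by exhibiting a tuple with
the right sum. -/
theorem component_eq {f : QuiverArrow V → M} (hf : ∀ e, PathAlgebra.vertex k e.tgt • f e = f e)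
    {m : M} (h : ∑ e : QuiverArrow V, PathAlgebra.arrow k e.2.2 • f e = m) (e : QuiverArrow V) :
    component hM e m = f e := by
  have : (Equiv.ofBijective _ hM).symm m = ⟨f, hf⟩ :=
    (Equiv.symm_apply_eq _).mpr h.symm
  rw [component, this]

/-- The `e`-th component of the inverse of the bijection `⨁ p_{r(e)} M → M`, as a linear map. -/
def componentLinear (e : QuiverArrow V) : Module.End k M where
  toFun := component hM e
  map_add' m n := component_eq hM
    (f := fun e => component hM e m + component hM e n)
    (fun e => by rw [smul_add, vertex_smul_component, vertex_smul_component])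
    (by simp only [smul_add, Finset.sum_add_distrib, sum_arrow_smul_component]) e
  map_smul' c m := component_eq hM (f := fun e => c • component hM e m)
    (fun e => by rw [smul_comm, vertex_smul_component])
    (by
      simp only [smul_comm _ c, ← Finset.smul_sum, sum_arrow_smul_component]) e

theorem isFamily_component : IsFamily (fun v => Algebra.lsmul k k M (PathAlgebra.vertex k v))
    (fun e : QuiverArrow V => Algebra.lsmul k k M (PathAlgebra.arrow k e.2.2))
    (componentLinear hM) := by
  classical
  have hp := PathAlgebra.isPathFamily (k := k) (V := V)
  refine
  { idem := fun v => by rw [← map_mul, hp.idem]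
    orthogonal := fun v w h => by rw [← map_mul, hp.orthogonal v w h, map_zero]
    sum_eq_one := by rw [← map_sum, hp.sum_eq_one, map_one]
    src_mul := fun e => by rw [← map_mul, PathAlgebra.vertex_mul_arrow_self]
    mul_tgt := fun e => by rw [← map_mul, PathAlgebra.arrow_mul_vertex_self]
    tgt_mul := fun e => LinearMap.ext fun m => vertex_smul_component hM e m
    mul_src := fun e => LinearMap.ext fun m => ?_
    gho_mul_arr := fun e e' => LinearMap.ext fun m => ?_
    sum_arr_gho := LinearMap.ext fun m => ?_ }
  -- Multiplication by `p_{s(e)}` retains the terms `e' m_{e'}` whose arrow has source `s(e)` and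
  -- kills the others.
  · refine (component_eq hM (f := fun e' => if e'.src = e.src then component hM e' m else 0)
      (fun e' => ?_) ?_ e).trans (if_pos rfl)
    · split_ifs
      exacts [vertex_smul_component hM e' m, smul_zero _]
    · change _ = PathAlgebra.vertex k e.src • m
      conv_rhs => rw [← sum_arrow_smul_component hM m]
      rw [Finset.smul_sum]
      refine Finset.sum_congr rfl fun e' _ => ?_
      rw [smul_smul]
      split_ifs with h
      · rw [← h, PathAlgebra.vertex_mul_arrow_self]
      · rw [PathAlgebra.vertex_mul_arrow_of_ne h, zero_smul, smul_zero]
  · refine (component_eq hM (f := fun e => if e = e' then PathAlgebra.vertex k e.tgt • m else 0)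
      (fun e => ?_) ?_ e).trans ?_
    · split_ifs
      · rw [smul_smul, hp.idem]
      · exact smul_zero _
    · rw [Finset.sum_eq_single e' (fun e _ h => by rw [if_neg h, smul_zero]) (by simp), if_pos rfl,
        smul_smul, PathAlgebra.arrow_mul_vertex_self]
      rfl
    · split_ifs <;> rfl
  · rw [LinearMap.add_apply, LinearMap.sum_apply, LinearMap.sum_apply]
    rw [Finset.sum_eq_zero (s := Finset.univ (α := V)), add_zero]
    · exact sum_arrow_smul_component hM m
    · intro v _
      split_ifs with hv
      · change PathAlgebra.vertex k v • m = 0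
        rw [← sum_arrow_smul_component hM m, Finset.smul_sum]
        exact Finset.sum_eq_zero fun e _ => by
          rw [smul_smul, PathAlgebra.vertex_mul_arrow_of_ne (hv e), zero_smul]
      · rfl

theorem lift_component_ofPathAlgebra (x : PathAlgebra k V) :
    (isFamily_component hM).lift (ofPathAlgebra k V x) = Algebra.lsmul k k M x := by
  refine DFunLike.congr_fun (f := (isFamily_component hM).lift.comp (ofPathAlgebra k V))
    (PathAlgebra.algHom_ext (fun v => ?_) fun {v w} e => ?_) x
  · rw [AlgHom.comp_apply, ofPathAlgebra_vertex, IsFamily.lift_vtx]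
  · rw [AlgHom.comp_apply, ofPathAlgebra_arrow ⟨v, w, e⟩, IsFamily.lift_arr]

/-- This is the uniqueness of the structure: vertices and arrows act as given by P(E), and `e̅`
applied to `m = ∑ e' m_{e'}` can only return `m_e`. -/
theorem smul_eq_lift_component [Module (LeavittPathAlgebra k V) M]
    [IsScalarTower (PathAlgebra k V) (LeavittPathAlgebra k V) M] (l : LeavittPathAlgebra k V)
    (m : M) : l • m = (isFamily_component hM).lift l m := by
  classical
  have := isScalarTower_of_path (k := k) (V := V) (M := M)
  refine LinearMap.congr_fun (f := Algebra.lsmul k k M l) (DFunLike.congr_fun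
    (f := Algebra.lsmul k k M) (algHom_ext (fun v => ?_) (fun e => ?_) fun e => ?_) l) m
  · rw [IsFamily.lift_vtx]
    exact LinearMap.ext fun m => (vertex_smul v m).symm
  · rw [IsFamily.lift_arr]
    exact LinearMap.ext fun m => (arrow_smul e m).symm
  · rw [IsFamily.lift_gho]
    refine LinearMap.ext fun m => ?_
    change gho k e • m = component hM e m
    conv_lhs => rw [← sum_arrow_smul_component hM m]
    simp only [arrow_smul, Finset.smul_sum, gho_smul_arr_smul]
    rw [Finset.sum_ite_eq Finset.univ e, if_pos (Finset.mem_univ e), ← vertex_smul,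
      vertex_smul_component]

end extension

theorem existsUnique_module (M : Type*) [AddCommGroup M] [Module (PathAlgebra k V) M]
    (h : IsBlanchfield k V M) : ∃! _inst : Module (LeavittPathAlgebra k V) M,
      IsScalarTower (PathAlgebra k V) (LeavittPathAlgebra k V) M := by
  let _ : Module k M := Module.compHom M (algebraMap k (PathAlgebra k V))
  have : IsScalarTower k (PathAlgebra k V) M := IsScalarTower.of_algebraMap_smul fun _ _ => rfl
  have hM := (PathAlgebra.isBlanchfield_iff M).mp h
  let inst₀ : Module (LeavittPathAlgebra k V) M :=
    Module.compHom M (isFamily_component hM).lift.toRingHom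
  refine ⟨inst₀, ⟨fun x l m => ?_⟩, fun inst hinst => ?_⟩
  · change (isFamily_component hM).lift (ofPathAlgebra k V x * l) m =
      x • (isFamily_component hM).lift l m
    rw [map_mul, Module.End.mul_apply, lift_component_ofPathAlgebra]
    rfl
  · exact Module.ext' _ _ fun l m => smul_eq_lift_component hM l m

end LeavittPathAlgebra

end

/-! ### Existence of ghost-stable generating subspaces; finite length and finite presentation -/

noncomputable section

namespace LeavittPathAlgebra

variable {k : Type u} [Field k] {V : Type} [Quiver.{0} V] [Fintype V]
  [∀ v w : V, Fintype (v ⟶ w)]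
  {M : Type*} [AddCommGroup M] [Module k M] [Module (LeavittPathAlgebra k V) M]
  [IsScalarTower k (LeavittPathAlgebra k V) M]

section existence

variable (k V) in
/-- The span of the elements `p_v x`, for `x` in a set `S` and vertices `v`. -/
def vertexSpan (S : Set M) : Submodule k M :=
  Submodule.span k (Set.image2 (fun (v : V) x => vtx k v • x) Set.univ S)

/-- The sums of elements that are obtained from elements of `B` by the action of at most `n` of the
elements `g e`. -/
def filtration (g : QuiverArrow V → LeavittPathAlgebra k V) (B : Submodule k M) :
    ℕ → Submodule k M
  | 0 => B
  | n + 1 => filtration g B n ⊔ ⨆ e, (filtration g B n).map (Algebra.lsmul k k M (g e))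

variable {g : QuiverArrow V → LeavittPathAlgebra k V} {B : Submodule k M}

theorem filtration_monotone (g : QuiverArrow V → LeavittPathAlgebra k V) (B : Submodule k M) :
    Monotone (filtration g B) :=
  monotone_nat_of_le_succ fun _ => le_sup_left

theorem filtration_mono {C : Submodule k M} (h : B ≤ C) (n : ℕ) :
    filtration g B n ≤ filtration g C n := by
  induction n with
  | zero => exact h
  | succ n ih => exact sup_le_sup ih (iSup_mono fun e => Submodule.map_mono ih)

theorem finiteDimensional_filtration [hB : FiniteDimensional k B] (n : ℕ) :
    FiniteDimensional k (filtration g B n) := by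
  induction n with
  | zero => exact hB
  | succ n ih => rw [filtration]; infer_instance

theorem finiteDimensional_vertexSpan {S : Set M} (hS : S.Finite) :
    FiniteDimensional k (vertexSpan k V S) :=
  FiniteDimensional.span_of_finite k (Set.finite_univ.image2 _ hS)

theorem smul_mem_filtration {n : ℕ} {m : M} (hm : m ∈ filtration g B n) (e : QuiverArrow V) :
    g e • m ∈ filtration g B (n + 1) :=
  Submodule.mem_sup_right (Submodule.mem_iSup_of_mem e ⟨m, hm, rfl⟩)

theorem filtration_induction {C : Submodule k M} {n : ℕ} (h0 : B ≤ C)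
    (h1 : ∀ i < n, ∀ e : QuiverArrow V, ∀ m ∈ filtration g B i, g e • m ∈ C) :
    filtration g B n ≤ C := by
  induction n with
  | zero => exact h0
  | succ n ih =>
    refine sup_le (ih fun i hi => h1 i (hi.trans n.lt_succ_self)) (iSup_le fun e => ?_)
    rintro _ ⟨m, hm, rfl⟩
    exact h1 n n.lt_succ_self e m hm

theorem vtx_smul_mem_vertexSpan (S : Set M) (v : V) {m : M} (hm : m ∈ vertexSpan k V S) :
    vtx k v • m ∈ vertexSpan k V S := by
  classical
  suffices vertexSpan k V S ≤ (vertexSpan k V S).comap (Algebra.lsmul k k M (vtx k v)) from this hm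
  refine Submodule.span_le.mpr ?_
  rintro _ ⟨v', -, x, hx, rfl⟩
  change vtx k v • vtx k v' • x ∈ vertexSpan k V S
  rw [vtx_smul_vtx_smul]
  split_ifs
  exacts [Submodule.subset_span ⟨v, trivial, x, hx, rfl⟩, Submodule.zero_mem _]

theorem subset_vertexSpan {S : Set M} : S ⊆ vertexSpan k V S := fun x hx => by
  rw [← sum_vtx_smul (k := k) (V := V) x]
  exact Submodule.sum_mem _ fun v _ => Submodule.subset_span ⟨v, trivial, x, hx, rfl⟩

theorem vtx_smul_mem_filtration (hB : ∀ v : V, ∀ m ∈ B, vtx k v • m ∈ B)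
    (hg : ∀ (v : V) e, vtx k v * g e = g e ∨ vtx k v * g e = 0) (n : ℕ) (v : V) {m : M}
    (hm : m ∈ filtration g B n) : vtx k v • m ∈ filtration g B n := by
  refine filtration_induction (n := n) (C := (filtration g B n).comap
    (Algebra.lsmul k k M (vtx k v))) (fun m hm => filtration_monotone g B n.zero_le (hB v m hm))
    (fun i hi e m hm => ?_) hm
  change vtx k v • g e • m ∈ filtration g B n
  rw [smul_smul]
  rcases hg v e with h | h
  · rw [h]
    exact filtration_monotone g B hi (smul_mem_filtration hm e)
  · rw [h, zero_smul]
    exact Submodule.zero_mem _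

theorem vtx_mul_arr_eq_or (v : V) (e : QuiverArrow V) :
    vtx k v * arr k e = arr k e ∨ vtx k v * arr k e = 0 := by
  by_cases h : v = e.src
  · exact .inl (h ▸ (isFamily k).src_mul e)
  · exact .inr ((isFamily k).mul_src_of_ne h)

theorem vtx_mul_gho_eq_or (v : V) (e : QuiverArrow V) :
    vtx k v * gho k e = gho k e ∨ vtx k v * gho k e = 0 := by
  by_cases h : v = e.tgt
  · exact .inl (h ▸ (isFamily k).tgt_mul e)
  · refine .inr ?_
    rw [← (isFamily k).tgt_mul, ← mul_assoc, (isFamily k).orthogonal _ _ h, zero_mul]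

variable (k V) in
/-- The span of the elements `α x`, for `x` in a set `S` and paths `α` of length at most `n`. -/
abbrev arrowFiltration (S : Set M) (n : ℕ) : Submodule k M :=
  filtration (V := V) (arr k) (vertexSpan k V S) n

theorem vtx_smul_mem_arrowFiltration (S : Set M) (n : ℕ) (v : V) {m : M}
    (hm : m ∈ arrowFiltration k V S n) : vtx k v • m ∈ arrowFiltration k V S n :=
  vtx_smul_mem_filtration (fun v _ => vtx_smul_mem_vertexSpan S v) vtx_mul_arr_eq_or n v hm

theorem exists_mem_arrowFiltration [Module (PathAlgebra k V) M]
    [IsScalarTower (PathAlgebra k V) (LeavittPathAlgebra k V) M] {S : Set M}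
    (hS : Submodule.span (PathAlgebra k V) S = ⊤) (m : M) :
    ∃ n, m ∈ arrowFiltration k V S n := by
  have hmem : ∀ y, y ∈ (⨆ n, arrowFiltration k V S n) ↔ ∃ n, y ∈ arrowFiltration k V S n :=
    fun y => Submodule.mem_iSup_of_directed _ (filtration_monotone _ _).directed_le
  have : IsScalarTower k (PathAlgebra k V) M := IsScalarTower.of_algebraMap_smul fun c y => by
    rw [← ofPathAlgebra_smul, AlgHom.commutes, algebraMap_smul]
  let N : Submodule (PathAlgebra k V) M :=
    PathAlgebra.submoduleOfGenerators (⨆ n, arrowFiltration k V S n)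
      (fun v y hy => by
        obtain ⟨n, hn⟩ := (hmem y).mp hy
        rw [vertex_smul]
        exact (hmem _).mpr ⟨n, vtx_smul_mem_arrowFiltration S n v hn⟩)
      (fun {v w} e y hy => by
        obtain ⟨n, hn⟩ := (hmem y).mp hy
        rw [arrow_smul ⟨v, w, e⟩]
        exact (hmem _).mpr ⟨n + 1, smul_mem_filtration hn _⟩)
  have hN : Submodule.span (PathAlgebra k V) S ≤ N := Submodule.span_le.mpr fun y hy => by
    exact (hmem y).mpr ⟨0, subset_vertexSpan hy⟩
  exact (hmem m).mp (hN (hS ▸ trivial))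

/-- A module that is finitely generated over the path algebra is generated by a
finite-dimensional subspace that is stable under the inverse path algebra. -/
theorem exists_isGhostStable [Module (PathAlgebra k V) M]
    [IsScalarTower (PathAlgebra k V) (LeavittPathAlgebra k V) M]
    [hfin : Module.Finite (PathAlgebra k V) M] :
    ∃ B : Submodule k M, FiniteDimensional k B ∧ IsGhostStable V B ∧
      Submodule.span (LeavittPathAlgebra k V) (B : Set M) = ⊤ := by
  classical
  obtain ⟨S, hS⟩ := hfin.fg_top
  choose d hd using fun x : QuiverArrow V × V × M =>
    exists_mem_arrowFiltration hS (gho k x.1 • vtx k x.2.1 • x.2.2)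
  -- Only finitely many elements `e̅ p_v x` with `x ∈ S` occur; `D` is a path length that reaches
  -- all of them.
  let T : Finset (QuiverArrow V × V × M) := Finset.univ ×ˢ Finset.univ ×ˢ S
  let D := T.sup d
  have hbase : ∀ e : QuiverArrow V, ∀ v : V, ∀ x ∈ S,
      gho k e • vtx k v • x ∈ arrowFiltration k V (S : Set M) D := fun e v x hx =>
    filtration_monotone _ _ (Finset.le_sup (f := d) (b := (e, v, x)) (by simp [T, hx])) (hd _)
  refine ⟨arrowFiltration k V (S : Set M) D,
    have := finiteDimensional_vertexSpan (k := k) (V := V) S.finite_toSet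
    finiteDimensional_filtration D,
    ⟨fun v m hm => vtx_smul_mem_arrowFiltration _ D v hm, fun e m hm => ?_⟩, ?_⟩
  -- A ghost cancels or kills the outermost arrow of a nontrivial path; on trivial paths, the choice
  -- of `D` keeps the result in the filtration.
  · refine filtration_induction (n := D) (C := (arrowFiltration k V (S : Set M) D).comap
      (Algebra.lsmul k k M (gho k e))) (Submodule.span_le.mpr ?_) (fun i hi e' m hm => ?_) hm
    · rintro _ ⟨v, -, x, hx, rfl⟩
      exact hbase e v x hx
    change gho k e • arr k e' • m ∈ arrowFiltration k V (S : Set M) D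
    rw [gho_smul_arr_smul]
    split_ifs
    · exact vtx_smul_mem_arrowFiltration _ D _ (filtration_monotone _ _ hi.le hm)
    · exact Submodule.zero_mem _
  · refine eq_top_iff.mpr fun m _ => ?_
    have hm : m ∈ Submodule.span (PathAlgebra k V) (S : Set M) := hS ▸ trivial
    exact Submodule.span_mono (subset_vertexSpan.trans (filtration_monotone _ _ D.zero_le))
      (span_pathAlgebra_le_span _ hm)

end existence

section finiteness

theorem eventual_submodule_le (N : Submodule (LeavittPathAlgebra k V) M) {n : ℕ} {m : M}
    (hm : m ∈ eventual V (N.restrictScalars k) n) : m ∈ N := by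
  induction n generalizing m with
  | zero => exact hm
  | succ n ih =>
    obtain ⟨h1, h2⟩ := mem_eventual_succ.mp hm
    rw [← sum_smul (k := k) (V := V) m]
    refine N.add_mem (N.sum_mem fun e _ => N.smul_mem _ (ih (h1 e))) (N.sum_mem fun v _ => ?_)
    split_ifs with hv
    exacts [ih (h2 v hv), N.zero_mem]

theorem IsGhostStable.exists_mem_eventual_inf {B : Submodule k M} (hB : IsGhostStable V B)
    (hspan : Submodule.span (LeavittPathAlgebra k V) (B : Set M) = ⊤)
    {N : Submodule (LeavittPathAlgebra k V) M} {m : M} (hm : m ∈ N) :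
    ∃ n, m ∈ LeavittPathAlgebra.eventual V (B ⊓ N.restrictScalars k) n := by
  obtain ⟨n, hn⟩ := hB.exists_mem_eventual (hspan ▸ Submodule.mem_top (x := m))
  exact ⟨n, mem_eventual_inf hn (eventual_submodule N hm n)⟩

/-- If `N ≤ N'` have the same intersection with `B`, ghost words move each element of `N'` into `B ⊓
N' ⊆ N`, and reconstruction puts it into `N`. Chain conditions thus pass from `B` to `M`. -/
theorem IsGhostStable.strictMono_comap {B : Submodule k M} (hB : IsGhostStable V B)
    (hspan : Submodule.span (LeavittPathAlgebra k V) (B : Set M) = ⊤) :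
    StrictMono fun N : Submodule (LeavittPathAlgebra k V) M =>
      (N.restrictScalars k).comap B.subtype := by
  intro N N' h
  refine ⟨fun b hb => h.1 hb, fun hle => h.2 fun m hm => ?_⟩
  obtain ⟨n, hn⟩ := hB.exists_mem_eventual_inf hspan hm
  refine eventual_submodule_le N (eventual_mono (fun b hb => ?_) n hn)
  exact hle (show (⟨b, hb.1⟩ : B) ∈ (N'.restrictScalars k).comap B.subtype from hb.2)

theorem IsGhostStable.isFiniteLength {B : Submodule k M} (hB : IsGhostStable V B)
    [FiniteDimensional k B]
    (hspan : Submodule.span (LeavittPathAlgebra k V) (B : Set M) = ⊤) :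
    IsFiniteLength (LeavittPathAlgebra k V) M := by
  have hmono := hB.strictMono_comap hspan
  rw [isFiniteLength_iff_isNoetherian_isArtinian]
  exact ⟨isNoetherian_iff'.mpr hmono.wellFoundedGT, hmono.wellFoundedLT⟩

/-- The generators are a basis of `B`, and the relations record how vertices and ghosts act on it.
In the module so presented, the image of `B` is ghost-stable, generates, and maps injectively to
`M`, so no further relations are needed. -/
theorem IsGhostStable.finitePresentation {B : Submodule k M} (hB : IsGhostStable V B)
    [FiniteDimensional k B]
    (hspan : Submodule.span (LeavittPathAlgebra k V) (B : Set M) = ⊤) :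
    Module.FinitePresentation (LeavittPathAlgebra k V) M := by
  classical
  let b := Module.finBasis k B
  let π : (Fin (Module.finrank k B) →₀ LeavittPathAlgebra k V) →ₗ[LeavittPathAlgebra k V] M :=
    Finsupp.linearCombination _ fun i => (b i : M)
  let act : V ⊕ QuiverArrow V → LeavittPathAlgebra k V := Sum.elim (vtx k) (gho k)
  have hact : ∀ g, ∀ y ∈ B, act g • y ∈ B := by
    rintro (v | e)
    exacts [hB.1 v, hB.2 e]
  let s₀ : B →ₗ[k] (Fin (Module.finrank k B) →₀ LeavittPathAlgebra k V) :=
    b.constr k fun i => Finsupp.single i 1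
  have hπs : ∀ y, π (s₀ y) = y := by
    have : (π.restrictScalars k).comp s₀ = B.subtype := b.ext fun i => by
      simp [s₀, π]
    exact fun y => LinearMap.congr_fun this y
  let rel : (V ⊕ QuiverArrow V) × Fin (Module.finrank k B) →
      (Fin (Module.finrank k B) →₀ LeavittPathAlgebra k V) := fun x =>
    act x.1 • s₀ (b x.2) - s₀ ⟨act x.1 • (b x.2 : M), hact x.1 _ (b x.2).2⟩
  let K := Submodule.span (LeavittPathAlgebra k V) (Set.range rel)
  have hK : K ≤ LinearMap.ker π := by
    refine Submodule.span_le.mpr ?_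
    rintro _ ⟨x, rfl⟩
    simp only [rel, SetLike.mem_coe, LinearMap.mem_ker, map_sub, map_smul, hπs, sub_self]
  let f := K.liftQ π hK
  let s : B →ₗ[k] ((Fin (Module.finrank k B) →₀ LeavittPathAlgebra k V) ⧸ K) :=
    (K.mkQ.restrictScalars k).comp s₀
  have hs : ∀ g, ∀ y : B, act g • s y = s ⟨act g • (y : M), hact g y y.2⟩ := by
    intro g
    have : (Algebra.lsmul k k _ (act g)).comp s =
        s.comp ((Algebra.lsmul k k M (act g)).restrict (hact g)) := b.ext fun i => by
      refine (Submodule.Quotient.eq K).mpr ?_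
      exact Submodule.subset_span ⟨(g, i), rfl⟩
    exact fun y => LinearMap.congr_fun this y
  have hrange : Submodule.span (LeavittPathAlgebra k V) (LinearMap.range s : Set (_ ⧸ K)) = ⊤ := by
    refine eq_top_iff.mpr fun y _ => ?_
    obtain ⟨y, rfl⟩ := K.mkQ_surjective y
    induction y using Finsupp.induction_linear with
    | zero => rw [map_zero]; exact Submodule.zero_mem _
    | add x y hx hy => rw [map_add]; exact Submodule.add_mem _ (hx trivial) (hy trivial)
    | single i l =>
      have : K.mkQ (Finsupp.single i l) = l • s (b i) := by
        change _ = l • K.mkQ (s₀ (b i))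
        rw [← map_smul, Module.Basis.constr_basis, Finsupp.smul_single, smul_eq_mul, mul_one]
      rw [this]
      exact Submodule.smul_mem _ _ (Submodule.subset_span ⟨_, rfl⟩)
  have hinj : Function.Injective f := by
    refine injective_of_comp_injective (s := s) ⟨?_, ?_⟩ hrange f ?_
    · rintro v _ ⟨y, rfl⟩
      exact ⟨_, (hs (.inl v) y).symm⟩
    · rintro e _ ⟨y, rfl⟩
      exact ⟨_, (hs (.inr e) y).symm⟩
    · intro y y' h
      exact Subtype.ext ((hπs y).symm.trans (Eq.trans h (hπs y')))
  have hker : LinearMap.ker π = K := by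
    refine le_antisymm (fun y hy => ?_) hK
    rw [← Submodule.Quotient.mk_eq_zero]
    exact hinj ((LinearMap.mem_ker.mp hy).trans (map_zero f).symm)
  refine Module.finitePresentation_of_surjective π ?_ ?_
  · rw [← LinearMap.range_eq_top, eq_top_iff, ← hspan, Submodule.span_le]
    intro y hy
    exact ⟨s₀ ⟨y, hy⟩, hπs ⟨y, hy⟩⟩
  · rw [hker]
    exact Submodule.fg_span (Set.finite_range rel)

end finiteness

end LeavittPathAlgebra

end

/-! ### Gradings and the absence of projective submodules -/

noncomputable section

section grading

variable {k : Type*} [Field k] {R : Type*} [Ring R] [Algebra k R]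

/-- A projective module over a graded ring has no nonzero finite-dimensional subspace on which
elements of degree `-1` act without common zeros. -/
theorem Submodule.eq_bot_of_projective_of_degree
    (δ : R →ₐ[k] AddMonoidAlgebra R ℤ) (hδ : Function.Injective δ) {ι : Type*} (g : ι → R)
    (hg : ∀ i, δ (g i) = AddMonoidAlgebra.single (-1) (g i))
    {N : Type*} [AddCommGroup N] [Module k N] [Module R N] [IsScalarTower k R N]
    [hN : Module.Projective R N] (B : Submodule k N) [FiniteDimensional k B]
    (hB : ∀ i, ∀ b ∈ B, g i • b ∈ B) (h0 : ∀ b ∈ B, (∀ i, g i • b = 0) → b = 0) : B = ⊥ := by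
  obtain ⟨s, hs⟩ := hN.out
  have hδmul : ∀ i x z, (δ (g i * x)).coeff z = g i * (δ x).coeff (z + 1) := fun i x z => by
    rw [map_mul, hg, AddMonoidAlgebra.coeff_single_mul_apply, neg_neg, add_comm]
  let bounded (D : ℕ) : Submodule k N :=
    { carrier := {b | ∀ n z, D < z.natAbs → (δ (s b n)).coeff z = 0}
      add_mem' := fun {a b} ha hb n z hz => by
        rw [map_add, Finsupp.add_apply, map_add, AddMonoidAlgebra.coeff_add, Finsupp.add_apply,
          ha n z hz, hb n z hz, add_zero]
      zero_mem' := fun n z hz => by simp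
      smul_mem' := fun c b hb n z hz => by
        rw [← algebraMap_smul R c b, map_smul, Finsupp.smul_apply, algebraMap_smul, map_smul,
          AddMonoidAlgebra.coeff_smul_apply, hb n z hz, smul_zero] }
  have hbdd : ∀ b, ∃ D, b ∈ bounded D := fun b => by
    refine ⟨(s b).support.sup fun n => (δ (s b n)).coeff.support.sup Int.natAbs,
      fun n z hz => ?_⟩
    by_contra hne
    have hn : n ∈ (s b).support := Finsupp.mem_support_iff.mpr fun h => hne (by rw [h]; simp)
    have hz' : z ∈ (δ (s b n)).coeff.support := Finsupp.mem_support_iff.mpr hne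
    exact absurd hz (not_lt.mpr ((Finset.le_sup (f := Int.natAbs) hz').trans
      (Finset.le_sup (f := fun n => (δ (s b n)).coeff.support.sup Int.natAbs) hn)))
  have hmono : Monotone bounded := fun D D' h b hb n z hz => hb n z (h.trans_lt hz)
  obtain ⟨S, hS⟩ := (Submodule.fg_iff_finiteDimensional B).mpr inferInstance
  choose d hd using hbdd
  -- Each vector has finitely many coordinates with finitely many degrees; a finite spanning set of
  -- `B` gives a common bound `D`.
  have hBD : B ≤ bounded (S.sup d) := by
    rw [← hS, Submodule.span_le]
    exact fun b hb => hmono (Finset.le_sup hb) (hd b)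
  set D := S.sup d
  -- All degrees of `b` are at least `-D`, so those below `j - D` form a window of length `j`. Each
  -- `g i` lowers the degrees and thereby shortens the window; an empty window forces `s b = 0`.
  have key : ∀ j : ℕ, ∀ b ∈ B, (∀ n z, (δ (s b n)).coeff z ≠ 0 → z + D < j) → b = 0 := by
    intro j
    induction j with
    | zero =>
      intro b hb hlt
      have hsb : s b = 0 := Finsupp.ext fun n => by
        refine hδ ?_
        rw [Finsupp.zero_apply, map_zero]
        refine AddMonoidAlgebra.coeff_injective (Finsupp.ext fun z => ?_)
        by_contra hne
        have h1 := hlt n z hne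
        exact hne (hBD hb n z (by omega))
      rw [← hs b, hsb, map_zero]
    | succ j ih =>
      intro b hb hlt
      refine h0 b hb fun i => ih _ (hB i b hb) fun n z hne => ?_
      rw [map_smul, Finsupp.smul_apply, smul_eq_mul, hδmul] at hne
      have := hlt n (z + 1) fun h => hne (by rw [h, mul_zero])
      push_cast at this
      omega
  -- The interval from `-D` to `D` contains `2 * D + 1` degrees.
  refine (Submodule.eq_bot_iff _).mpr fun b hb => key (2 * D + 1) b hb fun n z hne => ?_
  have : z.natAbs ≤ D := not_lt.mp fun h => hne (hBD hb n z h)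
  push_cast
  omega

/-- The homomorphism of algebras that evaluates a Laurent polynomial at `1`. -/
def laurentEval (k : Type*) [Field k] (R : Type*) [Ring R] [Algebra k R] :
    AddMonoidAlgebra R ℤ →ₐ[k] R :=
  AddMonoidAlgebra.liftNCAlgHom (AlgHom.id k R) 1 fun _ _ => Commute.one_right _

theorem laurentEval_single (z : ℤ) (r : R) :
    laurentEval k R (AddMonoidAlgebra.single z r) = r :=
  (AddMonoidAlgebra.liftNC_single _ _ _ _).trans (mul_one r)

end grading

namespace PathAlgebra

variable {k : Type u} [Field k] {V : Type} [Quiver.{0} V] [Fintype V]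

theorem isPathFamily_single : IsPathFamily
    (fun v : V => AddMonoidAlgebra.single (0 : ℤ) (vertex k v))
    (fun {_ _} e => AddMonoidAlgebra.single (-1 : ℤ) (arrow k e)) where
  idem v := by rw [AddMonoidAlgebra.single_mul_single, isPathFamily.idem, add_zero]
  orthogonal v w h := by
    rw [AddMonoidAlgebra.single_mul_single, isPathFamily.orthogonal v w h,
      AddMonoidAlgebra.single_zero]
  sum_eq_one :=
    (map_sum (AddMonoidAlgebra.singleZeroAlgHom (R := k)) _ _).symm.trans
      ((congrArg _ isPathFamily.sum_eq_one).trans (map_one _))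
  source_mul e := by rw [AddMonoidAlgebra.single_mul_single, isPathFamily.source_mul, zero_add]
  mul_target e := by rw [AddMonoidAlgebra.single_mul_single, isPathFamily.mul_target, add_zero]

variable (k V) in
/-- The grading of the path algebra by the negatives of the lengths of paths. -/
def gradingHom : PathAlgebra k V →ₐ[k] AddMonoidAlgebra (PathAlgebra k V) ℤ :=
  lift isPathFamily_single

theorem gradingHom_injective : Function.Injective (gradingHom k V) := by
  refine Function.LeftInverse.injective (g := laurentEval k _) fun x => ?_
  refine DFunLike.congr_fun (f := (laurentEval k _).comp (gradingHom k V)) (g := AlgHom.id k _)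
    (algHom_ext (fun v => ?_) fun e => ?_) x
  · rw [AlgHom.comp_apply, gradingHom, lift_vertex, laurentEval_single, AlgHom.id_apply]
  · rw [AlgHom.comp_apply, gradingHom, lift_arrow, laurentEval_single, AlgHom.id_apply]

end PathAlgebra

namespace LeavittPathAlgebra

variable {k : Type u} [Field k] {V : Type} [Quiver.{0} V] [Fintype V]
  [∀ v w : V, Fintype (v ⟶ w)]

theorem isFamily_single : IsFamily
    (fun v : V => AddMonoidAlgebra.single (0 : ℤ) (vtx k v))
    (fun e => AddMonoidAlgebra.single (1 : ℤ) (arr k e))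
    (fun e => AddMonoidAlgebra.single (-1 : ℤ) (gho k e)) := by
  classical
  have h := isFamily k (V := V)
  refine
  { idem := fun v => by rw [AddMonoidAlgebra.single_mul_single, h.idem, add_zero]
    orthogonal := fun v w hvw => by
      rw [AddMonoidAlgebra.single_mul_single, h.orthogonal v w hvw, AddMonoidAlgebra.single_zero]
    sum_eq_one := (map_sum (AddMonoidAlgebra.singleZeroAlgHom (R := k)) _ _).symm.trans
      ((congrArg _ h.sum_eq_one).trans (map_one _))
    src_mul := fun e => by rw [AddMonoidAlgebra.single_mul_single, h.src_mul, zero_add]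
    mul_tgt := fun e => by rw [AddMonoidAlgebra.single_mul_single, h.mul_tgt, add_zero]
    tgt_mul := fun e => by rw [AddMonoidAlgebra.single_mul_single, h.tgt_mul, zero_add]
    mul_src := fun e => by rw [AddMonoidAlgebra.single_mul_single, h.mul_src, add_zero]
    gho_mul_arr := fun e e' => ?_
    sum_arr_gho := ?_ }
  · rw [AddMonoidAlgebra.single_mul_single, h.gho_mul_arr, neg_add_cancel]
    split_ifs
    exacts [rfl, AddMonoidAlgebra.single_zero _]
  · have := congrArg (AddMonoidAlgebra.singleZeroAlgHom (R := k) (M := ℤ)) h.sum_arr_gho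
    rw [map_add, map_sum, map_sum, map_one] at this
    refine Eq.trans ?_ this
    congr 1
    · refine Finset.sum_congr rfl fun e _ => ?_
      rw [AddMonoidAlgebra.single_mul_single, add_neg_cancel]
      rfl
    · refine Finset.sum_congr rfl fun v _ => ?_
      split_ifs
      exacts [rfl, (map_zero _).symm]

variable (k V) in
/-- The grading of the Leavitt path algebra in which arrows have degree one. -/
def gradingHom : LeavittPathAlgebra k V →ₐ[k] AddMonoidAlgebra (LeavittPathAlgebra k V) ℤ :=
  isFamily_single.lift

theorem gradingHom_injective : Function.Injective (gradingHom k V) := by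
  refine Function.LeftInverse.injective (g := laurentEval k _) fun x => ?_
  refine DFunLike.congr_fun (f := (laurentEval k _).comp (gradingHom k V)) (g := AlgHom.id k _)
    (algHom_ext (fun v => ?_) (fun e => ?_) fun e => ?_) x
  · rw [AlgHom.comp_apply, gradingHom, IsFamily.lift_vtx, laurentEval_single, AlgHom.id_apply]
  · rw [AlgHom.comp_apply, gradingHom, IsFamily.lift_arr, laurentEval_single, AlgHom.id_apply]
  · rw [AlgHom.comp_apply, gradingHom, IsFamily.lift_gho, laurentEval_single, AlgHom.id_apply]

section

variable {M : Type*} [AddCommGroup M] [Module (LeavittPathAlgebra k V) M]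
  (hM : ∀ v : V, IsQuiverSink v → ∀ m : M, vtx k v • m = 0)

include hM

theorem eq_zero_of_gho_smul {m : M} (h : ∀ e : QuiverArrow V, gho k e • m = 0) : m = 0 := by
  rw [← sum_smul (k := k) (V := V) m, Finset.sum_eq_zero fun e _ => by rw [h, smul_zero],
    Finset.sum_eq_zero fun v _ => ?_, add_zero]
  split_ifs with hv
  exacts [hM v hv m, rfl]

/-- The degree argument applies to `B ∩ N` inside `N` and gives `B ∩ N = 0`. As every element of `N`
is rebuilt from `B ∩ N`, also `N = 0`. -/
theorem eq_bot_of_projective_leavitt [Module k M] [IsScalarTower k (LeavittPathAlgebra k V) M]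
    {B : Submodule k M} (hB : IsGhostStable V B) [FiniteDimensional k B]
    (hspan : Submodule.span (LeavittPathAlgebra k V) (B : Set M) = ⊤)
    (N : Submodule (LeavittPathAlgebra k V) M) [Module.Projective (LeavittPathAlgebra k V) N] :
    N = ⊥ := by
  let i : N →ₗ[k] M := N.subtype.restrictScalars k
  have hfin : FiniteDimensional k (B.comap i) := by
    refine Module.Finite.of_injective (i.restrict (p := B.comap i) (q := B) fun _ h => h) ?_
    exact fun x y hxy => Subtype.ext (Subtype.ext (congrArg (fun z : B => (z : M)) hxy))
  have h := Submodule.eq_bot_of_projective_of_degree (gradingHom k V) gradingHom_injective (gho k)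
    (fun e => isFamily_single.lift_gho e) (B.comap i) (fun e b hb => hB.2 e b hb)
    fun b _ h0 => Subtype.ext (eq_zero_of_gho_smul hM fun e => congrArg Subtype.val (h0 e))
  refine (Submodule.eq_bot_iff _).mpr fun m hm => ?_
  obtain ⟨n, hn⟩ := hB.exists_mem_eventual_inf hspan hm
  have hbot : B ⊓ N.restrictScalars k = ⊥ := (Submodule.eq_bot_iff _).mpr fun b hb =>
    congrArg Subtype.val ((Submodule.eq_bot_iff _).mp h ⟨b, hb.2⟩ hb.1)
  rw [hbot, eventual_bot] at hn
  exact hn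

/-- Here the finite-dimensional subspace is all of `B`, and P(E̅) is graded with its arrows in
degree `-1`. -/
theorem eq_bot_of_projective_inverse [Module (PathAlgebra k Vᵒᵖ) M]
    [IsScalarTower (PathAlgebra k Vᵒᵖ) (LeavittPathAlgebra k V) M] [Module k M]
    [IsScalarTower k (PathAlgebra k Vᵒᵖ) M] (A : Submodule (PathAlgebra k Vᵒᵖ) M)
    [hA : FiniteDimensional k A] (B : Submodule (PathAlgebra k Vᵒᵖ) M) (hBA : B ≤ A)
    [Module.Projective (PathAlgebra k Vᵒᵖ) B] : B = ⊥ := by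
  have hA' : FiniteDimensional k (A.restrictScalars k) := hA
  have hB : FiniteDimensional k B := Submodule.finiteDimensional_of_le
    (S₁ := B.restrictScalars k) (S₂ := A.restrictScalars k) hBA
  have h := Submodule.eq_bot_of_projective_of_degree (PathAlgebra.gradingHom k Vᵒᵖ)
    PathAlgebra.gradingHom_injective
    (fun e : QuiverArrow Vᵒᵖ => PathAlgebra.arrow k e.2.2)
    (fun e => PathAlgebra.lift_arrow _ e.2.2) (⊤ : Submodule k B) (fun _ _ _ => trivial)
    fun b _ h0 => Subtype.ext (eq_zero_of_gho_smul hM fun e => by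
      have h1 := ofInversePathAlgebra_arrow (k := k) e.2.2.op
      change _ = gho k e at h1
      rw [← h1, ofInversePathAlgebra_smul]
      exact congrArg Subtype.val (h0 ⟨_, _, e.2.2.op⟩))
  exact (Submodule.eq_bot_iff _).mpr fun b hb =>
    congrArg Subtype.val ((Submodule.eq_bot_iff _).mp h ⟨b, hb⟩ trivial)

end

end LeavittPathAlgebra

end

/-! ### Filtrations by path lengths, and germs of functions on paths -/

noncomputable section

namespace LeavittPathAlgebra

variable {k : Type u} [Field k] {V : Type} [Quiver.{0} V] [Fintype V]
  [∀ v w : V, Fintype (v ⟶ w)]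

section bifiltration

variable {Y : Type*} [AddCommGroup Y] [Module k Y] [Module (LeavittPathAlgebra k V) Y]
  [IsScalarTower k (LeavittPathAlgebra k V) Y]

variable (k V) in
/-- The span of the elements `β̅ x`, for `x` in a set `S` and paths `β` of length at most `d`. -/
abbrev ghostFiltration (S : Set Y) (d : ℕ) : Submodule k Y :=
  filtration (V := V) (gho k) (vertexSpan k V S) d

variable (k V) in
/-- The span of the elements `α β̅ x`, for `x` in a set `S` and paths `α`, `β` of lengths at most
`n` and `d`. -/
abbrev biFiltration (S : Set Y) (d n : ℕ) : Submodule k Y :=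
  filtration (V := V) (arr k) (ghostFiltration k V S d) n

theorem vtx_smul_mem_ghostFiltration (S : Set Y) (d : ℕ) (v : V) {y : Y}
    (hy : y ∈ ghostFiltration k V S d) : vtx k v • y ∈ ghostFiltration k V S d :=
  vtx_smul_mem_filtration (fun v _ => vtx_smul_mem_vertexSpan S v) vtx_mul_gho_eq_or d v hy

theorem vtx_smul_mem_biFiltration (S : Set Y) (d n : ℕ) (v : V) {y : Y}
    (hy : y ∈ biFiltration k V S d n) : vtx k v • y ∈ biFiltration k V S d n :=
  vtx_smul_mem_filtration (fun v _ => vtx_smul_mem_ghostFiltration S d v) vtx_mul_arr_eq_or n v hy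

theorem biFiltration_mono (S : Set Y) {d d' n n' : ℕ} (hd : d ≤ d') (hn : n ≤ n') :
    biFiltration k V S d n ≤ biFiltration k V S d' n' :=
  (filtration_monotone _ _ hn).trans (filtration_mono (filtration_monotone _ _ hd) n')

/-- A ghost shortens or kills a nontrivial `α`; if `α` is trivial, it lengthens `β̅`. The total `d +
n` does not grow, which is why a bound on the relations persists under ghosts. -/
theorem gho_smul_mem_biFiltration {S : Set Y} {d n : ℕ} (e : QuiverArrow V) {y : Y}
    (hy : y ∈ biFiltration k V S d (n + 1)) : gho k e • y ∈ biFiltration k V S (d + 1) n := by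
  refine filtration_induction (n := n + 1) (C := (biFiltration k V S (d + 1) n).comap
    (Algebra.lsmul k k Y (gho k e))) (fun y hy => ?_) (fun i hi e' y hy => ?_) hy
  · exact filtration_monotone _ _ n.zero_le (smul_mem_filtration hy e)
  · change gho k e • arr k e' • y ∈ biFiltration k V S (d + 1) n
    rw [gho_smul_arr_smul]
    split_ifs
    · exact vtx_smul_mem_biFiltration S _ n _
        (biFiltration_mono S d.le_succ (Nat.lt_succ_iff.mp hi) hy)
    · exact Submodule.zero_mem _

theorem vtx_smul_mem_of_sink {S : Set Y} {d n : ℕ} {v : V} (hv : IsQuiverSink v) {y : Y}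
    (hy : y ∈ biFiltration k V S d n) : vtx k v • y ∈ ghostFiltration k V S d := by
  refine filtration_induction (n := n) (C := (ghostFiltration k V S d).comap
    (Algebra.lsmul k k Y (vtx k v))) (fun y hy => vtx_smul_mem_ghostFiltration S d v hy)
    (fun i hi e' y hy => ?_) hy
  change vtx k v • arr k e' • y ∈ ghostFiltration k V S d
  rw [vtx_smul_arr_smul_of_sink hv]
  exact Submodule.zero_mem _

theorem exists_mem_biFiltration {S : Set Y} {y : Y}
    (hy : y ∈ Submodule.span (LeavittPathAlgebra k V) S) : ∃ n, y ∈ biFiltration k V S n n := by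
  have hmem : ∀ y, y ∈ (⨆ n, biFiltration k V S n n) ↔ ∃ n, y ∈ biFiltration k V S n n :=
    fun y => Submodule.mem_iSup_of_directed _
      (monotone_nat_of_le_succ fun n => biFiltration_mono S n.le_succ n.le_succ).directed_le
  let N : Submodule (LeavittPathAlgebra k V) Y :=
    submoduleOfGenerators (⨆ n, biFiltration k V S n n)
      (fun v y hy => by
        obtain ⟨n, hn⟩ := (hmem y).mp hy
        exact (hmem _).mpr ⟨n, vtx_smul_mem_biFiltration S n n v hn⟩)
      (fun e y hy => by
        obtain ⟨n, hn⟩ := (hmem y).mp hy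
        exact (hmem _).mpr ⟨n + 1, biFiltration_mono S n.le_succ le_rfl (smul_mem_filtration hn e)⟩)
      (fun e y hy => by
        obtain ⟨n, hn⟩ := (hmem y).mp hy
        exact (hmem _).mpr ⟨n + 1, biFiltration_mono S le_rfl n.le_succ
          (gho_smul_mem_biFiltration e (biFiltration_mono S le_rfl n.le_succ hn))⟩)
  have hN : Submodule.span (LeavittPathAlgebra k V) S ≤ N :=
    Submodule.span_le.mpr fun y hy => (hmem y).mpr ⟨0, subset_vertexSpan hy⟩
  exact (hmem y).mp (hN hy)

end bifiltration

section germs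

variable (k V) (X : Type*) [AddCommGroup X] [Module k X]

/-- The paths that start at `v` and that are of length at least `n` or end at a sink. -/
def IsDeepPath : ℕ → V → List (QuiverArrow V) → Prop
  | n, v, [] => n = 0 ∨ IsQuiverSink v
  | n, v, e :: l => e.src = v ∧ IsDeepPath (n - 1) e.tgt l

variable {V} in
theorem IsDeepPath.mono {m n : ℕ} (h : n ≤ m) {v : V} {l : List (QuiverArrow V)}
    (hl : IsDeepPath V m v l) : IsDeepPath V n v l := by
  induction l generalizing m n v with
  | nil => exact hl.imp_left fun hm => Nat.le_zero.mp (h.trans_eq hm)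
  | cons e l ih => exact ⟨hl.1, ih (Nat.sub_le_sub_right h 1) hl.2⟩

/-- The functions on lists of arrows that vanish on almost all paths that are maximal, in the sense
that they are long or end at a sink. -/
def negligible : Submodule k (V → List (QuiverArrow V) → X) where
  carrier := {f | ∃ n, ∀ v l, IsDeepPath V n v l → f v l = 0}
  add_mem' := by
    rintro f g ⟨m, hm⟩ ⟨n, hn⟩
    refine ⟨max m n, fun v l h => ?_⟩
    rw [Pi.add_apply, Pi.add_apply, hm v l (h.mono (le_max_left m n)),
      hn v l (h.mono (le_max_right m n)), add_zero]
  zero_mem' := ⟨0, fun _ _ _ => rfl⟩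
  smul_mem' := by
    rintro c f ⟨m, hm⟩
    exact ⟨m, fun v l h => by rw [Pi.smul_apply, Pi.smul_apply, hm v l h, smul_zero]⟩

/-- The germs at infinity of functions on paths. -/
def Germ : Type _ := (V → List (QuiverArrow V) → X) ⧸ negligible k V X

instance : AddCommGroup (Germ k V X) :=
  inferInstanceAs (AddCommGroup ((V → List (QuiverArrow V) → X) ⧸ negligible k V X))

instance : Module k (Germ k V X) :=
  inferInstanceAs (Module k ((V → List (QuiverArrow V) → X) ⧸ negligible k V X))

namespace Germ

/-- The germ of a function. -/
def mk : (V → List (QuiverArrow V) → X) →ₗ[k] Germ k V X := (negligible k V X).mkQ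

variable {k V X}

theorem mk_surjective : Function.Surjective (mk k V X) := Submodule.mkQ_surjective _

theorem mk_eq_zero {f : V → List (QuiverArrow V) → X} :
    mk k V X f = 0 ↔ ∃ n, ∀ v l, IsDeepPath V n v l → f v l = 0 :=
  Submodule.Quotient.mk_eq_zero (negligible k V X)

variable (k) in
open Classical in
/-- The action of a vertex on functions. -/
def vtxFun (v : V) : Module.End k (V → List (QuiverArrow V) → X) where
  toFun f u l := if u = v then f u l else 0
  map_add' f g := by ext u l; simp only [Pi.add_apply]; split_ifs <;> simp
  map_smul' c f := by ext u l; simp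

variable (k) in
open Classical in
/-- The action of an arrow on functions. -/
def arrFun (e : QuiverArrow V) : Module.End k (V → List (QuiverArrow V) → X) where
  toFun f u
    | [] => 0
    | e' :: l => if e' = e ∧ u = e.src then f e.tgt l else 0
  map_add' f g := by ext u (_ | ⟨e', l⟩) <;> simp only [Pi.add_apply] <;> [simp; (split_ifs <;> simp)]
  map_smul' c f := by ext u (_ | ⟨e', l⟩) <;> simp

variable (k) in
open Classical in
/-- The action of an arrow of the inverse quiver on functions. -/
def ghoFun (e : QuiverArrow V) : Module.End k (V → List (QuiverArrow V) → X) where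
  toFun f u l := if u = e.tgt then f e.src (e :: l) else 0
  map_add' f g := by ext u l; simp only [Pi.add_apply]; split_ifs <;> simp
  map_smul' c f := by ext u l; simp

theorem vtxFun_mem (v : V) : negligible k V X ≤ (negligible k V X).comap (vtxFun k v) := by
  rintro f ⟨n, hn⟩
  refine ⟨n, fun u l h => ?_⟩
  simp only [vtxFun, LinearMap.coe_mk, AddHom.coe_mk, hn u l h, ite_self]

open Classical in
theorem arrFun_mem (e : QuiverArrow V) :
    negligible k V X ≤ (negligible k V X).comap (arrFun k e) := by
  rintro f ⟨n, hn⟩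
  refine ⟨n + 1, fun u l h => ?_⟩
  cases l with
  | nil => rfl
  | cons e' l =>
    refine ite_eq_right_iff.mpr fun he => ?_
    exact hn _ _ (he.1 ▸ h.2)

open Classical in
theorem ghoFun_mem (e : QuiverArrow V) :
    negligible k V X ≤ (negligible k V X).comap (ghoFun k e) := by
  rintro f ⟨n, hn⟩
  refine ⟨n, fun u l h => ite_eq_right_iff.mpr fun hu => hn _ _ ⟨rfl, ?_⟩⟩
  exact hu ▸ h.mono (Nat.sub_le n 1)

/-- The endomorphism of the space of germs given by an endomorphism of the space of functions. -/
def mapEnd (T : Module.End k (V → List (QuiverArrow V) → X))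
    (hT : negligible k V X ≤ (negligible k V X).comap T) : Module.End k (Germ k V X) :=
  (negligible k V X).mapQ _ T hT

theorem end_ext {S T : Module.End k (Germ k V X)} (h : ∀ f, S (mk k V X f) = T (mk k V X f)) :
    S = T :=
  LinearMap.ext fun g => by
    obtain ⟨f, rfl⟩ := mk_surjective g
    exact h f

-- The relations hold already for functions, except the last one, which can fail at lists that are
-- not paths from the given vertex and at the empty path of a vertex that is not a sink. Germs
-- ignore both.
variable (k V X) in
theorem isFamily_mapEnd :
    IsFamily (fun v : V => (mapEnd (vtxFun k v) (vtxFun_mem v) : Module.End k (Germ k V X)))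
      (fun e => mapEnd (arrFun k e) (arrFun_mem e)) (fun e => mapEnd (ghoFun k e) (ghoFun_mem e)) where
  idem v := end_ext fun f => by
    refine congrArg (mk k V X) (funext₂ fun u l => ?_)
    simp only [vtxFun, LinearMap.coe_mk, AddHom.coe_mk]
    split_ifs <;> rfl
  orthogonal v w h := end_ext fun f => by
    refine (congrArg (mk k V X) (funext₂ fun u l => ?_)).trans (map_zero (mk k V X))
    simp only [vtxFun, LinearMap.coe_mk, AddHom.coe_mk]
    split_ifs with h1 h2
    exacts [absurd (h1.symm.trans h2) h, rfl, rfl]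
  sum_eq_one := end_ext fun f => by
    classical
    rw [LinearMap.sum_apply]
    refine (map_sum (mk k V X) (fun v => vtxFun k v f) _).symm.trans
      (congrArg (mk k V X) (funext₂ fun u l => ?_))
    simp [vtxFun]
  src_mul e := end_ext fun f => by
    refine congrArg (mk k V X) (funext₂ fun u l => ?_)
    cases l <;> simp only [vtxFun, arrFun, LinearMap.coe_mk, AddHom.coe_mk] <;> grind
  mul_tgt e := end_ext fun f => by
    refine congrArg (mk k V X) (funext₂ fun u l => ?_)
    cases l <;> simp [vtxFun, arrFun]
  tgt_mul e := end_ext fun f => by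
    refine congrArg (mk k V X) (funext₂ fun u l => ?_)
    simp only [vtxFun, ghoFun, LinearMap.coe_mk, AddHom.coe_mk]
    split_ifs <;> rfl
  mul_src e := end_ext fun f => by
    refine congrArg (mk k V X) (funext₂ fun u l => ?_)
    simp [vtxFun, ghoFun]
  gho_mul_arr e e' := by
    split_ifs with h
    · subst h
      refine end_ext fun f => congrArg (mk k V X) (funext₂ fun u l => ?_)
      simp only [vtxFun, ghoFun, arrFun, LinearMap.coe_mk, AddHom.coe_mk]
      grind
    · refine end_ext fun f =>
        (congrArg (mk k V X) (funext₂ fun u l => ?_)).trans (map_zero (mk k V X))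
      simp [ghoFun, arrFun, h]
  sum_arr_gho := by
    classical
    refine end_ext fun f => ?_
    have key : mk k V X ((∑ e, arrFun k e (ghoFun k e f) +
        ∑ v, if IsQuiverSink v then vtxFun k v f else 0) - f) = 0 := by
      -- At level one a path is nonempty or the trivial path at a sink, and there the identity holds
      -- pointwise.
      refine mk_eq_zero.mpr ⟨1, fun u l h => ?_⟩
      simp only [Pi.sub_apply, Pi.add_apply, Finset.sum_apply, sub_eq_zero]
      have hs : ∑ v, (if IsQuiverSink v then vtxFun k v f else 0 : V → List (QuiverArrow V) → X) u l =
          if IsQuiverSink u then f u l else 0 := by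
        rw [Finset.sum_eq_single u]
        · split_ifs <;> simp [vtxFun]
        · intro v _ hv
          split_ifs
          · simp [vtxFun, hv.symm]
          · rfl
        · simp
      rw [hs]
      cases l with
      | nil =>
        have hu : IsQuiverSink u := h.resolve_left one_ne_zero
        rw [if_pos hu]
        simp [arrFun]
      | cons e l =>
        obtain ⟨rfl, -⟩ := h
        rw [if_neg fun hu : IsQuiverSink e.src => hu e rfl, add_zero, Finset.sum_eq_single e]
        · simp [arrFun, ghoFun]
        · intro e' _ he
          simp [arrFun, he.symm]
        · simp
    rw [map_sub, sub_eq_zero, map_add, map_sum, map_sum] at key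
    refine Eq.trans ?_ key
    rw [LinearMap.add_apply, LinearMap.sum_apply, LinearMap.sum_apply]
    refine congrArg₂ _ rfl (Finset.sum_congr rfl fun v _ => ?_)
    split_ifs
    · rfl
    · exact (map_zero (mk k V X)).symm

instance : Module (LeavittPathAlgebra k V) (Germ k V X) :=
  Module.compHom _ (isFamily_mapEnd k V X).lift.toRingHom

instance : IsScalarTower k (LeavittPathAlgebra k V) (Germ k V X) :=
  IsScalarTower.of_algebraMap_smul fun c g => by
    change (isFamily_mapEnd k V X).lift (algebraMap _ _ c) g = _
    rw [AlgHom.commutes]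
    rfl

theorem vtx_smul_mk (v : V) (f : V → List (QuiverArrow V) → X) :
    vtx k v • mk k V X f = mk k V X (vtxFun k v f) := by
  change (isFamily_mapEnd k V X).lift (vtx k v) _ = _
  rw [IsFamily.lift_vtx]
  rfl

theorem gho_smul_mk (e : QuiverArrow V) (f : V → List (QuiverArrow V) → X) :
    gho k e • mk k V X f = mk k V X (ghoFun k e f) := by
  change (isFamily_mapEnd k V X).lift (gho k e) _ = _
  rw [IsFamily.lift_gho]
  rfl

end Germ

end germs

end LeavittPathAlgebra

end

/-! ### Twisting the ghosts, and exchanging a vector for a free generator -/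

noncomputable section

namespace LeavittPathAlgebra

variable {k : Type u} [Field k] {V : Type} [Quiver.{0} V] [Fintype V]
  [∀ v w : V, Fintype (v ⟶ w)]

section hat

variable {X : Type*} [AddCommGroup X] [Module k X] [Module (LeavittPathAlgebra k V) X]
  [IsScalarTower k (LeavittPathAlgebra k V) X]

variable (V) in
/-- The function on paths that sends a path `e_1 ⋯ e_n` with endpoint `v` to
`p_v τ e̅_n τ ⋯ e̅_1 τ x`. -/
def twistedFun (τ : Module.End k X) : V → List (QuiverArrow V) → Module.End k X
  | v, [] => Algebra.lsmul k k X (vtx k v) * τ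
  | _, e :: l => twistedFun τ e.tgt l * Algebra.lsmul k k X (gho k e) * τ

variable (V) in
/-- The germ of the function `twistedFun`. -/
def twistedGerm (τ : Module.End k X) : X →ₗ[k] Germ k V X :=
  Germ.mk k V X ∘ₗ LinearMap.pi fun v => LinearMap.pi fun l => twistedFun V τ v l

variable {τ : Module.End k X}

/-- In each value of `twistedFun` the first operator applied is `τ`, so the germ depends only on `τ
x`. This is what identifies `c` with the free generator. -/
theorem twistedGerm_eq_of_eq {x y : X} (h : τ x = τ y) :
    twistedGerm V τ x = twistedGerm V τ y := by
  refine congrArg (Germ.mk k V X) (funext₂ fun v l => ?_)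
  change twistedFun V τ v l x = twistedFun V τ v l y
  cases l <;> simp [twistedFun, h]

open Classical in
theorem twistedFun_vtx_smul (hτ : ∀ (v : V) x, τ (vtx k v • x) = vtx k v • τ x) (u v : V) (x : X)
    {l : List (QuiverArrow V)} (hl : IsDeepPath V 0 v l) :
    twistedFun V τ v l (vtx k u • x) = if v = u then twistedFun V τ v l x else 0 := by
  cases l with
  | nil =>
    change vtx k v • τ (vtx k u • x) = if v = u then vtx k v • τ x else 0
    rw [hτ, vtx_smul_vtx_smul]
  | cons e l =>
    obtain ⟨rfl, -⟩ := hl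
    change twistedFun V τ e.tgt l (gho k e • τ (vtx k u • x)) =
      if e.src = u then twistedFun V τ e.tgt l (gho k e • τ x) else 0
    rw [hτ, gho_smul_vtx_smul]
    by_cases h : u = e.src
    · rw [if_pos h, if_pos h.symm]
    · rw [if_neg h, if_neg (Ne.symm h), map_zero]

theorem vtx_smul_twistedGerm (hτ : ∀ (v : V) x, τ (vtx k v • x) = vtx k v • τ x) (u : V) (x : X) :
    vtx k u • twistedGerm V τ x = twistedGerm V τ (vtx k u • x) := by
  rw [twistedGerm, LinearMap.comp_apply, LinearMap.comp_apply, Germ.vtx_smul_mk, ← sub_eq_zero,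
    ← map_sub, Germ.mk_eq_zero]
  refine ⟨0, fun v l hl => sub_eq_zero.mpr ?_⟩
  exact (twistedFun_vtx_smul hτ u v x hl).symm

/-- A ghost prepends its arrow to the path, and evaluation there begins with `τ` followed by `e̅`.
So the action of `e̅` on germs corresponds to the twisted ghost `e̅ τ` on `X`. -/
theorem gho_smul_twistedGerm (hτ : ∀ (v : V) x, τ (vtx k v • x) = vtx k v • τ x)
    (e : QuiverArrow V) (x : X) :
    gho k e • twistedGerm V τ x = twistedGerm V τ (gho k e • τ x) := by
  classical
  rw [twistedGerm, LinearMap.comp_apply, LinearMap.comp_apply, Germ.gho_smul_mk, ← sub_eq_zero,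
    ← map_sub, Germ.mk_eq_zero]
  refine ⟨0, fun v l hl => sub_eq_zero.mpr ?_⟩
  have h := twistedFun_vtx_smul hτ e.tgt v (gho k e • τ x) hl
  rw [smul_smul, (isFamily k).tgt_mul] at h
  refine Eq.trans ?_ h.symm
  change (if v = e.tgt then twistedFun V τ e.tgt l (gho k e • τ x) else 0) = _
  by_cases hv : v = e.tgt
  · subst hv; rfl
  · rw [if_neg hv, if_neg hv]

variable {Y : Type*} [AddCommGroup Y] [Module (LeavittPathAlgebra k V) Y]
  {j : Y →ₗ[LeavittPathAlgebra k V] X}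

/-- On the image of `j` twisted and true ghosts agree, and `sum_smul` in the module of germs
recovers the arrows from them. -/
theorem arr_smul_twistedGerm (hτ : ∀ (v : V) x, τ (vtx k v • x) = vtx k v • τ x)
    (hj : ∀ y, τ (j y) = j y) (e : QuiverArrow V) (y : Y) :
    arr k e • twistedGerm V τ (j y) = twistedGerm V τ (j (arr k e • y)) := by
  classical
  have h := sum_smul (k := k) (V := V) (twistedGerm V τ (j (arr k e • y)))
  rw [← h, Finset.sum_eq_single e, Finset.sum_eq_zero, add_zero]
  · rw [gho_smul_twistedGerm hτ, hj, ← map_smul j, gho_smul_arr_smul, if_pos rfl, map_smul j,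
      ← vtx_smul_twistedGerm hτ, smul_smul, (isFamily k).mul_tgt]
  · intro v _
    split_ifs with hv
    · rw [vtx_smul_twistedGerm hτ, ← map_smul j, vtx_smul_arr_smul_of_sink hv, map_zero, map_zero]
    · rfl
  · intro e' _ he
    rw [gho_smul_twistedGerm hτ, hj, ← map_smul j, gho_smul_arr_smul, if_neg he, map_zero, map_zero,
      smul_zero]
  · simp

theorem smul_twistedGerm (hτ : ∀ (v : V) x, τ (vtx k v • x) = vtx k v • τ x)
    (hj : ∀ y, τ (j y) = j y) (l : LeavittPathAlgebra k V) (y : Y) :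
    l • twistedGerm V τ (j y) = twistedGerm V τ (j (l • y)) := by
  let S : Subalgebra k (LeavittPathAlgebra k V) :=
    { carrier := {l | ∀ y, l • twistedGerm V τ (j y) = twistedGerm V τ (j (l • y))}
      mul_mem' := fun {a b} ha hb y => by rw [mul_smul, hb, ha, mul_smul]
      add_mem' := fun {a b} ha hb y => by rw [add_smul, ha, hb, add_smul, map_add, map_add]
      algebraMap_mem' := fun c y => by
        rw [algebraMap_smul, map_smul j, algebraMap_smul, map_smul] }
  have : l ∈ S := by
    rw [subalgebra_eq_top S (fun v y => ?_) (fun e y => arr_smul_twistedGerm hτ hj e y)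
      fun e y => ?_]
    · trivial
    · rw [vtx_smul_twistedGerm hτ, map_smul j]
    · rw [gho_smul_twistedGerm hτ, hj, map_smul j]
  exact this y

/-- Since `τ` fixes the image of `j`, vanishing of the germ says that long ghost words, and those
ending at sinks, annihilate `j y`; `sum_smul` then rebuilds `j y` from zeros. -/
theorem eq_zero_of_twistedGerm_eq_zero (hτ : ∀ (v : V) x, τ (vtx k v • x) = vtx k v • τ x)
    (hj : ∀ y, τ (j y) = j y) {y : Y} (hy : twistedGerm V τ (j y) = 0) : j y = 0 := by
  classical
  obtain ⟨n, hn⟩ := Germ.mk_eq_zero.mp hy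
  change ∀ v l, IsDeepPath V n v l → twistedFun V τ v l (j y) = 0 at hn
  clear hy
  induction n generalizing y with
  | zero =>
    rw [← sum_vtx_smul (k := k) (V := V) (j y)]
    refine Finset.sum_eq_zero fun v _ => ?_
    have h : vtx k v • τ (j y) = 0 := hn v [] (.inl rfl)
    rwa [hj] at h
  | succ n ih =>
    rw [← sum_smul (k := k) (V := V) (j y), Finset.sum_eq_zero, Finset.sum_eq_zero, add_zero]
    · intro v _
      split_ifs with hv
      · have h : vtx k v • τ (j y) = 0 := hn v [] (.inr hv)
        rwa [hj] at h
      · rfl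
    · intro e _
      rw [← map_smul, ih, smul_zero]
      intro v l hl
      have h := twistedFun_vtx_smul hτ e.tgt v (j (gho k e • y)) (hl.mono n.zero_le)
      rw [← map_smul, smul_smul, (isFamily k).tgt_mul] at h
      rw [h]
      split_ifs with hv
      · have h' : twistedFun V τ e.tgt l (gho k e • τ (j y)) = 0 := hn e.src (e :: l) ⟨rfl, hv ▸ hl⟩
        rw [hv, map_smul]
        rwa [hj] at h'
      · rfl

end hat

section presentation

variable {M : Type*} [AddCommGroup M] [Module k M] [Module (LeavittPathAlgebra k V) M]
  [IsScalarTower k (LeavittPathAlgebra k V) M]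

/-- The endomorphism `(m, l) ↦ (m - λ(m) c, l + λ(m) p_v)` of `M × L(E)`. -/
def exchange (v : V) (c : M) (f : M →ₗ[k] k) : Module.End k (M × LeavittPathAlgebra k V) :=
  LinearMap.id + (f ∘ₗ LinearMap.fst k M _).smulRight (-c, vtx k v)

theorem exchange_apply (v : V) (c : M) (f : M →ₗ[k] k) (x : M × LeavittPathAlgebra k V) :
    exchange v c f x = x + f x.1 • (-c, vtx k v) := rfl

variable {v : V} {c : M} {f : M →ₗ[k] k}

-- The functional `f` and the vector `(-c, p_v)` are both concentrated at the vertex `v`.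
open Classical in
theorem exchange_vtx_smul (hc : vtx k v • c = c)
    (hf : ∀ (u : V) m, f (vtx k u • m) = if u = v then f m else 0) (u : V)
    (x : M × LeavittPathAlgebra k V) : exchange v c f (vtx k u • x) = vtx k u • exchange v c f x := by
  have h : vtx k u • (-c, vtx k v) =
      if u = v then ((-c, vtx k v) : M × LeavittPathAlgebra k V) else 0 := by
    split_ifs with h
    · rw [h, Prod.smul_mk, smul_neg, hc, smul_eq_mul, (isFamily k).idem]
    · rw [Prod.smul_mk, smul_neg, ← hc, vtx_smul_vtx_smul, if_neg h, neg_zero, smul_eq_mul,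
        (isFamily k).orthogonal _ _ h]
      rfl
  rw [exchange_apply, exchange_apply, smul_add, smul_comm, h, Prod.smul_fst, hf]
  split_ifs <;> simp

variable {s : Finset M}

open Classical in
/-- If the coordinate `f` vanishes where it should, the relations of a finitely presented module
also hold for the vector of germs that arises from replacing `c` by a free generator of the
projective module `L(E) p_v`. -/
theorem mul_vtx_eq_zero_of_smul_eq_zero (hc : vtx k v • c = c)
    (hf : ∀ (u : V) m, f (vtx k u • m) = if u = v then f m else 0) (hfc : f c = 1) {D : ℕ}
    (hD : ∀ i < D, ∀ r ∈ ghostFiltration k V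
      (Set.range fun i : s => Finsupp.single i (1 : LeavittPathAlgebra k V)) i,
      ∀ e, f (Finsupp.linearCombination (LeavittPathAlgebra k V) ((↑) : s → M) r) •
        (gho k e * vtx k v) = 0)
    {T : Set (s →₀ LeavittPathAlgebra k V)}
    (hT : Submodule.span (LeavittPathAlgebra k V) T =
      LinearMap.ker (Finsupp.linearCombination (LeavittPathAlgebra k V) ((↑) : s → M)))
    (hTD : ∀ t ∈ T, ∃ d n, d + n ≤ D ∧ t ∈ biFiltration k V
      (Set.range fun i : s => Finsupp.single i (1 : LeavittPathAlgebra k V)) d n)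
    {r : s →₀ LeavittPathAlgebra k V}
    (hr : r ∈ ghostFiltration k V
      (Set.range fun i : s => Finsupp.single i (1 : LeavittPathAlgebra k V)) D)
    (hrc : Finsupp.linearCombination (LeavittPathAlgebra k V) ((↑) : s → M) r = c)
    {l : LeavittPathAlgebra k V} (hl : l • c = 0) : l * vtx k v = 0 := by
  classical
  set S : Set (s →₀ LeavittPathAlgebra k V) :=
    Set.range fun i : s => Finsupp.single i (1 : LeavittPathAlgebra k V) with hS
  set π := Finsupp.linearCombination (LeavittPathAlgebra k V) ((↑) : s → M)
  let τ := exchange v c f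
  have hτ : ∀ (u : V) x, τ (vtx k u • x) = vtx k u • τ x := exchange_vtx_smul hc hf
  let Ψ : (s →₀ LeavittPathAlgebra k V) →ₗ[LeavittPathAlgebra k V]
      Germ k V (M × LeavittPathAlgebra k V) :=
    Finsupp.linearCombination _ fun i : s => twistedGerm V τ (i.1, 0)
  -- By `hD`, the correction that `τ` inserts before each ghost is annihilated by this ghost, so the
  -- twist is invisible on ghost words of length at most `D`.
  have hΨ : ∀ d ≤ D, ∀ r ∈ ghostFiltration k V S d, Ψ r = twistedGerm V τ (π r, 0) := by
    intro d
    induction d using Nat.strong_induction_on with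
    | _ d ih =>
    intro hd r hr
    let C : Submodule k (s →₀ LeavittPathAlgebra k V) := LinearMap.ker
      (Ψ.restrictScalars k - twistedGerm V τ ∘ₗ LinearMap.inl k M (LeavittPathAlgebra k V) ∘ₗ
        π.restrictScalars k)
    have hC : ∀ r, r ∈ C ↔ Ψ r = twistedGerm V τ (π r, 0) := fun r => by
      simp [C, sub_eq_zero]
    refine (hC r).mp (filtration_induction (n := d) (C := C) (Submodule.span_le.mpr ?_)
      (fun i hi e r hr' => ?_) hr)
    · rintro _ ⟨u, -, _, ⟨i, rfl⟩, rfl⟩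
      refine (hC _).mpr ?_
      simp only [map_smul, Ψ, π, Finsupp.linearCombination_single, one_smul]
      rw [vtx_smul_twistedGerm hτ, Prod.smul_mk, smul_zero]
    · have hr0 := (hD i (hi.trans_le hd) r hr' e)
      refine (hC _).mpr ?_
      rw [map_smul, map_smul, ih i hi (hi.trans_le hd).le r hr', gho_smul_twistedGerm hτ]
      refine congrArg (twistedGerm V τ) ?_
      have h0 : f (π r) • gho k e • ((-c, vtx k v) : M × LeavittPathAlgebra k V) = 0 := by
        refine Prod.ext ?_ hr0
        change f (π r) • gho k e • (-c) = 0
        rw [smul_neg, smul_neg, ← hc, smul_smul (gho k e), ← smul_assoc, hr0, zero_smul, neg_zero]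
      rw [exchange_apply, smul_add, smul_comm, h0, add_zero, Prod.smul_mk, smul_zero]
  -- Ghosts trade arrow length `n` for ghost length `d` within the bound `D`, until `hΨ` applies;
  -- `sum_smul` then rebuilds `Ψ r` from zeros.
  have hker : ∀ n d, d + n ≤ D → ∀ r ∈ biFiltration k V S d n, π r = 0 → Ψ r = 0 := by
    intro n
    induction n with
    | zero =>
      intro d hd r hr hr0
      rw [hΨ d hd r hr, hr0]
      exact map_zero (twistedGerm V τ)
    | succ n ih =>
      intro d hd r hr hr0
      rw [← sum_smul (k := k) (V := V) (Ψ r), Finset.sum_eq_zero, Finset.sum_eq_zero, add_zero]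
      · intro u _
        split_ifs with hu
        · rw [← map_smul, hΨ d (by omega) _ (vtx_smul_mem_of_sink hu hr), map_smul, hr0, smul_zero]
          exact map_zero (twistedGerm V τ)
        · rfl
      · intro e _
        rw [← map_smul, ih (d + 1) (by omega) _ (gho_smul_mem_biFiltration e hr), smul_zero]
        rw [map_smul, hr0, smul_zero]
  have hle : LinearMap.ker π ≤ LinearMap.ker Ψ := hT ▸ Submodule.span_le.mpr fun t ht => by
    obtain ⟨d, n, hdn, htm⟩ := hTD t ht
    exact hker n d hdn t htm (hT ▸ Submodule.subset_span ht : t ∈ LinearMap.ker π)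
  have h1 : Ψ (l • r) = 0 := hle (show π (l • r) = 0 by rw [map_smul, hrc, hl])
  let j : LeavittPathAlgebra k V →ₗ[LeavittPathAlgebra k V] M × LeavittPathAlgebra k V :=
    LinearMap.inr _ _ _
  have hj : ∀ y, τ (j y) = j y := fun y => by
    rw [exchange_apply]
    simp [j]
  -- As `f c = 1`, the exchange carries `(c, 0)` to `(0, p_v)`, which it fixes.
  have h2 : τ (c, 0) = τ (j (vtx k v)) := by
    rw [hj, exchange_apply, hfc]
    simp [j]
  rw [map_smul, hΨ D le_rfl r hr, hrc, twistedGerm_eq_of_eq h2, smul_twistedGerm hτ hj] at h1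
  exact congrArg Prod.snd (eq_zero_of_twistedGerm_eq_zero hτ hj h1)

end presentation

end LeavittPathAlgebra

end

/-! ### Finitely presented modules without nonzero projective submodules -/

noncomputable section

/-- In a module without nonzero projective submodules, an element whose annihilator is that of an
idempotent vanishes. -/
theorem eq_zero_of_annihilator_le {R M : Type*} [Ring R] [AddCommGroup M] [Module R M]
    (hproj : ∀ N : Submodule R M, Module.Projective R N → N = ⊥) {p : R} {c : M} (hpc : p • c = c)
    (h : ∀ r : R, r • c = 0 → r * p = 0) : c = 0 := by
  let q := LinearMap.toSpanSingleton R M c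
  -- The map `r c ↦ r p` is well defined by `h`, and `p c = c` makes it a section of `r ↦ r c`; so
  -- the submodule generated by `c` is a summand of `R`.
  let i : LinearMap.range q →ₗ[R] R :=
    (LinearMap.ker q).liftQ (LinearMap.toSpanSingleton R R p) (fun r hr => h r hr) ∘ₗ
      q.quotKerEquivRange.symm.toLinearMap
  have hi : ∀ r : R, i (q.rangeRestrict r) = r * p := fun r => by
    have : q.quotKerEquivRange.symm (q.rangeRestrict r) = (LinearMap.ker q).mkQ r := by
      rw [LinearEquiv.symm_apply_eq]
      rfl
    rw [LinearMap.comp_apply, LinearEquiv.coe_coe, this]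
    rfl
  have hN := hproj (LinearMap.range q) (Module.Projective.of_split i q.rangeRestrict (by
    refine LinearMap.ext fun x => ?_
    obtain ⟨r, rfl⟩ := q.surjective_rangeRestrict x
    rw [LinearMap.comp_apply, hi]
    refine Subtype.ext ?_
    change (r * p) • c = r • c
    rw [mul_smul, hpc]))
  have hc : c ∈ LinearMap.range q := ⟨1, one_smul R c⟩
  rwa [hN] at hc

namespace LeavittPathAlgebra

variable {k : Type u} [Field k] {V : Type} [Quiver.{0} V] [Fintype V]
  [∀ v w : V, Fintype (v ⟶ w)]
  {M : Type*} [AddCommGroup M] [Module k M] [Module (LeavittPathAlgebra k V) M]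
  [IsScalarTower k (LeavittPathAlgebra k V) M]

-- Composing a separating functional with `p_v` concentrates it at `v`; it still vanishes on `W`
-- because `W` is stable under vertices.
open Classical in
theorem exists_coordinate {W : Submodule k M} (hW : ∀ v : V, ∀ m ∈ W, vtx k v • m ∈ W) {v : V}
    {c : M} (hc : vtx k v • c = c) (hcW : c ∉ W) :
    ∃ f : M →ₗ[k] k, f c = 1 ∧ (∀ m ∈ W, f m = 0) ∧
      ∀ (u : V) m, f (vtx k u • m) = if u = v then f m else 0 := by
  obtain ⟨g, hgc, hgW⟩ := Submodule.exists_le_ker_of_notMem hcW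
  refine ⟨(g c)⁻¹ • g ∘ₗ Algebra.lsmul k k M (vtx k v), ?_, fun m hm => ?_, fun u m => ?_⟩
  · change (g c)⁻¹ * g (vtx k v • c) = 1
    rw [hc, inv_mul_cancel₀ hgc]
  · change (g c)⁻¹ * g (vtx k v • m) = 0
    rw [LinearMap.mem_ker.mp (hgW (hW v m hm)), mul_zero]
  · change (g c)⁻¹ * g (vtx k v • vtx k u • m) = if u = v then (g c)⁻¹ * g (vtx k v • m) else 0
    rw [vtx_smul_vtx_smul]
    by_cases h : u = v
    · rw [if_pos h, if_pos h.symm]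
    · rw [if_neg h, if_neg (Ne.symm h), map_zero, mul_zero]

/-- A finitely presented module without nonzero projective submodules is finitely generated over
the path algebra and vanishes at the sinks. -/
theorem finite_and_sink [hfp : Module.FinitePresentation (LeavittPathAlgebra k V) M]
    (hproj : ∀ N : Submodule (LeavittPathAlgebra k V) M,
      Module.Projective (LeavittPathAlgebra k V) N → N = ⊥)
    [Module (PathAlgebra k V) M] [IsScalarTower (PathAlgebra k V) (LeavittPathAlgebra k V) M] :
    Module.Finite (PathAlgebra k V) M ∧ ∀ v : V, IsQuiverSink v → ∀ m : M, vtx k v • m = 0 := by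
  classical
  obtain ⟨s, hs, T, hT⟩ := hfp
  set S : Set (s →₀ LeavittPathAlgebra k V) :=
    Set.range fun i : s => Finsupp.single i (1 : LeavittPathAlgebra k V) with hS
  set π := Finsupp.linearCombination (LeavittPathAlgebra k V) ((↑) : s → M) with hπ
  have hSfin : S.Finite := Set.finite_range _
  have hspan : ∀ r, r ∈ Submodule.span (LeavittPathAlgebra k V) S := fun r => by
    refine Finsupp.induction_linear r (Submodule.zero_mem _) (fun _ _ => Submodule.add_mem _)
      fun i l => ?_
    rw [← mul_one l, ← smul_eq_mul, ← Finsupp.smul_single]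
    exact Submodule.smul_mem _ _ (Submodule.subset_span ⟨i, rfl⟩)
  have hsurj : Function.Surjective π := LinearMap.range_eq_top.mp <| by
    rw [hπ, Finsupp.range_linearCombination, Subtype.range_coe]
    exact hs
  choose d hd using fun r => exists_mem_biFiltration (k := k) (hspan r)
  -- Both path lengths in a relation from `T` are at most `T.sup d`, and it is their sum that has to
  -- stay within the bound.
  let D₀ := T.sup d + T.sup d
  have key : ∀ D, D₀ ≤ D → ∀ (v : V) (r : s →₀ LeavittPathAlgebra k V) (f : M →ₗ[k] k),
      r ∈ ghostFiltration k V S D → vtx k v • π r = π r →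
      (∀ (u : V) m, f (vtx k u • m) = if u = v then f m else 0) → f (π r) = 1 →
      (∀ i < D, ∀ r ∈ ghostFiltration k V S i, ∀ e, f (π r) • (gho k e * vtx k v) = 0) →
      False := by
    intro D hD v r f hr hc hf hfc hrel
    have h0 : π r = 0 := eq_zero_of_annihilator_le hproj hc fun l hl =>
      mul_vtx_eq_zero_of_smul_eq_zero hc hf hfc hrel hT (fun t ht => ⟨d t, d t,
        (add_le_add (Finset.le_sup ht) (Finset.le_sup ht)).trans hD, hd t⟩) hr rfl hl
    rw [h0, map_zero] at hfc
    exact zero_ne_one hfc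
  constructor
  · let W : ℕ → Submodule k M := fun D =>
      (ghostFiltration k V S D).map (π.restrictScalars k)
    have hWvtx : ∀ D, ∀ v : V, ∀ m ∈ W D, vtx k v • m ∈ W D := by
      rintro D v _ ⟨r, hr, rfl⟩
      exact ⟨vtx k v • r, vtx_smul_mem_ghostFiltration S D v hr, map_smul π _ _⟩
    -- A vector outside `W D₀` has a component `c = p_v w` outside it. A functional that vanishes on
    -- `W D₀` and is one at `c` satisfies the condition of `key`, since words shorter than `D₀ + 1`
    -- map into `W D₀`.
    have hle : W (D₀ + 1) ≤ W D₀ := by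
      by_contra hnot
      obtain ⟨w, hw, hwn⟩ := Set.not_subset.mp hnot
      obtain ⟨v, hv⟩ : ∃ v : V, vtx k v • w ∉ W D₀ := by
        by_contra! hall
        exact hwn (sum_vtx_smul (k := k) (V := V) w ▸ Submodule.sum_mem _ fun v _ => hall v)
      have hc : vtx k v • vtx k v • w = vtx k v • w := by rw [vtx_smul_vtx_smul, if_pos rfl]
      obtain ⟨f, hfc, hfW, hf⟩ := exists_coordinate (hWvtx D₀) hc hv
      obtain ⟨r, hr, hrw⟩ := hWvtx (D₀ + 1) v w hw
      change π r = vtx k v • w at hrw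
      refine key (D₀ + 1) D₀.le_succ v r f hr (hrw ▸ hc) hf (hrw ▸ hfc) fun i hi r' hr' e => ?_
      rw [hfW (π r') ⟨r', filtration_monotone _ _ (Nat.lt_succ_iff.mp hi) hr', rfl⟩, zero_smul]
    have hstab : IsGhostStable V (W D₀) := ⟨hWvtx D₀, by
      rintro e _ ⟨r, hr, rfl⟩
      exact hle ⟨gho k e • r, smul_mem_filtration hr e, map_smul π _ _⟩⟩
    have hWspan : Submodule.span (LeavittPathAlgebra k V) (W D₀ : Set M) = ⊤ := by
      refine top_le_iff.mp (hs ▸ Submodule.span_mono fun x hx => ?_)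
      refine ⟨Finsupp.single ⟨x, hx⟩ 1,
        filtration_monotone _ _ D₀.zero_le (subset_vertexSpan ⟨⟨x, hx⟩, rfl⟩), ?_⟩
      exact (Finsupp.linearCombination_single _ _ _).trans (one_smul _ x)
    have : FiniteDimensional k (vertexSpan k V S) := finiteDimensional_vertexSpan hSfin
    have : FiniteDimensional k (ghostFiltration k V S D₀) := finiteDimensional_filtration D₀
    obtain ⟨b, hb⟩ : (W D₀).FG := Module.Finite.iff_fg.mp inferInstance
    have : IsScalarTower k (PathAlgebra k V) M := IsScalarTower.of_algebraMap_smul fun c y => by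
      rw [← ofPathAlgebra_smul, AlgHom.commutes, algebraMap_smul]
    refine ⟨b, ?_⟩
    rw [← top_le_iff, ← hstab.span_eq_top_iff.mpr hWspan, Submodule.span_le, ← hb]
    exact Submodule.span_le_restrictScalars k (PathAlgebra k V) _
  -- At a sink `e̅ p_v = 0` for every `e`, so the condition on shorter words is automatic and any
  -- functional detecting `p_v m` will do.
  · intro v hv m
    by_contra hm
    have hc : vtx k v • vtx k v • m = vtx k v • m := by rw [vtx_smul_vtx_smul, if_pos rfl]
    obtain ⟨f, hfc, -, hf⟩ := exists_coordinate (W := ⊥) (by simp) hc hm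
    obtain ⟨r, rfl⟩ := hsurj m
    -- The sink kills all terms that begin with an arrow, so `p_v m` is represented by ghost words
    -- alone, as `key` requires.
    have hr := vtx_smul_mem_of_sink hv (hd r)
    refine key (max D₀ (d r)) (le_max_left _ _) v (vtx k v • r) f
      (filtration_monotone _ _ (le_max_right _ _) hr) (by rw [map_smul, hc]) hf
      (by rw [map_smul, hfc]) fun i _ r' _ e => ?_
    rw [← (isFamily k).mul_src, mul_assoc, (isFamily k).orthogonal _ _ (hv e), mul_zero, smul_zero]

end LeavittPathAlgebra

open LeavittPathAlgebra in
theorem isFNP_iff {k : Type u} [Field k] {V : Type} [Quiver.{0} V] [Fintype V]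
    [∀ v w : V, Fintype (v ⟶ w)] {M : Type w} [AddCommGroup M] [Module (LeavittPathAlgebra k V) M]
    [Module (PathAlgebra k V) M] [IsScalarTower (PathAlgebra k V) (LeavittPathAlgebra k V) M] :
    (Module.Finite (PathAlgebra k V) M ∧ IsBlanchfield k V M) ↔
      IsFNP (LeavittPathAlgebra k V) M := by
  let _ : Module k M := Module.compHom M (algebraMap k (LeavittPathAlgebra k V))
  have : IsScalarTower k (LeavittPathAlgebra k V) M :=
    IsScalarTower.of_algebraMap_smul fun _ _ => rfl
  rw [isBlanchfield_iff_sink]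
  constructor
  · rintro ⟨hfin, hM⟩
    obtain ⟨B, hfd, hB, hspan⟩ := exists_isGhostStable (k := k) (V := V) (M := M)
    exact ⟨hB.finitePresentation hspan, hB.isFiniteLength hspan, fun N _ =>
      eq_bot_of_projective_leavitt hM hB hspan N⟩
  · intro h
    have := h.finitePresentation
    exact finite_and_sink h.eq_bot_of_projective

end

theorem proposition7p3 (k : Type u) [Field k] (V : Type) [Quiver.{0} V] [Fintype V]
    [∀ v w : V, Fintype (v ⟶ w)] :
    -- Blanchfield `P(E)`-modules are `L(E)`-modules in a unique way.
    (∀ (M : Type w) [AddCommGroup M] [Module (PathAlgebra k V) M],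
      IsBlanchfield k V M →
        ∃! _inst : Module (LeavittPathAlgebra k V) M,
          IsScalarTower (PathAlgebra k V) (LeavittPathAlgebra k V) M) ∧
    -- The f.g. Blanchfield modules among the `L(E)`-modules.
    (∀ (M : Type w) [AddCommGroup M] [Module (LeavittPathAlgebra k V) M]
      [Module (PathAlgebra k V) M] [IsScalarTower (PathAlgebra k V) (LeavittPathAlgebra k V) M],
      (Module.Finite (PathAlgebra k V) M ∧ IsBlanchfield k V M) ↔
        IsFNP (LeavittPathAlgebra k V) M) ∧
    -- Lattices in a f.g. Blanchfield module, regarded as an `L(E)`-module.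
    (∀ (M : Type w) [AddCommGroup M] [Module (LeavittPathAlgebra k V) M]
      [Module (PathAlgebra k V) M] [IsScalarTower (PathAlgebra k V) (LeavittPathAlgebra k V) M]
      [Module (PathAlgebra k Vᵒᵖ) M]
      [IsScalarTower (PathAlgebra k Vᵒᵖ) (LeavittPathAlgebra k V) M]
      [Module k M] [IsScalarTower k (PathAlgebra k Vᵒᵖ) M],
      Module.Finite (PathAlgebra k V) M → IsBlanchfield k V M →
        (∃ A : Submodule (PathAlgebra k Vᵒᵖ) M, LeavittPathAlgebra.IsLattice A) ∧
        (∀ A : Submodule (PathAlgebra k Vᵒᵖ) M, LeavittPathAlgebra.IsLattice A ↔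
          FiniteDimensional k A ∧ Function.Bijective (LeavittPathAlgebra.tensorToModule A)) ∧
        (∀ A : Submodule (PathAlgebra k Vᵒᵖ) M, LeavittPathAlgebra.IsLattice A →
          ∀ B : Submodule (PathAlgebra k Vᵒᵖ) M, B ≤ A →
            Module.Projective (PathAlgebra k Vᵒᵖ) B → B = ⊥) ∧
        (∃ A : Submodule (PathAlgebra k Vᵒᵖ) M,
          IsLeast {A | LeavittPathAlgebra.IsLattice A} A)) := by
  refine ⟨fun M _ _ h => LeavittPathAlgebra.existsUnique_module M h, fun M _ _ _ _ => isFNP_iff,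
    fun M _ _ _ _ _ _ _ _ hfin hM => ?_⟩
  have := LeavittPathAlgebra.isScalarTower_of_inverse (k := k) (V := V) (Y := M)
  obtain ⟨B, hfd, hB, hspan⟩ := LeavittPathAlgebra.exists_isGhostStable (k := k) (V := V) (M := M)
  have hlat : ∃ A : Submodule (PathAlgebra k Vᵒᵖ) M, LeavittPathAlgebra.IsLattice A :=
    ⟨hB.toSubmodule, hfd, hB.span_eq_top_iff.mpr hspan⟩
  refine ⟨hlat, LeavittPathAlgebra.isLattice_iff, fun A hA B hBA _ => ?_,
    LeavittPathAlgebra.exists_isLeast_isLattice hlat⟩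
  have := hA.finiteDimensional
  exact LeavittPathAlgebra.eq_bot_of_projective_inverse
    (LeavittPathAlgebra.isBlanchfield_iff_sink.mp hM) A B hBA
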